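/- Let $\delta>0$. Call a function $\omega:[0,\infty)\to(0,1]$ $\delta$-admissible if it is decreasing (in the wide sense), $x\,\omega(x)\ge\delta$ for all $x\ge1$, and $\omega(2x)\ge\delta\,\omega(x)$ for all $x\ge0$. For $Q\subset\mathbb R$ let $n_Q(t)=\operatorname{card}(Q\cap[0,t))$ if $t\ge0$ and $n_Q(t)=-\operatorname{card}(Q\cap(t,0))$ if $t<0$; $Q$ is separated if $\inf\{|a-b|:a,b\in Q,\ a\ne b\}>0$. There exists $\varepsilon\in(0,1)$, depending only on $\delta$, such that the following holds. Let $(\zeta_m)_{m\in\mathbb Z}$ be a sequence of independent random variables which are either all standard real Gaussian (mean $0$, variance $1$), or all standard complex Gaussian (real and imaginary parts independent real Gaussian with mean $0$ and variance $1/2$), and let $\omega$ be $\delta$-admissible. Then, almost surely, there exists a function $F$ meromorphic in $\mathbb C$ whose set of poles $Q$ is a separated subset of $\mathbb R$ (containing no integers) such that $$F(m)=\zeta_m\,\omega(|m|),\qquad m\in\mathbb Z,$$ $$|F(z)|\le C\Bigl(1+\frac1{\operatorname{dist}(z,Q)}\Bigr),\qquad z\in\mathbb C\setminus Q,$$ $$|n_Q(t)-(1-\varepsilon)t|\le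 C\bigl(1+|t|^{2/3}\bigr),\qquad t\in\mathbb R,$$ where the constant $C$ depends only on $\delta$ and on the realization of the sequence $(\zeta_m)$ (and on whether the real or the complex case is considered), not on $\omega$. -/

import Mathlib

open MeasureTheory ProbabilityTheory

/-- Weights `ω : [0, ∞) → (0, 1]`, decreasing, with `x ω(x) ≥ δ` for `x ≥ 1` and
`ω(2x) ≥ δ ω(x)` for `x ≥ 0`. (Only the values of `ω` on `[0, ∞)` matter.) -/
structure AdmissibleWeight (δ : ℝ) (ω : ℝ → ℝ) : Prop where
  pos : ∀ x, 0 ≤ x → 0 < ω x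
  le_one : ∀ x, 0 ≤ x → ω x ≤ 1
  antitone : AntitoneOn ω (Set.Ici 0)
  lower : ∀ x, 1 ≤ x → δ ≤ x * ω x
  doubling : ∀ x, 0 ≤ x → δ * ω x ≤ ω (2 * x)

/-- A set of reals is separated if distinct points have distance bounded below. -/
def SeparatedSet (Q : Set ℝ) : Prop :=
  ∃ c : ℝ, 0 < c ∧ ∀ a ∈ Q, ∀ b ∈ Q, a ≠ b → c ≤ |a - b|

open Classical in
/-- The counting function: `card (Q ∩ [0, t))` for `t ≥ 0`, `- card (Q ∩ (t, 0))` for `t < 0`. -/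
noncomputable def countingFun (Q : Set ℝ) (t : ℝ) : ℝ :=
  if 0 ≤ t then ((Q ∩ Set.Ico 0 t).ncard : ℝ) else -((Q ∩ Set.Ioo t 0).ncard : ℝ)

/-- The set of poles of a function of one complex variable. -/
def poleSet (F : ℂ → ℂ) : Set ℂ := {z | meromorphicOrderAt F z < 0}

/-- `F` is a meromorphic function in the plane: every point is at worst a pole, and `F` is
holomorphic at each point which is not a pole (no removable singularities are left, and the value
of `F` at a pole is irrelevant). -/
def MeromorphicInPlane (F : ℂ → ℂ) : Prop :=
  MeromorphicOn F Set.univ ∧ ∀ z, z ∉ poleSet F → AnalyticAt ℂ F z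

/-- There is a meromorphic function `F` whose set of poles is exactly a separated set `Q` of
reals, which takes the (finite) values `a m` at the integers `m`, with
`|F(z)| ≤ C (1 + 1 / dist (z, Q))` off `Q` and `|n_Q(t) - (1 - ε) t| ≤ C (1 + |t|^(2/3))`. -/
def HasCauchyInterpolant (ε C : ℝ) (a : ℤ → ℂ) : Prop :=
  ∃ (F : ℂ → ℂ) (Q : Set ℝ),
    MeromorphicInPlane F ∧
    poleSet F = Complex.ofReal '' Q ∧
    SeparatedSet Q ∧
    (∀ m : ℤ, (m : ℝ) ∉ Q ∧ F (m : ℂ) = a m) ∧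
    (∀ z : ℂ, z ∉ poleSet F → ‖F z‖ ≤ C * (1 + 1 / Metric.infDist z (Complex.ofReal '' Q))) ∧
    (∀ t : ℝ, |countingFun Q t - (1 - ε) * t| ≤ C * (1 + |t| ^ (2 / 3 : ℝ)))

/-- A standard complex Gaussian variable: real and imaginary parts are independent real Gaussian
variables of mean `0` and variance `1/2`. -/
structure IsStdComplexGaussian {Ω : Type*} [MeasurableSpace Ω] (X : Ω → ℂ) (P : Measure Ω) :
    Prop where
  re : HasLaw (fun x => (X x).re) (gaussianReal 0 (1 / 2)) P
  im : HasLaw (fun x => (X x).im) (gaussianReal 0 (1 / 2)) P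
  indep : IndepFun (fun x => (X x).re) (fun x => (X x).im) P

/-! ### Admissible weights and block sums -/

namespace AdmissibleWeight

variable {δ : ℝ} {ω : ℝ → ℝ}

theorem delta_le_one (h : AdmissibleWeight δ ω) : δ ≤ 1 := by
  have h1 := h.lower 1 le_rfl
  have h2 := h.le_one 1 zero_le_one
  linarith

theorem pow_doubling (h : AdmissibleWeight δ ω) (hδ : 0 < δ) (I : ℕ) {x : ℝ} (hx : 0 ≤ x) :
    δ ^ I * ω x ≤ ω (2 ^ I * x) := by
  induction I with
  | zero => simp
  | succ k ih =>
    have := h.doubling (2 ^ k * x) (by positivity)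
    calc δ ^ (k + 1) * ω x = δ * (δ ^ k * ω x) := by ring
      _ ≤ δ * ω (2 ^ k * x) := by gcongr
      _ ≤ ω (2 * (2 ^ k * x)) := this
      _ = ω (2 ^ (k + 1) * x) := by ring_nf

theorem le_max_mul (h : AdmissibleWeight δ ω) {x : ℝ} (hx : 0 ≤ x) : δ ≤ max 1 x * ω x := by
  rcases le_total 1 x with h1 | h1
  · rw [max_eq_right h1]; exact h.lower x h1
  · rw [max_eq_left h1, one_mul]
    have := h.lower 1 le_rfl
    have h2 := h.antitone (Set.mem_Ici.2 hx) (Set.mem_Ici.2 zero_le_one) h1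
    linarith

/-- Nearby values of an admissible weight are comparable. -/
theorem le_of_le_add_two (h : AdmissibleWeight δ ω) (hδ : 0 < δ) {x y : ℝ} (hx : 0 ≤ x)
    (hy : 0 ≤ y) (hxy : y ≤ x + 2) : δ ^ 3 * ω x ≤ ω y := by
  have hd1 := h.delta_le_one
  rcases le_total 2 x with h2 | h2
  · have h3 := h.antitone (Set.mem_Ici.2 hy) (Set.mem_Ici.2 (by linarith : (0 : ℝ) ≤ 2 * x))
      (by linarith)
    have h4 := h.doubling x hx
    have h5 : δ ^ 3 * ω x ≤ δ * ω x := by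
      have := h.pos x hx
      gcongr
      exact pow_le_of_le_one hδ.le hd1 (by norm_num)
    linarith
  · have h3 := h.antitone (Set.mem_Ici.2 hy) (Set.mem_Ici.2 (by norm_num : (0 : ℝ) ≤ 2 ^ 2 * 1))
      (by linarith)
    have h4 := h.pow_doubling hδ 2 zero_le_one
    have h5 := h.lower 1 le_rfl
    have h6 := h.le_one x hx
    have h7 : δ ^ 3 * ω x ≤ δ ^ 2 * ω 1 := by
      calc δ ^ 3 * ω x ≤ δ ^ 3 * 1 := by gcongr
        _ = δ ^ 2 * δ := by ring
        _ ≤ δ ^ 2 * ω 1 := by gcongr; linarith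
    linarith

end AdmissibleWeight

/-- The distance from the origin to the block `[j, j + 1]`. -/
def blockHeight (j : ℤ) : ℤ := if 0 ≤ j then j else -j - 1

theorem blockHeight_nonneg (j : ℤ) : 0 ≤ blockHeight j := by
  unfold blockHeight; split_ifs <;> omega

theorem blockHeight_le_add (i j : ℤ) : blockHeight i ≤ blockHeight j + |i - j| := by
  unfold blockHeight
  rcases abs_cases (i - j) with h | h <;> split_ifs <;> omega

theorem blockHeight_le_abs {L x : ℝ} {j : ℤ} (hL : 0 < L) (h1 : j * L ≤ x)
    (h2 : x ≤ (j + 1) * L) :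
    L * blockHeight j ≤ |x| ∧ |x| ≤ L * (blockHeight j + 1) := by
  unfold blockHeight
  split_ifs with h
  · have h' : (0 : ℝ) ≤ j := by exact_mod_cast h
    have : 0 ≤ x := le_trans (by positivity) h1
    rw [abs_of_nonneg this]
    constructor <;> nlinarith
  · have h' : (j : ℝ) + 1 ≤ 0 := by
      have : j + 1 ≤ 0 := by omega
      exact_mod_cast this
    have : x ≤ 0 := h2.trans (by nlinarith)
    rw [abs_of_nonpos this]
    push_cast
    constructor <;> nlinarith

/-- The largest value of the weight on the `j`-th block of length `L`. -/
noncomputable def blockWeight (ω : ℝ → ℝ) (L : ℝ) (j : ℤ) : ℝ := ω (L * blockHeight j)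

/-- Points of nonadjacent blocks are far apart. -/
theorem block_dist_far {L x y : ℝ} {i j : ℤ} (hL : 0 ≤ L) (hx : i * L ≤ x) (hx' : x ≤ (i + 1) * L)
    (hy : j * L ≤ y) (hy' : y ≤ (j + 1) * L) (h : 2 ≤ |i - j|) :
    L / 3 * (1 + |(i : ℝ) - j|) ≤ |x - y| := by
  have h' : (2 : ℝ) ≤ |(i : ℝ) - j| := by exact_mod_cast h
  have key : (|(i : ℝ) - j| - 1) * L ≤ |x - y| := by
    rcases abs_cases ((i : ℝ) - j) with ⟨h4, _⟩ | ⟨h4, _⟩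
    · rw [h4]; exact le_trans (by nlinarith) (le_abs_self _)
    · rw [h4]; exact le_trans (by nlinarith) (neg_le_abs _)
  nlinarith

theorem block_dist_le {L x y c : ℝ} {i j : ℤ} (hc : 0 ≤ c) (hx : i * L ≤ x) (hx' : x ≤ (i + 1) * L)
    (hy : j * L ≤ y) (hy' : y ≤ (j + 1) * L) (h2 : 2 * c ≤ |x - y|) (h3 : 3 * c ≤ L) :
    c * (1 + |(i : ℝ) - j|) ≤ |x - y| := by
  rcases lt_or_ge |i - j| 2 with h | h
  · have : |(i : ℝ) - j| ≤ 1 := by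
      have : |i - j| ≤ 1 := by omega
      exact_mod_cast this
    nlinarith
  · refine le_trans ?_ (block_dist_far (by linarith) hx hx' hy hy' h)
    gcongr
    linarith

/-- The sum of `1 / (1 + |j|)²` over the integers. -/
noncomputable def blockSum : ℝ := ∑' j : ℤ, 1 / (1 + |(j : ℝ)|) ^ 2

theorem summable_block (i : ℤ) : Summable fun j : ℤ => 1 / (1 + |(i : ℝ) - j|) ^ 2 := by
  have h0 : Summable fun j : ℤ => 1 / (1 + |(j : ℝ)|) ^ 2 := by
    have hn : Summable fun k : ℕ => 1 / (1 + (k : ℝ)) ^ 2 := by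
      have := (summable_nat_add_iff 1).2 (Real.summable_one_div_nat_pow.2 (by norm_num : 1 < 2))
      refine this.congr fun k => ?_
      push_cast; ring
    refine Summable.of_nat_of_neg ?_ ?_ <;> refine hn.congr fun k => ?_ <;> simp
  have := (Equiv.subLeft i).summable_iff.2 h0
  refine this.congr fun j => ?_
  simp

theorem tsum_block (i : ℤ) : ∑' j : ℤ, 1 / (1 + |(i : ℝ) - j|) ^ 2 = blockSum := by
  unfold blockSum
  rw [← (Equiv.subLeft i).tsum_eq]
  simp

theorem one_le_blockSum : 1 ≤ blockSum := by
  have h0 : Summable fun j : ℤ => 1 / (1 + |(j : ℝ)|) ^ 2 := by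
    refine (summable_block 0).congr fun j => ?_
    simp
  have := h0.le_tsum 0 (fun j _ => by positivity)
  simpa [blockSum] using this

theorem blockWeight_le_one {δ : ℝ} {ω : ℝ → ℝ} (h : AdmissibleWeight δ ω) {L : ℝ} (hL : 0 < L)
    (j : ℤ) : blockWeight ω L j ≤ 1 := by
  have := blockHeight_nonneg j
  exact h.le_one _ (by positivity)

theorem blockWeight_pos {δ : ℝ} {ω : ℝ → ℝ} (h : AdmissibleWeight δ ω) {L : ℝ} (hL : 0 < L)
    (j : ℤ) : 0 < blockWeight ω L j := by
  have := blockHeight_nonneg j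
  exact h.pos _ (by positivity)

theorem le_blockWeight {δ : ℝ} {ω : ℝ → ℝ} (h : AdmissibleWeight δ ω) {L x : ℝ} {j : ℤ}
    (hL : 0 < L) (h1 : j * L ≤ x) (h2 : x ≤ (j + 1) * L) : ω |x| ≤ blockWeight ω L j := by
  have := blockHeight_nonneg j
  exact h.antitone (Set.mem_Ici.2 (by positivity)) (Set.mem_Ici.2 (abs_nonneg _))
    (blockHeight_le_abs hL h1 h2).1

theorem summable_blockWeight {δ : ℝ} {ω : ℝ → ℝ} (h : AdmissibleWeight δ ω) {L : ℝ} (hL : 0 < L)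
    (i : ℤ) : Summable fun j : ℤ => blockWeight ω L j / (1 + |(i : ℝ) - j|) ^ 2 := by
  refine Summable.of_nonneg_of_le (fun j => ?_) (fun j => ?_) (summable_block i)
  · have := blockWeight_pos h hL j
    positivity
  · gcongr
    exact blockWeight_le_one h hL j

/-- Summation of an admissible weight over blocks against an inverse square kernel. -/
theorem tsum_blockWeight_le {δ : ℝ} {ω : ℝ → ℝ} (h : AdmissibleWeight δ ω) (hδ : 0 < δ)
    {L x : ℝ} {i : ℤ} (hL : 1 ≤ L) (h1 : i * L ≤ x) (h2 : x ≤ (i + 1) * L) {I : ℕ} (hI : 1 ≤ I) :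
    ∑' j : ℤ, blockWeight ω L j / (1 + |(i : ℝ) - j|) ^ 2 ≤
      ω |x| * (blockSum * δ⁻¹ ^ I + (8 * 2⁻¹ ^ I + 8 / (blockHeight i + 1)) * L / δ) := by
  have hL0 : 0 < L := by linarith
  have hωx := h.pos |x| (abs_nonneg x)
  obtain ⟨hlo, hhi⟩ := blockHeight_le_abs hL0 h1 h2
  have hh0 : (0 : ℝ) ≤ blockHeight i := by exact_mod_cast blockHeight_nonneg i
  set H : ℝ := blockHeight i + 1 with hH
  have hH1 : 1 ≤ H := by linarith
  set X : ℝ := 2⁻¹ ^ I * H with hX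
  have hXH : X ≤ H / 2 := by
    have : (2⁻¹ : ℝ) ^ I ≤ 2⁻¹ ^ 1 := pow_le_pow_of_le_one (by norm_num) (by norm_num) hI
    rw [hX]; nlinarith
  have hX0 : 0 < X := by positivity
  have hmax : max 1 |x| ≤ L * H := max_le (by nlinarith) hhi
  have hone : 1 ≤ L * H * ω |x| / δ := by
    rw [le_div_iff₀ hδ, one_mul]
    exact (h.le_max_mul (abs_nonneg x)).trans (by gcongr)
  set N : ℤ := ⌈X⌉ with hN
  have hN0 : 0 ≤ N := Int.ceil_nonneg hX0.le
  set S : Finset ℤ := Finset.Ico (-N) N with hS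
  have hcard : (S.card : ℝ) ≤ 2 * X + 2 := by
    have : ((S.card : ℤ) : ℝ) = 2 * N := by
      rw [hS, Int.card_Ico, Int.toNat_of_nonneg (by omega)]; push_cast; ring
    have h3 : (S.card : ℝ) = 2 * N := by exact_mod_cast this
    have := Int.ceil_lt_add_one X
    rw [h3]; linarith
  have hpt : ∀ j : ℤ, blockWeight ω L j / (1 + |(i : ℝ) - j|) ^ 2 ≤
      ω |x| * δ⁻¹ ^ I * (1 / (1 + |(i : ℝ) - j|) ^ 2) +
        (if j ∈ S then L * H * ω |x| / δ * (4 / H ^ 2) else 0) := by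
    intro j
    have hj0 := blockHeight_nonneg j
    have hj0' : (0 : ℝ) ≤ blockHeight j := by exact_mod_cast hj0
    rcases le_or_gt X (blockHeight j) with hc | hc
    · have hW : blockWeight ω L j ≤ ω |x| * δ⁻¹ ^ I := by
        have h3 := h.pow_doubling hδ I (x := L * blockHeight j) (by positivity)
        have h4 : |x| ≤ 2 ^ I * (L * blockHeight j) := by
          have : H ≤ 2 ^ I * blockHeight j := by
            have : H = 2 ^ I * X := by rw [hX, ← mul_assoc, ← mul_pow]; norm_num
            rw [this]; gcongr
          calc |x| ≤ L * H := hhi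
            _ ≤ L * (2 ^ I * blockHeight j) := by gcongr
            _ = _ := by ring
        have h5 := h.antitone (Set.mem_Ici.2 (abs_nonneg x)) (Set.mem_Ici.2 (by positivity)) h4
        rw [inv_pow, ← div_eq_mul_inv, le_div_iff₀ (by positivity), mul_comm]
        exact h3.trans h5
      have h6 : (0 : ℝ) ≤ if j ∈ S then L * H * ω |x| / δ * (4 / H ^ 2) else 0 := by
        split_ifs <;> positivity
      calc blockWeight ω L j / (1 + |(i : ℝ) - j|) ^ 2
          ≤ ω |x| * δ⁻¹ ^ I / (1 + |(i : ℝ) - j|) ^ 2 := by gcongr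
        _ = ω |x| * δ⁻¹ ^ I * (1 / (1 + |(i : ℝ) - j|) ^ 2) := by ring
        _ ≤ _ := le_add_of_nonneg_right h6
    · have hjS : j ∈ S := by
        have h3 : (blockHeight j : ℝ) < N := lt_of_lt_of_le hc (Int.le_ceil X)
        have h4 : blockHeight j < N := by exact_mod_cast h3
        rw [hS, Finset.mem_Ico]
        unfold blockHeight at h4
        split_ifs at h4 <;> omega
      rw [if_pos hjS]
      have h7 : H / 2 ≤ 1 + |(i : ℝ) - j| := by
        have : (blockHeight i : ℝ) ≤ blockHeight j + |(i : ℝ) - j| := by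
          exact_mod_cast blockHeight_le_add i j
        linarith
      have h8 : blockWeight ω L j / (1 + |(i : ℝ) - j|) ^ 2 ≤ L * H * ω |x| / δ * (4 / H ^ 2) := by
        calc blockWeight ω L j / (1 + |(i : ℝ) - j|) ^ 2
            ≤ (L * H * ω |x| / δ) / (H / 2) ^ 2 := by
              gcongr
              exact (blockWeight_le_one h hL0 j).trans hone
          _ = _ := by field_simp; ring
      have h9 : 0 ≤ ω |x| * δ⁻¹ ^ I * (1 / (1 + |(i : ℝ) - j|) ^ 2) := by positivity
      linarith
  have hs1 : Summable fun j : ℤ => ω |x| * δ⁻¹ ^ I * (1 / (1 + |(i : ℝ) - j|) ^ 2) :=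
    (summable_block i).mul_left _
  have hs2 : HasSum (fun j : ℤ => if j ∈ S then L * H * ω |x| / δ * (4 / H ^ 2) else 0)
      (∑ j ∈ S, L * H * ω |x| / δ * (4 / H ^ 2)) := by
    have := hasSum_sum_of_ne_finset_zero (s := S) (L := SummationFilter.unconditional ℤ)
      (f := fun j : ℤ => if j ∈ S then L * H * ω |x| / δ * (4 / H ^ 2) else 0)
      (fun j hj => if_neg hj)
    convert this using 1
    exact Finset.sum_congr rfl fun j hj => (if_pos hj).symm
  calc ∑' j : ℤ, blockWeight ω L j / (1 + |(i : ℝ) - j|) ^ 2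
      ≤ ∑' j : ℤ, (ω |x| * δ⁻¹ ^ I * (1 / (1 + |(i : ℝ) - j|) ^ 2) +
        (if j ∈ S then L * H * ω |x| / δ * (4 / H ^ 2) else 0)) :=
        (summable_blockWeight h hL0 i).tsum_le_tsum hpt (hs1.add hs2.summable)
    _ = ω |x| * δ⁻¹ ^ I * blockSum + S.card * (L * H * ω |x| / δ * (4 / H ^ 2)) := by
        rw [hs1.tsum_add hs2.summable, hs2.tsum_eq, tsum_mul_left, tsum_block, Finset.sum_const,
          nsmul_eq_mul]
    _ ≤ ω |x| * δ⁻¹ ^ I * blockSum + (2 * X + 2) * (L * H * ω |x| / δ * (4 / H ^ 2)) := by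
        gcongr
    _ = _ := by
        rw [hX]; field_simp; ring

/-! ### Series of simple fractions with compensated blocks -/

/-- Simple poles `pt a` with residues `res a`, arranged in blocks of length `L` with vanishing
total residue. -/
structure BlockPoles {ι : Type*} (L c K N : ℝ) (pt : ι → ℝ) (res : ι → ℂ) (S : ℤ → Finset ι) :
    Prop where
  one_le : 1 ≤ L
  c_pos : 0 < c
  K_nonneg : 0 ≤ K
  mem : ∀ j, ∀ a ∈ S j, j * L ≤ pt a ∧ pt a < (j + 1) * L
  sep : ∀ i j, ∀ a ∈ S i, ∀ b ∈ S j, a ≠ b → c ≤ |pt a - pt b|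
  ne_zero : ∀ j, ∀ a ∈ S j, res a ≠ 0
  bound : ∀ j, ∀ a ∈ S j, ‖res a‖ ≤ K
  card_le : ∀ j, ((S j).card : ℝ) ≤ N
  sum_zero : ∀ j, ∑ a ∈ S j, res a = 0

section

variable {ι : Type*} {L c K N : ℝ} {pt : ι → ℝ} {res : ι → ℂ} {S : ℤ → Finset ι}

/-- The sum of the simple fractions in one block. -/
noncomputable def blockField (pt : ι → ℝ) (res : ι → ℂ) (S : ℤ → Finset ι) (j : ℤ) (z : ℂ) : ℂ :=
  ∑ a ∈ S j, res a / (z - pt a)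

/-- The sum of all simple fractions, block by block. -/
noncomputable def poleSeries (pt : ι → ℝ) (res : ι → ℂ) (S : ℤ → Finset ι) (z : ℂ) : ℂ :=
  ∑' j, blockField pt res S j z

/-- The set of all poles. -/
def blockPoleSet (pt : ι → ℝ) (S : ℤ → Finset ι) : Set ℝ := {x | ∃ j, ∃ a ∈ S j, pt a = x}

namespace BlockPoles

theorem norm_blockField_le (h : BlockPoles L c K N pt res S) {z : ℂ} {i j : ℤ}
    (h1 : i * L ≤ z.re) (h2 : z.re ≤ (i + 1) * L) (hij : 2 ≤ |i - j|) :
    ‖blockField pt res S j z‖ ≤ 9 * K * N * (1 / (1 + |(i : ℝ) - j|) ^ 2) := by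
  have hL0 : 0 < L := by linarith [h.one_le]
  set r : ℝ := L / 3 * (1 + |(i : ℝ) - j|) with hr
  have hr0 : 0 < r := by positivity
  have hfar : ∀ y : ℝ, j * L ≤ y → y ≤ (j + 1) * L → r ≤ ‖z - y‖ := by
    intro y hy hy'
    have := block_dist_far hL0.le h1 h2 hy hy' hij
    refine this.trans ?_
    have := Complex.abs_re_le_norm (z - y)
    simpa using this
  set b : ℝ := j * L with hb
  have hzb : r ≤ ‖z - b‖ := hfar b le_rfl (by nlinarith)
  have hzb0 : z - b ≠ 0 := norm_pos_iff.1 (hr0.trans_le hzb)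
  have hterm : ∀ a ∈ S j, ‖res a / (z - pt a) - res a / (z - b)‖ ≤ K * L / r ^ 2 := by
    intro a ha
    obtain ⟨h3, h4⟩ := h.mem j a ha
    have hza : r ≤ ‖z - pt a‖ := hfar _ h3 h4.le
    have hza0 : z - pt a ≠ 0 := norm_pos_iff.1 (hr0.trans_le hza)
    have e : res a / (z - pt a) - res a / (z - b) =
        res a * ((pt a - b : ℝ) : ℂ) / ((z - pt a) * (z - b)) := by
      field_simp; push_cast; ring
    rw [e, norm_div, norm_mul, norm_mul, Complex.norm_real, Real.norm_eq_abs, sq]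
    have h5 : |pt a - b| ≤ L := by
      rw [abs_of_nonneg (by linarith)]; nlinarith
    have := h.bound j a ha
    have := h.K_nonneg
    gcongr
  have e : blockField pt res S j z = ∑ a ∈ S j, (res a / (z - pt a) - res a / (z - b)) := by
    rw [Finset.sum_sub_distrib, ← Finset.sum_div, h.sum_zero j]
    simp [blockField]
  rw [e]
  have hK := h.K_nonneg
  calc ‖∑ a ∈ S j, (res a / (z - pt a) - res a / (z - b))‖
      ≤ ∑ a ∈ S j, K * L / r ^ 2 := norm_sum_le_of_le _ hterm
    _ = (S j).card * (K * L / r ^ 2) := by simp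
    _ ≤ N * (K * L / r ^ 2) := by gcongr; exact h.card_le j
    _ ≤ N * (K * 9 / (1 + |(i : ℝ) - j|) ^ 2) := by
        have hN : 0 ≤ N := le_trans (by positivity) (h.card_le j)
        have : K * L / r ^ 2 = K * (9 / L) / (1 + |(i : ℝ) - j|) ^ 2 := by
          rw [hr]; field_simp; ring
        rw [this]
        gcongr
        rw [div_le_iff₀ hL0]; linarith [h.one_le]
    _ = _ := by ring

theorem exists_block (h : BlockPoles L c K N pt res S) (x : ℝ) :
    ∃ i : ℤ, i * L ≤ x ∧ x < (i + 1) * L := by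
  have hL0 : 0 < L := by linarith [h.one_le]
  refine ⟨⌊x / L⌋, ?_, ?_⟩
  · rw [← le_div_iff₀ hL0]; exact Int.floor_le _
  · rw [← div_lt_iff₀ hL0]; exact Int.lt_floor_add_one _

theorem summable (h : BlockPoles L c K N pt res S) (z : ℂ) :
    Summable fun j => blockField pt res S j z := by
  obtain ⟨i, h1, h2⟩ := h.exists_block z.re
  refine Summable.of_norm_bounded_eventually ((summable_block i).mul_left (9 * K * N)) ?_
  rw [Filter.eventually_cofinite]
  refine (Set.finite_Icc (i - 1) (i + 1)).subset fun j hj => ?_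
  by_contra hj'
  refine hj (h.norm_blockField_le h1 h2.le ?_)
  rw [Set.mem_Icc] at hj'
  rcases abs_cases (i - j) with h' | h' <;> omega

/-- Away from the nearest blocks the series is holomorphic. -/
theorem far_analytic (h : BlockPoles L c K N pt res S) {z : ℂ} {i : ℤ} (h1 : i * L ≤ z.re)
    (h2 : z.re < (i + 1) * L) :
    AnalyticAt ℂ (fun z => ∑' j, if |i - j| ≤ 3 then 0 else blockField pt res S j z) z := by
  have hL0 : 0 < L := by linarith [h.one_le]
  set U : Set ℂ := {w | (i - 1) * L < w.re ∧ w.re < (i + 2) * L} with hU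
  have hUo : IsOpen U :=
    (isOpen_lt continuous_const Complex.continuous_re).inter
      (isOpen_lt Complex.continuous_re continuous_const)
  have hzU : z ∈ U := ⟨by nlinarith, by nlinarith⟩
  have hidx : ∀ w ∈ U, ∃ i' : ℤ, i' * L ≤ w.re ∧ w.re < (i' + 1) * L ∧ |i' - i| ≤ 1 := by
    rintro w ⟨hw1, hw2⟩
    obtain ⟨i', h3, h4⟩ := h.exists_block w.re
    refine ⟨i', h3, h4, ?_⟩
    have h5 : (i : ℝ) - 1 < i' + 1 := lt_of_mul_lt_mul_right (hw1.trans h4) hL0.le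
    have h6 : (i' : ℝ) < i + 2 := lt_of_mul_lt_mul_right (h3.trans_lt hw2) hL0.le
    have h5' : i - 1 < i' + 1 := by exact_mod_cast h5
    have h6' : i' < i + 2 := by exact_mod_cast h6
    rw [abs_le]; omega
  have hK := h.K_nonneg
  have hN : 0 ≤ N := le_trans (by positivity) (h.card_le 0)
  have hd : DifferentiableOn ℂ
      (fun z => ∑' j, if |i - j| ≤ 3 then 0 else blockField pt res S j z) U := by
    refine Complex.differentiableOn_tsum_of_summable_norm
      (u := fun j => 9 * K * N * 4 * (1 / (1 + |(i : ℝ) - j|) ^ 2))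
      ((summable_block i).mul_left _) (fun j => ?_) hUo (fun j w hw => ?_)
    · split_ifs with hj
      · exact differentiableOn_const _
      · intro w hw
        obtain ⟨i', h3, h4, h5⟩ := hidx w hw
        refine DifferentiableAt.differentiableWithinAt ?_
        unfold blockField
        refine DifferentiableAt.fun_sum fun a ha => ?_
        refine (differentiableAt_const _).div (differentiableAt_id.sub_const _) ?_
        intro h0
        have h6 : w.re = pt a := by
          have := congrArg Complex.re h0
          simpa [sub_eq_zero] using this
        obtain ⟨h7, h8⟩ := h.mem j a ha
        rw [← h6] at h7 h8
        have h9 : (i' : ℝ) < j + 1 := lt_of_mul_lt_mul_right (h3.trans_lt h8) hL0.le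
        have h10 : (j : ℝ) < i' + 1 := lt_of_mul_lt_mul_right (h7.trans_lt h4) hL0.le
        have h9' : i' < j + 1 := by exact_mod_cast h9
        have h10' : j < i' + 1 := by exact_mod_cast h10
        have : i' = j := by omega
        subst this
        rw [abs_sub_comm] at h5
        omega
    · split_ifs with hj
      · rw [norm_zero]; positivity
      · obtain ⟨i', h3, h4, h5⟩ := hidx w hw
        have h6 : |i - j| ≤ |i' - j| + 1 := by
          have := abs_sub_le i i' j
          rw [abs_sub_comm i i'] at this; omega
        have h7 := h.norm_blockField_le h3 h4.le (show 2 ≤ |i' - j| by omega)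
        refine h7.trans ?_
        rw [mul_assoc (9 * K * N) 4]
        gcongr
        have h8 : |(i : ℝ) - j| ≤ |(i' : ℝ) - j| + 1 := by exact_mod_cast h6
        have h9 : 0 ≤ |(i' : ℝ) - j| := abs_nonneg _
        have h10 : 0 ≤ |(i : ℝ) - j| := abs_nonneg _
        rw [mul_one_div, div_le_div_iff₀ (by positivity) (by positivity)]
        nlinarith
  exact hd.analyticAt (hUo.mem_nhds hzU)

theorem series_eq (h : BlockPoles L c K N pt res S) (i : ℤ) (z : ℂ) :
    poleSeries pt res S z = ∑ j ∈ Finset.Icc (i - 3) (i + 3), blockField pt res S j z +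
      ∑' j, if |i - j| ≤ 3 then 0 else blockField pt res S j z := by
  have hm : ∀ j, j ∈ Finset.Icc (i - 3) (i + 3) ↔ |i - j| ≤ 3 := by
    intro j; rw [Finset.mem_Icc, abs_le]; omega
  have hsum : HasSum (fun j => if |i - j| ≤ 3 then blockField pt res S j z else 0)
      (∑ j ∈ Finset.Icc (i - 3) (i + 3), blockField pt res S j z) := by
    have := hasSum_sum_of_ne_finset_zero (s := Finset.Icc (i - 3) (i + 3))
      (L := SummationFilter.unconditional ℤ)
      (f := fun j => if |i - j| ≤ 3 then blockField pt res S j z else 0)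
      (fun j hj => if_neg (fun h' => hj ((hm j).2 h')))
    convert this using 1
    exact Finset.sum_congr rfl fun j hj => (if_pos ((hm j).1 hj)).symm
  have hall := (h.summable z).hasSum
  have h2 := hall.sub hsum
  have h3 : (fun j => blockField pt res S j z -
      if |i - j| ≤ 3 then blockField pt res S j z else 0) =
      fun j => if |i - j| ≤ 3 then 0 else blockField pt res S j z := by
    funext j; split_ifs <;> simp
  rw [h3] at h2
  rw [h2.tsum_eq]
  simp [poleSeries]

/-- The local form of the series at any point: a simple fraction plus a holomorphic function. -/
theorem local_form (h : BlockPoles L c K N pt res S) (z : ℂ) :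
    ∃ (r : ℂ) (g : ℂ → ℂ), AnalyticAt ℂ g z ∧
      (∀ w, poleSeries pt res S w = r / (w - z) + g w) ∧
      (r ≠ 0 ↔ z ∈ Complex.ofReal '' blockPoleSet pt S) := by
  classical
  obtain ⟨i, h1, h2⟩ := h.exists_block z.re
  have hfar := h.far_analytic h1 h2
  have hser := h.series_eq i
  set T : Finset ((_ : ℤ) × ι) := (Finset.Icc (i - 3) (i + 3)).sigma S with hT
  have hnear : ∀ w, ∑ j ∈ Finset.Icc (i - 3) (i + 3), blockField pt res S j w =
      ∑ a ∈ T, res a.2 / (w - pt a.2) := by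
    intro w; rw [hT, Finset.sum_sigma]; rfl
  have hrest : AnalyticAt ℂ
      (fun w => ∑ a ∈ T.filter (fun a => (pt a.2 : ℂ) ≠ z), res a.2 / (w - pt a.2)) z := by
    refine Finset.analyticAt_fun_sum _ fun a ha => ?_
    have hne := (Finset.mem_filter.1 ha).2
    exact analyticAt_const.div (analyticAt_id.sub analyticAt_const)
      (sub_ne_zero.2 (Ne.symm hne))
  refine ⟨∑ a ∈ T.filter (fun a => (pt a.2 : ℂ) = z), res a.2, _, hrest.add hfar, fun w => ?_, ?_⟩
  · rw [hser w, hnear w, ← Finset.sum_filter_add_sum_filter_not T (fun a => (pt a.2 : ℂ) = z),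
      Finset.sum_div, add_assoc]
    congr 1
    exact Finset.sum_congr rfl fun a ha => by rw [(Finset.mem_filter.1 ha).2]
  · by_cases hz : z ∈ Complex.ofReal '' blockPoleSet pt S
    · simp only [hz, iff_true]
      obtain ⟨x, ⟨j, a, ha, rfl⟩, rfl⟩ := hz
      have hL0 : 0 < L := by linarith [h.one_le]
      obtain ⟨h7, h8⟩ := h.mem j a ha
      rw [Complex.ofReal_re] at h1 h2
      have h9 : (i : ℝ) < j + 1 := lt_of_mul_lt_mul_right (h1.trans_lt h8) hL0.le
      have h10 : (j : ℝ) < i + 1 := lt_of_mul_lt_mul_right (h7.trans_lt h2) hL0.le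
      have h9' : i < j + 1 := by exact_mod_cast h9
      have h10' : j < i + 1 := by exact_mod_cast h10
      have hij : i = j := by omega
      subst hij
      have hset : T.filter (fun b => (pt b.2 : ℂ) = (pt a : ℂ)) = {⟨i, a⟩} := by
        ext ⟨j', b⟩
        simp only [Finset.mem_filter, hT, Finset.mem_sigma, Finset.mem_Icc, Finset.mem_singleton,
          Complex.ofReal_inj]
        constructor
        · rintro ⟨⟨_, hb⟩, hab⟩
          obtain ⟨h7, h8⟩ := h.mem j' b hb
          have hba : b = a := by
            by_contra hne
            have := h.sep j' i b hb a ha hne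
            rw [hab, sub_self, abs_zero] at this
            linarith [h.c_pos]
          rw [hab] at h7 h8
          have h9 : (i : ℝ) < j' + 1 := lt_of_mul_lt_mul_right (h1.trans_lt h8) hL0.le
          have h10 : (j' : ℝ) < i + 1 := lt_of_mul_lt_mul_right (h7.trans_lt h2) hL0.le
          have h9' : i < j' + 1 := by exact_mod_cast h9
          have h10' : j' < i + 1 := by exact_mod_cast h10
          have : j' = i := by omega
          subst this; subst hba; rfl
        · intro hb
          obtain ⟨rfl, hb'⟩ := Sigma.mk.inj_iff.1 hb
          obtain rfl := eq_of_heq hb'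
          exact ⟨⟨⟨by omega, by omega⟩, ha⟩, rfl⟩
      rw [hset, Finset.sum_singleton]
      exact h.ne_zero i a ha
    · simp only [hz, iff_false, not_not]
      refine Finset.sum_eq_zero fun a ha => ?_
      obtain ⟨h3, h4⟩ := Finset.mem_filter.1 ha
      exact absurd ⟨pt a.2, ⟨a.1, a.2, (Finset.mem_sigma.1 h3).2, rfl⟩, h4⟩ hz

theorem poleSet_series (h : BlockPoles L c K N pt res S) :
    MeromorphicInPlane (poleSeries pt res S) ∧
      poleSet (poleSeries pt res S) = Complex.ofReal '' blockPoleSet pt S := by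
  have hmero : ∀ z, MeromorphicAt (poleSeries pt res S) z := by
    intro z
    obtain ⟨r, g, hg, hF, -⟩ := h.local_form z
    have : poleSeries pt res S = fun w => r / (w - z) + g w := funext hF
    rw [this]
    have := hg.meromorphicAt
    fun_prop
  have hregular : ∀ z, z ∉ Complex.ofReal '' blockPoleSet pt S →
      AnalyticAt ℂ (poleSeries pt res S) z := by
    intro z hz
    obtain ⟨r, g, hg, hF, hr⟩ := h.local_form z
    have hr0 : r = 0 := by
      by_contra h0; exact hz (hr.1 h0)
    have : poleSeries pt res S = g := by
      funext w; rw [hF w, hr0]; simp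
    rwa [this]
  have hpole : ∀ z, z ∈ Complex.ofReal '' blockPoleSet pt S →
      meromorphicOrderAt (poleSeries pt res S) z = ((-1 : ℤ) : WithTop ℤ) := by
    intro z hz
    obtain ⟨r, g, hg, hF, hr⟩ := h.local_form z
    have hr0 := hr.2 hz
    rw [meromorphicOrderAt_eq_int_iff (hmero z)]
    refine ⟨fun w => r + (w - z) * g w, by fun_prop, by simpa using hr0, ?_⟩
    filter_upwards [self_mem_nhdsWithin] with w hw
    have hw0 : w - z ≠ 0 := sub_ne_zero.2 hw
    rw [hF w, zpow_neg_one, smul_eq_mul]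
    field_simp
  have hset : poleSet (poleSeries pt res S) = Complex.ofReal '' blockPoleSet pt S := by
    ext z
    constructor
    · intro hz
      by_contra hz'
      exact absurd hz (not_lt.2 (hregular z hz').meromorphicOrderAt_nonneg)
    · intro hz
      change meromorphicOrderAt _ z < 0
      rw [hpole z hz]
      exact WithTop.coe_lt_coe.2 (by norm_num)
  exact ⟨⟨fun z _ => hmero z, fun z hz => hregular z (hset ▸ hz)⟩, hset⟩

theorem separated (h : BlockPoles L c K N pt res S) : SeparatedSet (blockPoleSet pt S) := by
  refine ⟨c, h.c_pos, ?_⟩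
  rintro _ ⟨i, a, ha, rfl⟩ _ ⟨j, b, hb, rfl⟩ hab
  exact h.sep i j a ha b hb fun h' => hab (by rw [h'])

theorem isClosed_poles (h : BlockPoles L c K N pt res S) :
    IsClosed (Complex.ofReal '' blockPoleSet pt S) := by
  obtain ⟨⟨-, han⟩, hset⟩ := h.poleSet_series
  rw [← isOpen_compl_iff]
  convert isOpen_analyticAt ℂ (poleSeries pt res S) using 1
  ext z
  rw [← hset]
  exact ⟨fun hz => han z hz, fun hz hz' => absurd hz' (not_lt.2 hz.meromorphicOrderAt_nonneg)⟩

theorem norm_series_le (h : BlockPoles L c K N pt res S) {z : ℂ}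
    (hz : z ∉ Complex.ofReal '' blockPoleSet pt S) :
    ‖poleSeries pt res S z‖ ≤ (9 * blockSum + 3) * K * N *
      (1 + 1 / Metric.infDist z (Complex.ofReal '' blockPoleSet pt S)) := by
  obtain ⟨i, h1, h2⟩ := h.exists_block z.re
  set d := Metric.infDist z (Complex.ofReal '' blockPoleSet pt S) with hd
  have hd0 : 0 ≤ d := Metric.infDist_nonneg
  have hK := h.K_nonneg
  have hN : 0 ≤ N := le_trans (by positivity) (h.card_le 0)
  have hnear : ∀ j, ‖blockField pt res S j z‖ ≤ K * N * (1 / d) := by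
    intro j
    calc ‖blockField pt res S j z‖ ≤ ∑ a ∈ S j, K * (1 / d) := by
          refine norm_sum_le_of_le _ fun a ha => ?_
          have hmem : (pt a : ℂ) ∈ Complex.ofReal '' blockPoleSet pt S :=
            ⟨pt a, ⟨j, a, ha, rfl⟩, rfl⟩
          have hle : d ≤ ‖z - pt a‖ := by
            rw [← dist_eq_norm]
            exact Metric.infDist_le_dist_of_mem hmem
          have hpos : 0 < d := (h.isClosed_poles.notMem_iff_infDist_pos ⟨_, hmem⟩).1 hz
          rw [norm_div, div_eq_mul_one_div]
          gcongr
          exact h.bound j a ha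
      _ = (S j).card * (K * (1 / d)) := by simp
      _ ≤ N * (K * (1 / d)) := by gcongr; exact h.card_le j
      _ = _ := by ring
  have hterm : ∀ j, ‖blockField pt res S j z‖ ≤ 9 * K * N * (1 / (1 + |(i : ℝ) - j|) ^ 2) +
      (if j ∈ Finset.Icc (i - 1) (i + 1) then K * N * (1 / d) else 0) := by
    intro j
    split_ifs with hj
    · exact (hnear j).trans (le_add_of_nonneg_left (by positivity))
    · rw [add_zero]
      refine h.norm_blockField_le h1 h2.le ?_
      rw [Finset.mem_Icc] at hj
      rcases abs_cases (i - j) with h' | h' <;> omega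
  have hs1 := (summable_block i).mul_left (9 * K * N)
  have hs2 : HasSum (fun j : ℤ => if j ∈ Finset.Icc (i - 1) (i + 1) then K * N * (1 / d) else 0)
      (∑ j ∈ Finset.Icc (i - 1) (i + 1), K * N * (1 / d)) := by
    have := hasSum_sum_of_ne_finset_zero (s := Finset.Icc (i - 1) (i + 1))
      (L := SummationFilter.unconditional ℤ)
      (f := fun j : ℤ => if j ∈ Finset.Icc (i - 1) (i + 1) then K * N * (1 / d) else 0)
      (fun j hj => if_neg hj)
    convert this using 1
    exact Finset.sum_congr rfl fun j hj => (if_pos hj).symm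
  have hcard : (Finset.Icc (i - 1) (i + 1)).card = 3 := by
    rw [Int.card_Icc]; omega
  calc ‖poleSeries pt res S z‖
      ≤ ∑' j : ℤ, (9 * K * N * (1 / (1 + |(i : ℝ) - j|) ^ 2) +
      (if j ∈ Finset.Icc (i - 1) (i + 1) then K * N * (1 / d) else 0)) :=
        tsum_of_norm_bounded (hs1.add hs2.summable).hasSum hterm
    _ = 9 * K * N * blockSum + 3 * (K * N * (1 / d)) := by
        rw [hs1.tsum_add hs2.summable, hs2.tsum_eq, tsum_mul_left, tsum_block, Finset.sum_const,
          hcard, nsmul_eq_mul]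
        norm_num
    _ ≤ _ := by
        have := one_le_blockSum
        have h4 : 0 ≤ K * N := by positivity
        have h5 : 0 ≤ 1 / d := by positivity
        have h6 : 0 ≤ K * N * (1 / d) := by positivity
        nlinarith

theorem ncard_blocks (h : BlockPoles L c K N pt res S) (a b : ℤ) :
    (blockPoleSet pt S ∩ Set.Ico (a * L) (b * L)).Finite ∧
      ((blockPoleSet pt S ∩ Set.Ico (a * L) (b * L)).ncard : ℝ) =
        ∑ j ∈ Finset.Ico a b, ((S j).card : ℝ) := by
  classical
  have hL0 : 0 < L := by linarith [h.one_le]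
  set T : Finset ((_ : ℤ) × ι) := (Finset.Ico a b).sigma S with hT
  have hset : blockPoleSet pt S ∩ Set.Ico (a * L) (b * L) =
      (fun x : (_ : ℤ) × ι => pt x.2) '' (T : Set ((_ : ℤ) × ι)) := by
    ext x
    constructor
    · rintro ⟨⟨j, p, hp, rfl⟩, h1, h2⟩
      obtain ⟨h3, h4⟩ := h.mem j p hp
      have h5 : (a : ℝ) < j + 1 := lt_of_mul_lt_mul_right (h1.trans_lt h4) hL0.le
      have h6 : (j : ℝ) < b := lt_of_mul_lt_mul_right (h3.trans_lt h2) hL0.le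
      have h5' : a < j + 1 := by exact_mod_cast h5
      have h6' : j < b := by exact_mod_cast h6
      exact ⟨⟨j, p⟩, by simp [hT, hp]; omega, rfl⟩
    · rintro ⟨⟨j, p⟩, hp, rfl⟩
      simp only [hT, Finset.mem_coe, Finset.mem_sigma, Finset.mem_Ico] at hp
      obtain ⟨⟨h5, h6⟩, hp⟩ := hp
      obtain ⟨h3, h4⟩ := h.mem j p hp
      have h5' : (a : ℝ) ≤ j := by exact_mod_cast h5
      have h6' : (j : ℝ) + 1 ≤ b := by exact_mod_cast h6
      exact ⟨⟨j, p, hp, rfl⟩, le_trans (by gcongr) h3, lt_of_lt_of_le h4 (by gcongr)⟩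
  have hinj : Set.InjOn (fun x : (_ : ℤ) × ι => pt x.2) T := by
    rintro ⟨i, p⟩ hp ⟨j, q⟩ hq hpq
    simp only [hT, Finset.mem_coe, Finset.mem_sigma] at hp hq
    simp only at hpq
    have hpq' : p = q := by
      by_contra hne
      have := h.sep i j p hp.2 q hq.2 hne
      rw [hpq, sub_self, abs_zero] at this
      linarith [h.c_pos]
    obtain ⟨h1, h2⟩ := h.mem i p hp.2
    obtain ⟨h3, h4⟩ := h.mem j q hq.2
    rw [hpq] at h1 h2
    have h5 : (i : ℝ) < j + 1 := lt_of_mul_lt_mul_right (h1.trans_lt h4) hL0.le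
    have h6 : (j : ℝ) < i + 1 := lt_of_mul_lt_mul_right (h3.trans_lt h2) hL0.le
    have h5' : i < j + 1 := by exact_mod_cast h5
    have h6' : j < i + 1 := by exact_mod_cast h6
    have : i = j := by omega
    subst this; subst hpq'; rfl
  rw [hset]
  refine ⟨T.finite_toSet.image _, ?_⟩
  rw [hinj.ncard_image, Set.ncard_coe_finset, hT, Finset.card_sigma]
  push_cast; rfl

/-- The counting function of the poles, from the numbers of poles in the blocks. -/
theorem counting_le (h : BlockPoles L c K N pt res S) {ε C : ℝ} (hε0 : 0 ≤ ε) (hε1 : ε ≤ 1)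
    (hC : 0 ≤ C)
    (hpos : ∀ M : ℕ, |∑ j ∈ Finset.Ico (0 : ℤ) M, ((S j).card : ℝ) - (1 - ε) * L * M| ≤
      C * (1 + (M : ℝ) ^ (2 / 3 : ℝ)))
    (hneg : ∀ M : ℕ, |∑ j ∈ Finset.Ico (-M : ℤ) 0, ((S j).card : ℝ) - (1 - ε) * L * M| ≤
      C * (1 + (M : ℝ) ^ (2 / 3 : ℝ))) (t : ℝ) :
    |countingFun (blockPoleSet pt S) t - (1 - ε) * t| ≤
      (C + 2 * L + N) * (1 + |t| ^ (2 / 3 : ℝ)) := by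
  have hL := h.one_le
  have hL0 : 0 < L := by linarith
  have hN : 0 ≤ N := le_trans (by positivity) (h.card_le 0)
  set M : ℕ := ⌊|t| / L⌋₊ with hM
  have hM1 : M * L ≤ |t| := by
    rw [← le_div_iff₀ hL0]; exact Nat.floor_le (by positivity)
  have hM2 : |t| < (M + 1) * L := by
    rw [← div_lt_iff₀ hL0]; exact Nat.lt_floor_add_one _
  have hMt : (M : ℝ) ≤ |t| := by nlinarith [(Nat.cast_nonneg M : (0 : ℝ) ≤ M)]
  have hpow : (M : ℝ) ^ (2 / 3 : ℝ) ≤ |t| ^ (2 / 3 : ℝ) :=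
    Real.rpow_le_rpow (by positivity) hMt (by norm_num)
  have hpow0 : 0 ≤ |t| ^ (2 / 3 : ℝ) := by positivity
  have hCM : C * (1 + (M : ℝ) ^ (2 / 3 : ℝ)) ≤ C * (1 + |t| ^ (2 / 3 : ℝ)) := by gcongr
  have hfin : C * (1 + |t| ^ (2 / 3 : ℝ)) + 2 * L + N ≤
      (C + 2 * L + N) * (1 + |t| ^ (2 / 3 : ℝ)) := by nlinarith
  have hεt : |(1 - ε) * |t| - (1 - ε) * L * M| ≤ L := by
    have e : (1 - ε) * |t| - (1 - ε) * L * M = (1 - ε) * (|t| - M * L) := by ring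
    rw [e, abs_of_nonneg (mul_nonneg (by linarith) (by linarith))]
    nlinarith
  refine le_trans ?_ hfin
  unfold countingFun
  split_ifs with ht
  · rw [abs_of_nonneg ht] at hM1 hM2 hεt hCM ⊢
    obtain ⟨hf1, hc1⟩ := h.ncard_blocks 0 M
    obtain ⟨hf2, hc2⟩ := h.ncard_blocks 0 (M + 1)
    have hup : Finset.Ico (0 : ℤ) (M + 1) = insert (M : ℤ) (Finset.Ico 0 (M : ℤ)) := by
      ext k; simp only [Finset.mem_Ico, Finset.mem_insert]; omega
    rw [hup, Finset.sum_insert (by simp)] at hc2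
    have hle1 := Set.ncard_le_ncard (s := blockPoleSet pt S ∩ Set.Ico ((0 : ℤ) * L) ((M : ℤ) * L))
      (t := blockPoleSet pt S ∩ Set.Ico 0 t)
      (Set.inter_subset_inter_right _ (Set.Ico_subset_Ico (by simp) (by simpa using hM1)))
      (hf2.subset (Set.inter_subset_inter_right _
        (Set.Ico_subset_Ico (by simp) (by push_cast; linarith))))
    have hle2 := Set.ncard_le_ncard (s := blockPoleSet pt S ∩ Set.Ico 0 t)
      (t := blockPoleSet pt S ∩ Set.Ico ((0 : ℤ) * L) ((M + 1 : ℤ) * L))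
      (Set.inter_subset_inter_right _ (Set.Ico_subset_Ico (by simp) (by push_cast; linarith)))
      (by simpa using hf2)
    have hle1' : (∑ j ∈ Finset.Ico (0 : ℤ) M, ((S j).card : ℝ)) ≤
        (blockPoleSet pt S ∩ Set.Ico 0 t).ncard := by rw [← hc1]; exact_mod_cast hle1
    have hle2' : ((blockPoleSet pt S ∩ Set.Ico 0 t).ncard : ℝ) ≤
        (S M).card + ∑ j ∈ Finset.Ico (0 : ℤ) M, ((S j).card : ℝ) := by
      rw [← hc2]; push_cast; exact_mod_cast hle2
    have h3 := h.card_le M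
    have h4 := abs_le.1 (hpos M)
    have h5 := abs_le.1 hεt
    rw [abs_le]
    constructor <;> linarith [h4.1, h4.2, h5.1, h5.2]
  · rw [not_le] at ht
    rw [abs_of_neg ht] at hM1 hM2 hεt hCM ⊢
    obtain ⟨hf1, hc1⟩ := h.ncard_blocks (-M) 0
    obtain ⟨hf2, hc2⟩ := h.ncard_blocks (-(M + 1)) 0
    have hup : Finset.Ico (-((M : ℤ) + 1)) 0 = insert (-(M + 1) : ℤ) (Finset.Ico (-M : ℤ) 0) := by
      ext k; simp only [Finset.mem_Ico, Finset.mem_insert]; omega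
    rw [hup, Finset.sum_insert (by simp)] at hc2
    have hsub2 : blockPoleSet pt S ∩ Set.Ioo t 0 ⊆
        blockPoleSet pt S ∩ Set.Ico (((-(M + 1) : ℤ) : ℝ) * L) (((0 : ℤ) : ℝ) * L) := by
      rintro x ⟨hx, hx1, hx2⟩
      refine ⟨hx, ?_, ?_⟩
      · push_cast; linarith
      · simpa using hx2
    have hfin2 : (blockPoleSet pt S ∩ Set.Ioo t 0).Finite := hf2.subset hsub2
    have hsub1 : blockPoleSet pt S ∩ Set.Ico (((-M : ℤ) : ℝ) * L) (((0 : ℤ) : ℝ) * L) ⊆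
        insert t (blockPoleSet pt S ∩ Set.Ioo t 0) := by
      rintro x ⟨hx, hx1, hx2⟩
      rcases eq_or_ne x t with rfl | hne
      · exact Set.mem_insert _ _
      · refine Set.mem_insert_of_mem _ ⟨hx, lt_of_le_of_ne ?_ (Ne.symm hne), by simpa using hx2⟩
        push_cast at hx1; linarith
    have hle1 := Set.ncard_le_ncard hsub1 (hfin2.insert t)
    have hle1b := Set.ncard_insert_le t (blockPoleSet pt S ∩ Set.Ioo t 0)
    have hle2 := Set.ncard_le_ncard hsub2 hf2
    have hle1' : (∑ j ∈ Finset.Ico (-M : ℤ) 0, ((S j).card : ℝ)) ≤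
        (blockPoleSet pt S ∩ Set.Ioo t 0).ncard + 1 := by
      rw [← hc1]; exact_mod_cast hle1.trans hle1b
    have hle2' : ((blockPoleSet pt S ∩ Set.Ioo t 0).ncard : ℝ) ≤
        (S (-(M + 1))).card + ∑ j ∈ Finset.Ico (-M : ℤ) 0, ((S j).card : ℝ) := by
      rw [← hc2]; exact_mod_cast hle2
    have h3 := h.card_le (-(M + 1))
    have h4 := abs_le.1 (hneg M)
    have h5 := abs_le.1 hεt
    rw [abs_le]
    constructor <;> linarith [h4.1, h4.2, h5.1, h5.2]

end BlockPoles

end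

/-! ### Three values interpolated by two simple fractions -/

/-- The triple `v` is close to the triple `u`, scaled by the positive numbers `o`. -/
structure NearTriple {E : Type*} [NormedAddCommGroup E] [NormedSpace ℝ E] (u : E × E × E)
    (o : ℝ × ℝ × ℝ) (v : E × E × E) : Prop where
  pos₁ : 0 < o.1
  pos₂ : 0 < o.2.1
  pos₃ : 0 < o.2.2
  near₁ : ‖v.1 - o.1 • u.1‖ ≤ o.1 / 16
  near₂ : ‖v.2.1 - o.2.1 • u.2.1‖ ≤ o.2.1 / 16
  near₃ : ‖v.2.2 - o.2.2 • u.2.2‖ ≤ o.2.2 / 16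

/-- The numbers `o` are comparable up to the factor `R`. -/
structure Comparable (R : ℝ) (o : ℝ × ℝ × ℝ) : Prop where
  h₁₂ : o.1 ≤ R * o.2.1
  h₁₃ : o.1 ≤ R * o.2.2
  h₂₁ : o.2.1 ≤ R * o.1
  h₂₃ : o.2.1 ≤ R * o.2.2
  h₃₁ : o.2.2 ≤ R * o.1
  h₃₂ : o.2.2 ≤ R * o.2.1

/-- The triples `v` and `v'` differ by at most `d` times `o`. -/
structure CloseTriples {E : Type*} [NormedAddCommGroup E] (d : ℝ) (o : ℝ × ℝ × ℝ)
    (v v' : E × E × E) : Prop where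
  nonneg : 0 ≤ d
  close₁ : ‖v.1 - v'.1‖ ≤ d * o.1
  close₂ : ‖v.2.1 - v'.2.1‖ ≤ d * o.2.1
  close₃ : ‖v.2.2 - v'.2.2‖ ≤ d * o.2.2

/-- Positive weights `a, b, c`, depending on a triple `v = (v₋, v₀, v₊)` near the triple `u`, with
`a v₊ + b v₀ + c v₋ = 0`. -/
structure TripleSolver (E : Type*) [NormedAddCommGroup E] [NormedSpace ℝ E]
    [MeasurableSpace E] where
  u : E × E × E
  a : E × E × E → ℝ
  b : E × E × E → ℝ
  c : E × E × E → ℝ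
  measurable_a : Measurable a
  measurable_b : Measurable b
  measurable_c : Measurable c
  norm_u₁ : 1 ≤ ‖u.1‖ ∧ ‖u.1‖ ≤ 23 / 16
  norm_u₂ : 1 ≤ ‖u.2.1‖ ∧ ‖u.2.1‖ ≤ 23 / 16
  norm_u₃ : 1 ≤ ‖u.2.2‖ ∧ ‖u.2.2‖ ≤ 23 / 16
  pos : ∀ {o v}, NearTriple u o v → 0 < a v ∧ 0 < b v ∧ 0 < c v
  sum_le : ∀ {R o v}, 1 ≤ R → Comparable R o → NearTriple u o v →
    a v + b v + c v ≤ 7 * R * a v ∧ a v + b v + c v ≤ 7 * R * b v ∧ a v + b v + c v ≤ 7 * R * c v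
  relation : ∀ {o v}, NearTriple u o v → a v • v.2.2 + b v • v.2.1 + c v • v.1 = 0
  lipschitz : ∀ {o v v' d}, NearTriple u o v → NearTriple u o v' → CloseTriples d o v v' →
    |a v - a v'| ≤ 6 * d * a v ∧ |b v - b v'| ≤ 6 * d * b v ∧ |c v - c v'| ≤ 6 * d * c v
  not_single : ∀ {o v}, NearTriple u o v → ∀ (q : ℝ) (r : E), -1 < q → q < 1 →
    (1 - q) • v.2.2 = r → (-q) • v.2.1 = r → (-1 - q) • v.1 = r → False

theorem quotient_lipschitz {a s a' s' e : ℝ} (ha' : 0 ≤ a') (hs : 0 < s) (hs' : 0 < s')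
    (has : a ≤ s) (has' : a' ≤ s') (he : 0 ≤ e) (h1 : |a - a'| ≤ e * a) (h2 : |s - s'| ≤ e * s) :
    |a / s - a' / s'| ≤ 2 * e := by
  have e1 : a / s - a' / s' = ((a - a') * s' + a' * (s' - s)) / (s * s') := by
    field_simp; ring
  rw [e1, abs_div, abs_of_pos (mul_pos hs hs'), div_le_iff₀ (mul_pos hs hs')]
  calc |(a - a') * s' + a' * (s' - s)| ≤ |a - a'| * s' + a' * |s - s'| := by
        refine (abs_add_le _ _).trans ?_
        rw [abs_mul, abs_mul, abs_of_pos hs', abs_of_nonneg ha', abs_sub_comm s' s]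
    _ ≤ (e * a) * s' + a' * (e * s) := by gcongr
    _ ≤ (e * s) * s' + s' * (e * s) := by gcongr
    _ = _ := by ring

theorem norm_le_of_near {E : Type*} [NormedAddCommGroup E] [NormedSpace ℝ E]
    {r : ℝ} {e f : E} (hr : 0 < r) (h : ‖e - r • f‖ ≤ r / 16)
    (hf : ‖f‖ ≤ 23 / 16) : ‖e‖ ≤ 2 * r := by
  have h1 : ‖e‖ ≤ ‖e - r • f‖ + ‖r • f‖ := by
    simpa using norm_add_le (e - r • f) (r • f)
  rw [norm_smul, Real.norm_of_nonneg hr.le] at h1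
  nlinarith

theorem norm_smul_sub_smul_le {E : Type*} [NormedAddCommGroup E] [NormedSpace ℝ E]
    {r r' : ℝ} {e e' : E} :
    ‖r • e - r' • e'‖ ≤ |r| * ‖e - e'‖ + |r - r'| * ‖e'‖ := by
  have : r • e - r' • e' = r • (e - e') + (r - r') • e' := by
    rw [smul_sub, sub_smul]; abel
  rw [this]
  refine (norm_add_le _ _).trans ?_
  rw [norm_smul, norm_smul, Real.norm_eq_abs, Real.norm_eq_abs]

theorem exists_roots {x y w κ : ℝ} (hκ : 0 < κ) (hx : κ ≤ x) (hy : κ ≤ y) (hw : κ ≤ w)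
    (hs : x + y + w = 1) : ∃ q₁ q₂ : ℝ, -1 < q₁ ∧ q₁ ≤ -κ ∧ κ ≤ q₂ ∧ q₂ ≤ 1 - κ ∧
      ∀ z : ℝ, z ^ 2 - (w - x) * z - y = (z - q₁) * (z - q₂) := by
  have hy0 : 0 < y := by linarith
  have hD0 : 0 < (w - x) ^ 2 + 4 * y := by positivity
  have hsq := Real.sq_sqrt hD0.le
  have hsq0 := Real.sqrt_pos.2 hD0
  generalize Real.sqrt ((w - x) ^ 2 + 4 * y) = r at hsq hsq0
  obtain ⟨q₁, hq₁⟩ : ∃ q, q = (w - x - r) / 2 := ⟨_, rfl⟩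
  obtain ⟨q₂, hq₂⟩ : ∃ q, q = (w - x + r) / 2 := ⟨_, rfl⟩
  have hsum : q₁ + q₂ = w - x := by rw [hq₁, hq₂]; ring
  have hprod : q₁ * q₂ = -y := by
    rw [hq₁, hq₂]; linear_combination (-1 / 4) * hsq
  have hlt : q₁ < q₂ := by rw [hq₁, hq₂]; linarith
  clear hq₁ hq₂ hsq hsq0
  have hprod' : q₁ * q₂ < 0 := by linarith
  have h1 : q₁ < 0 := by
    by_contra hc
    have := mul_nonneg (not_lt.1 hc) ((not_lt.1 hc).trans hlt.le)
    linarith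
  have h2 : 0 < q₂ := by
    by_contra hc
    have := mul_nonneg_of_nonpos_of_nonpos h1.le (not_lt.1 hc)
    linarith
  have hAt1 : (1 - q₁) * (1 - q₂) = 2 * x := by linear_combination hprod - hsum - hs
  have hAtm : (1 + q₁) * (1 + q₂) = 2 * w := by linear_combination hprod + hsum - hs
  have hb2 : q₂ < 1 := by
    by_contra hc
    have := mul_nonneg (by linarith : 0 ≤ 1 - q₁) (by linarith [not_lt.1 hc] : 0 ≤ q₂ - 1)
    linarith
  have hb1 : -1 < q₁ := by
    by_contra hc
    have := mul_nonneg (by linarith [not_lt.1 hc] : 0 ≤ -1 - q₁) (by linarith : 0 ≤ 1 + q₂)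
    linarith
  have m1 := mul_nonneg (by linarith : 0 ≤ 1 - q₂) (by linarith : 0 ≤ 1 + q₁)
  have m2 := mul_nonneg (by linarith : 0 ≤ -q₁) (by linarith : 0 ≤ 1 - q₂)
  have m3 := mul_nonneg (by linarith : 0 ≤ q₂) (by linarith : 0 ≤ 1 + q₁)
  refine ⟨q₁, q₂, hb1, by linarith, by linarith, by linarith, fun z => ?_⟩
  linear_combination z * hsum - hprod

namespace TripleSolver

variable {E : Type*} [NormedAddCommGroup E] [NormedSpace ℝ E] [MeasurableSpace E]
  (T : TripleSolver E)

/-- Normalized weight of `v₊`. -/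
noncomputable def x (v : E × E × E) : ℝ := T.a v / (T.a v + T.b v + T.c v)
/-- Normalized weight of `v₀`. -/
noncomputable def y (v : E × E × E) : ℝ := T.b v / (T.a v + T.b v + T.c v)
/-- Normalized weight of `v₋`. -/
noncomputable def w (v : E × E × E) : ℝ := T.c v / (T.a v + T.b v + T.c v)
/-- The leading coefficient of the numerator. -/
noncomputable def α (v : E × E × E) : E := T.x v • v.2.2 - T.w v • v.1
/-- The constant coefficient of the numerator. -/
noncomputable def β (v : E × E × E) : E := -(T.y v • v.2.1)
/-- The denominator. -/
noncomputable def den (v : E × E × E) (z : ℝ) : ℝ := z ^ 2 - (T.w v - T.x v) * z - T.y v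
/-- The interpolating field, compensated by a simple fraction with pole `-s`. -/
noncomputable def field (v : E × E × E) (z s : ℝ) : E :=
  (z / T.den v z - 1 / (z + s)) • T.α v + (1 / T.den v z) • T.β v

variable {T} {o : ℝ × ℝ × ℝ} {v v' : E × E × E}

theorem weights_pos (h : NearTriple T.u o v) :
    0 < T.x v ∧ 0 < T.y v ∧ 0 < T.w v ∧ T.x v + T.y v + T.w v = 1 := by
  obtain ⟨ha, hb, hc⟩ := T.pos h
  have hs : 0 < T.a v + T.b v + T.c v := by positivity
  refine ⟨div_pos ha hs, div_pos hb hs, div_pos hc hs, ?_⟩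
  unfold x y w
  field_simp

theorem weights_lower {R : ℝ} (hR : 1 ≤ R) (ho : Comparable R o) (h : NearTriple T.u o v) :
    1 / (7 * R) ≤ T.x v ∧ 1 / (7 * R) ≤ T.y v ∧ 1 / (7 * R) ≤ T.w v := by
  obtain ⟨ha, hb, hc⟩ := T.pos h
  have hs : 0 < T.a v + T.b v + T.c v := by positivity
  obtain ⟨h1, h2, h3⟩ := T.sum_le hR ho h
  have hR0 : 0 < 7 * R := by linarith
  unfold x y w
  refine ⟨?_, ?_, ?_⟩ <;> rw [div_le_div_iff₀ hR0 hs] <;> linarith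

theorem weights_relation (h : NearTriple T.u o v) :
    T.x v • v.2.2 + T.y v • v.2.1 + T.w v • v.1 = 0 := by
  have := congrArg (fun e => (T.a v + T.b v + T.c v)⁻¹ • e) (T.relation h)
  simp only [smul_add, smul_smul, smul_zero] at this
  unfold x y w
  simpa only [div_eq_inv_mul] using this

theorem weights_lipschitz {d : ℝ} (h : NearTriple T.u o v) (h' : NearTriple T.u o v')
    (hd : CloseTriples d o v v') :
    |T.x v - T.x v'| ≤ 12 * d ∧ |T.y v - T.y v'| ≤ 12 * d ∧ |T.w v - T.w v'| ≤ 12 * d := by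
  obtain ⟨ha, hb, hc⟩ := T.pos h
  obtain ⟨ha', hb', hc'⟩ := T.pos h'
  obtain ⟨h1, h2, h3⟩ := T.lipschitz h h' hd
  have hd0 := hd.nonneg
  have hs : 0 < T.a v + T.b v + T.c v := by positivity
  have hs' : 0 < T.a v' + T.b v' + T.c v' := by positivity
  have hss : |(T.a v + T.b v + T.c v) - (T.a v' + T.b v' + T.c v')| ≤
      6 * d * (T.a v + T.b v + T.c v) := by
    rw [abs_le] at h1 h2 h3 ⊢
    constructor <;> linarith
  have e : (12 : ℝ) * d = 2 * (6 * d) := by ring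
  rw [e]
  refine ⟨?_, ?_, ?_⟩
  · exact quotient_lipschitz ha'.le hs hs' (by linarith) (by linarith) (by positivity) h1 hss
  · exact quotient_lipschitz hb'.le hs hs' (by linarith) (by linarith) (by positivity) h2 hss
  · exact quotient_lipschitz hc'.le hs hs' (by linarith) (by linarith) (by positivity) h3 hss

theorem norm_triple (h : NearTriple T.u o v) :
    ‖v.1‖ ≤ 2 * o.1 ∧ ‖v.2.1‖ ≤ 2 * o.2.1 ∧ ‖v.2.2‖ ≤ 2 * o.2.2 :=
  ⟨norm_le_of_near h.pos₁ h.near₁ T.norm_u₁.2, norm_le_of_near h.pos₂ h.near₂ T.norm_u₂.2,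
    norm_le_of_near h.pos₃ h.near₃ T.norm_u₃.2⟩

theorem norm_αβ_le {R : ℝ} (hR : 1 ≤ R) (ho : Comparable R o) (h : NearTriple T.u o v) :
    ‖T.α v‖ ≤ 4 * R * o.2.1 ∧ ‖T.β v‖ ≤ 2 * R * o.2.1 := by
  obtain ⟨hx, hy, hw, hs⟩ := weights_pos h
  obtain ⟨h1, h2, h3⟩ := norm_triple h
  have e1 := ho.h₁₂
  have e2 := ho.h₃₂
  have p1 := h.pos₁
  have p2 := h.pos₂
  have p3 := h.pos₃
  constructor
  · calc ‖T.α v‖ ≤ ‖T.x v • v.2.2‖ + ‖T.w v • v.1‖ := norm_sub_le _ _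
      _ = T.x v * ‖v.2.2‖ + T.w v * ‖v.1‖ := by
        rw [norm_smul, norm_smul, Real.norm_of_nonneg hx.le, Real.norm_of_nonneg hw.le]
      _ ≤ 1 * (2 * o.2.2) + 1 * (2 * o.1) := by gcongr <;> linarith
      _ ≤ _ := by linarith
  · calc ‖T.β v‖ = T.y v * ‖v.2.1‖ := by
          rw [β, norm_neg, norm_smul, Real.norm_of_nonneg hy.le]
      _ ≤ 1 * (2 * o.2.1) := by gcongr; linarith
      _ ≤ _ := by nlinarith

theorem norm_αβ_sub_le {R d : ℝ} (hR : 1 ≤ R) (ho : Comparable R o) (h : NearTriple T.u o v)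
    (h' : NearTriple T.u o v') (hd : CloseTriples d o v v') :
    ‖T.α v - T.α v'‖ ≤ 50 * R * d * o.2.1 ∧ ‖T.β v - T.β v'‖ ≤ 25 * R * d * o.2.1 := by
  obtain ⟨hx, hy, hw, hs⟩ := weights_pos h
  obtain ⟨l1, l2, l3⟩ := weights_lipschitz h h' hd
  obtain ⟨h1, h2, h3⟩ := norm_triple h'
  have hd0 := hd.nonneg
  have p1 := h.pos₁
  have p2 := h.pos₂
  have p3 := h.pos₃
  have key : ∀ {r r' p : ℝ} {e e' : E}, 0 < r → r ≤ 1 → 0 < p → |r - r'| ≤ 12 * d →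
      ‖e - e'‖ ≤ d * p → ‖e'‖ ≤ 2 * p → ‖r • e - r' • e'‖ ≤ 25 * d * p := by
    intro r r' p e e' hr hr1 hp h4 h5 h6
    refine norm_smul_sub_smul_le.trans ?_
    rw [abs_of_pos hr]
    calc r * ‖e - e'‖ + |r - r'| * ‖e'‖ ≤ 1 * (d * p) + 12 * d * (2 * p) := by gcongr
      _ = _ := by ring
  have k1 := key hx (by linarith) p3 l1 hd.close₃ h3
  have k2 := key hy (by linarith) p2 l2 hd.close₂ h2
  have k3 := key hw (by linarith) p1 l3 hd.close₁ h1
  constructor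
  · have e : T.α v - T.α v' =
        (T.x v • v.2.2 - T.x v' • v'.2.2) - (T.w v • v.1 - T.w v' • v'.1) := by
      unfold α; abel
    rw [e]
    refine (norm_sub_le _ _).trans ?_
    have e1 := ho.h₁₂
    have e2 := ho.h₃₂
    have : 25 * d * o.2.2 + 25 * d * o.1 ≤ 25 * d * (R * o.2.1) + 25 * d * (R * o.2.1) := by
      gcongr
    linarith
  · have e : T.β v - T.β v' = -(T.y v • v.2.1 - T.y v' • v'.2.1) := by
      unfold β; abel
    rw [e, norm_neg]
    refine k2.trans ?_
    have : 25 * d * o.2.1 * 1 ≤ 25 * d * o.2.1 * R := by gcongr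
    linarith

theorem den_lower (h : NearTriple T.u o v) {z : ℝ} (hz : 2 ≤ |z|) : z ^ 2 / 2 ≤ T.den v z := by
  obtain ⟨hx, hy, hw, hs⟩ := weights_pos h
  unfold den
  rcases abs_cases z with ⟨e, _⟩ | ⟨e, _⟩ <;> rw [e] at hz <;> nlinarith

theorem den_sub_le {d : ℝ} (h : NearTriple T.u o v) (h' : NearTriple T.u o v')
    (hd : CloseTriples d o v v') {z : ℝ} (hz : 1 ≤ |z|) :
    |T.den v z - T.den v' z| ≤ 36 * d * |z| := by
  obtain ⟨l1, l2, l3⟩ := weights_lipschitz h h' hd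
  have hd0 := hd.nonneg
  have e : T.den v z - T.den v' z =
      (T.x v - T.x v') * z - (T.w v - T.w v') * z - (T.y v - T.y v') := by unfold den; ring
  rw [e]
  calc |(T.x v - T.x v') * z - (T.w v - T.w v') * z - (T.y v - T.y v')|
      ≤ |(T.x v - T.x v') * z| + |(T.w v - T.w v') * z| + |T.y v - T.y v'| :=
        (abs_sub _ _).trans (add_le_add_left (abs_sub _ _) _)
    _ = |T.x v - T.x v'| * |z| + |T.w v - T.w v'| * |z| + |T.y v - T.y v'| := by
        rw [abs_mul, abs_mul]
    _ ≤ 12 * d * |z| + 12 * d * |z| + 12 * d * |z| := by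
        gcongr
        nlinarith
    _ = _ := by ring

theorem field_coeff_le (h : NearTriple T.u o v) {z s : ℝ} (hz : 2 ≤ |z|) (hzs : z + s ≠ 0) :
    1 / z ^ 2 ≤ (1 + |s|) / (|z| * |z + s|) ∧
    |z / T.den v z - 1 / (z + s)| ≤ 2 * ((1 + |s|) / (|z| * |z + s|)) ∧
      |1 / T.den v z| ≤ 2 * ((1 + |s|) / (|z| * |z + s|)) := by
  obtain ⟨hx, hy, hw, hs⟩ := weights_pos h
  have hd := den_lower h hz
  have hz0 : z ≠ 0 := by rintro rfl; simp at hz; linarith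
  have hz2 : 0 < z ^ 2 := by positivity
  have hden : 0 < T.den v z := by linarith
  have hZ : 0 < |z + s| := abs_pos.2 hzs
  have hza : 0 < |z| := abs_pos.2 hz0
  have hZle : |z + s| ≤ |z| * (1 + |s|) := by
    have := abs_add_le z s
    nlinarith [abs_nonneg s]
  have hzκ : 1 / z ^ 2 ≤ (1 + |s|) / (|z| * |z + s|) := by
    rw [div_le_div_iff₀ hz2 (by positivity), one_mul, ← sq_abs z]
    nlinarith [abs_nonneg s]
  refine ⟨hzκ, ?_, ?_⟩
  · have e : z / T.den v z - 1 / (z + s) =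
        (z * s + ((T.w v - T.x v) * z + T.y v)) / (T.den v z * (z + s)) := by
      rw [div_sub_div _ _ hden.ne' hzs]
      congr 1
      unfold den; ring
    have hnum : |z * s + ((T.w v - T.x v) * z + T.y v)| ≤ |z| * (1 + |s|) := by
      have a1 : |(T.w v - T.x v) * z + T.y v| ≤ |z| := by
        refine (abs_add_le _ _).trans ?_
        rw [abs_mul, abs_of_pos hy]
        have : |T.w v - T.x v| ≤ 1 - T.y v := by rw [abs_le]; constructor <;> linarith
        nlinarith
      refine (abs_add_le _ _).trans ?_
      rw [abs_mul]; linarith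
    rw [e, abs_div, abs_mul, abs_of_pos hden]
    calc |z * s + ((T.w v - T.x v) * z + T.y v)| / (T.den v z * |z + s|)
        ≤ (|z| * (1 + |s|)) / (z ^ 2 / 2 * |z + s|) := by gcongr
      _ = _ := by rw [← sq_abs z]; field_simp
  · rw [abs_of_pos (by positivity)]
    calc 1 / T.den v z ≤ 1 / (z ^ 2 / 2) := by gcongr
      _ = 2 * (1 / z ^ 2) := by field_simp
      _ ≤ _ := by gcongr

/-- Decay of the compensated field. -/
theorem norm_field_le {R : ℝ} (hR : 1 ≤ R) (ho : Comparable R o) (h : NearTriple T.u o v)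
    {z s : ℝ} (hz : 2 ≤ |z|) (hzs : z + s ≠ 0) :
    ‖T.field v z s‖ ≤ 1014 * R * o.2.1 * ((1 + |s|) / (|z| * |z + s|)) := by
  obtain ⟨n1, n2⟩ := norm_αβ_le hR ho h
  obtain ⟨-, c1, c2⟩ := field_coeff_le h hz hzs
  have p2 := h.pos₂
  unfold field
  calc ‖(z / T.den v z - 1 / (z + s)) • T.α v + (1 / T.den v z) • T.β v‖
      ≤ |z / T.den v z - 1 / (z + s)| * ‖T.α v‖ + |1 / T.den v z| * ‖T.β v‖ := by
        refine (norm_add_le _ _).trans ?_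
        rw [norm_smul, norm_smul, Real.norm_eq_abs, Real.norm_eq_abs]
    _ ≤ 2 * ((1 + |s|) / (|z| * |z + s|)) * (4 * R * o.2.1) +
        2 * ((1 + |s|) / (|z| * |z + s|)) * (2 * R * o.2.1) := by gcongr
    _ = 12 * (R * o.2.1 * ((1 + |s|) / (|z| * |z + s|))) := by ring
    _ ≤ 1014 * (R * o.2.1 * ((1 + |s|) / (|z| * |z + s|))) := by gcongr; norm_num
    _ = _ := by ring

theorem norm_field_sub_le {R d : ℝ} (hR : 1 ≤ R) (ho : Comparable R o) (h : NearTriple T.u o v)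
    (h' : NearTriple T.u o v') (hd : CloseTriples d o v v')
    {z s : ℝ} (hz : 2 ≤ |z|) (hzs : z + s ≠ 0) :
    ‖T.field v z s - T.field v' z s‖ ≤
      d * (1014 * R * o.2.1 * ((1 + |s|) / (|z| * |z + s|))) := by
  obtain ⟨n1, n2⟩ := norm_αβ_le hR ho h'
  obtain ⟨m1, m2⟩ := norm_αβ_sub_le hR ho h h' hd
  obtain ⟨hzκ, c1, c2⟩ := field_coeff_le h hz hzs
  set κ : ℝ := (1 + |s|) / (|z| * |z + s|) with hκ
  have hd0 := hd.nonneg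
  have hdl := den_lower h hz
  have hdl' := den_lower h' hz
  have hz0 : z ≠ 0 := by rintro rfl; simp at hz; linarith
  have hz2 : 0 < z ^ 2 := by positivity
  have hden : 0 < T.den v z := by linarith
  have hden' : 0 < T.den v' z := by linarith
  have hza : 0 < |z| := abs_pos.2 hz0
  have p2 := h.pos₂
  have hκ0 : 0 ≤ κ := by positivity
  have hΔ := den_sub_le h h' hd (z := z) (by linarith)
  have c4 : |1 / T.den v z - 1 / T.den v' z| ≤ 144 * d * (1 / z ^ 2) / |z| := by
    rw [div_sub_div _ _ hden.ne' hden'.ne', abs_div, abs_of_pos (mul_pos hden hden')]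
    have : |1 * T.den v' z - T.den v z * 1| ≤ 36 * d * |z| := by
      rw [one_mul, mul_one, abs_sub_comm]; exact hΔ
    calc |1 * T.den v' z - T.den v z * 1| / (T.den v z * T.den v' z)
        ≤ (36 * d * |z|) / (z ^ 2 / 2 * (z ^ 2 / 2)) := by gcongr
      _ = _ := by rw [← sq_abs z]; field_simp; ring
  have c4' : |1 / T.den v z - 1 / T.den v' z| ≤ 144 * d * κ := by
    refine c4.trans ?_
    rw [div_le_iff₀ hza]
    have : 144 * d * (1 / z ^ 2) ≤ 144 * d * κ := by gcongr
    have h0 : 0 ≤ 144 * d * κ := by positivity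
    nlinarith
  have c3 : |(z / T.den v z - 1 / (z + s)) - (z / T.den v' z - 1 / (z + s))| ≤ 144 * d * κ := by
    have e : (z / T.den v z - 1 / (z + s)) - (z / T.den v' z - 1 / (z + s)) =
        z * (1 / T.den v z - 1 / T.den v' z) := by ring
    rw [e, abs_mul]
    calc |z| * |1 / T.den v z - 1 / T.den v' z| ≤ |z| * (144 * d * (1 / z ^ 2) / |z|) := by gcongr
      _ = 144 * d * (1 / z ^ 2) := by field_simp
      _ ≤ 144 * d * κ := by gcongr
  unfold field
  have e : ∀ p q p' q' : E, (p + q) - (p' + q') = (p - p') + (q - q') := by intros; abel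
  rw [e]
  refine (norm_add_le _ _).trans ?_
  refine (add_le_add norm_smul_sub_smul_le norm_smul_sub_smul_le).trans ?_
  calc |z / T.den v z - 1 / (z + s)| * ‖T.α v - T.α v'‖ +
        |z / T.den v z - 1 / (z + s) - (z / T.den v' z - 1 / (z + s))| * ‖T.α v'‖ +
        (|1 / T.den v z| * ‖T.β v - T.β v'‖ + |1 / T.den v z - 1 / T.den v' z| * ‖T.β v'‖)
      ≤ 2 * κ * (50 * R * d * o.2.1) + 144 * d * κ * (4 * R * o.2.1) +
        (2 * κ * (25 * R * d * o.2.1) + 144 * d * κ * (2 * R * o.2.1)) := by gcongr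
    _ = d * (1014 * R * o.2.1 * κ) := by ring

theorem eval_nodes (h : NearTriple T.u o v) :
    ((1 : ℝ) / T.den v 1) • T.α v + (1 / T.den v 1) • T.β v = v.2.2 ∧
    ((0 : ℝ) / T.den v 0) • T.α v + (1 / T.den v 0) • T.β v = v.2.1 ∧
    ((-1 : ℝ) / T.den v (-1)) • T.α v + (1 / T.den v (-1)) • T.β v = v.1 := by
  obtain ⟨hx, hy, hw, hs⟩ := weights_pos h
  have hrel := weights_relation h
  have d1 : T.den v 1 = 2 * T.x v := by unfold den; linear_combination -hs
  have d0 : T.den v 0 = -T.y v := by unfold den; ring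
  have dm : T.den v (-1) = 2 * T.w v := by unfold den; linear_combination -hs
  rw [d1, d0, dm]
  refine ⟨?_, ?_, ?_⟩
  · have e : T.α v + T.β v = (2 * T.x v) • v.2.2 := by
      have : T.α v + T.β v = (2 * T.x v) • v.2.2 -
          (T.x v • v.2.2 + T.y v • v.2.1 + T.w v • v.1) := by
        unfold α β; module
      rw [this, hrel, sub_zero]
    rw [← smul_add, e, smul_smul, one_div_mul_cancel (by positivity), one_smul]
  · rw [zero_div, zero_smul, zero_add, β, smul_neg, smul_smul, ← neg_smul]
    have : -(1 / -T.y v * T.y v) = 1 := by field_simp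
    rw [this, one_smul]
  · have e : -T.α v + T.β v = (2 * T.w v) • v.1 := by
      have : -T.α v + T.β v = (2 * T.w v) • v.1 -
          (T.x v • v.2.2 + T.y v • v.2.1 + T.w v • v.1) := by
        unfold α β; module
      rw [this, hrel, sub_zero]
    have e2 : ((-1 : ℝ) / (2 * T.w v)) • T.α v + (1 / (2 * T.w v)) • T.β v =
        (1 / (2 * T.w v)) • (-T.α v + T.β v) := by
      rw [smul_add, smul_neg, neg_div, neg_smul]
    rw [e2, e, smul_smul, one_div_mul_cancel (by positivity), one_smul]

/-- The field is a sum of two simple fractions with poles in `(-1, 0)` and `(0, 1)` and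
nonvanishing residues. -/
theorem exists_poles {R : ℝ} (hR : 1 ≤ R) (ho : Comparable R o) (h : NearTriple T.u o v) :
    ∃ (q₁ q₂ : ℝ) (c₁ c₂ : E), -1 ≤ q₁ ∧ q₁ ≤ -(1 / (7 * R)) ∧ 0 ≤ q₂ ∧ q₂ ≤ 1 - 1 / (7 * R) ∧
      -1 < q₁ ∧ 0 < q₂ ∧
      c₁ ≠ 0 ∧ c₂ ≠ 0 ∧ c₁ + c₂ = T.α v ∧ ‖c₁‖ ≤ 42 * R ^ 2 * o.2.1 ∧ ‖c₂‖ ≤ 42 * R ^ 2 * o.2.1 ∧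
      ∀ z : ℝ, z ≠ q₁ → z ≠ q₂ →
        (z / T.den v z) • T.α v + (1 / T.den v z) • T.β v =
          (1 / (z - q₁)) • c₁ + (1 / (z - q₂)) • c₂ := by
  obtain ⟨hx, hy, hw, hs⟩ := weights_pos h
  obtain ⟨lx, ly, lw⟩ := weights_lower hR ho h
  obtain ⟨n1, n2⟩ := norm_αβ_le hR ho h
  have p2 := h.pos₂
  set κ := 1 / (7 * R) with hκ
  have hκ0 : 0 < κ := by positivity
  obtain ⟨q₁, q₂, hb1, e1, e3, e2, hroots⟩ := exists_roots hκ0 lx ly lw hs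
  have hden : ∀ z, T.den v z = (z - q₁) * (z - q₂) := hroots
  have hb2 : q₂ < 1 := by linarith
  have hneg : q₁ < 0 ∧ 0 < q₂ := ⟨by linarith, by linarith⟩
  have hdiff : 2 * κ ≤ q₂ - q₁ := by linarith
  have hne : q₂ - q₁ ≠ 0 := by linarith
  have hne' : q₁ - q₂ ≠ 0 := by linarith
  have hrep : ∀ z : ℝ, z ≠ q₁ → z ≠ q₂ →
        (z / T.den v z) • T.α v + (1 / T.den v z) • T.β v =
          (1 / (z - q₁)) • ((1 / (q₁ - q₂)) • (q₁ • T.α v + T.β v)) +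
          (1 / (z - q₂)) • ((1 / (q₂ - q₁)) • (q₂ • T.α v + T.β v)) := by
    intro z h1 h2
    have z1 : z - q₁ ≠ 0 := sub_ne_zero.2 h1
    have z2 : z - q₂ ≠ 0 := sub_ne_zero.2 h2
    rw [hden z]
    match_scalars <;> field_simp <;> ring
  have hnv : ∀ q q' : ℝ, -1 < q' → q' < 1 → q' ≠ 0 → (∀ z, T.den v z = (z - q) * (z - q')) →
      -1 < q → q < 1 → q ≠ 0 → q • T.α v + T.β v ≠ 0 := by
    intro q q' h1 h2 h0 hd h3 h4 h5 hzero
    obtain ⟨v1, v0, vm⟩ := eval_nodes h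
    have hβ : T.β v = -(q • T.α v) := by
      rw [eq_neg_iff_add_eq_zero, add_comm]; exact hzero
    refine T.not_single h q' (T.α v) h1 h2 ?_ ?_ ?_
    · rw [← v1, hβ, hd]
      have : 1 - q ≠ 0 := by linarith
      have : 1 - q' ≠ 0 := by linarith
      match_scalars
      field_simp
      try ring
    · rw [← v0, hβ, hd]
      match_scalars
      field_simp
      try ring
    · rw [← vm, hβ, hd]
      have : -1 - q ≠ 0 := by linarith
      have : -1 - q' ≠ 0 := by linarith
      match_scalars
      field_simp
      try ring
  have hnorm : ∀ q : ℝ, |q| ≤ 1 → ∀ e : ℝ, |e| ≤ 1 / (2 * κ) →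
      ‖e • (q • T.α v + T.β v)‖ ≤ 42 * R ^ 2 * o.2.1 := by
    intro q hq e he
    rw [norm_smul, Real.norm_eq_abs]
    have : ‖q • T.α v + T.β v‖ ≤ 1 * (4 * R * o.2.1) + 2 * R * o.2.1 := by
      refine (norm_add_le _ _).trans ?_
      rw [norm_smul, Real.norm_eq_abs]
      gcongr
    have hk : 1 / (2 * κ) = 7 * R / 2 := by rw [hκ]; field_simp
    rw [hk] at he
    calc |e| * ‖q • T.α v + T.β v‖ ≤ 7 * R / 2 * (1 * (4 * R * o.2.1) + 2 * R * o.2.1) := by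
          gcongr
      _ = 21 * R ^ 2 * o.2.1 := by ring
      _ ≤ _ := by gcongr; norm_num
  refine ⟨q₁, q₂, (1 / (q₁ - q₂)) • (q₁ • T.α v + T.β v), (1 / (q₂ - q₁)) • (q₂ • T.α v + T.β v),
    hb1.le, e1, hneg.2.le, e2, hb1, hneg.2, ?_, ?_, ?_, ?_, ?_, hrep⟩
  · refine smul_ne_zero (one_div_ne_zero hne') ?_
    exact hnv q₁ q₂ (by linarith) hb2 hneg.2.ne' hden hb1 (by linarith) hneg.1.ne
  · refine smul_ne_zero (one_div_ne_zero hne) ?_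
    exact hnv q₂ q₁ hb1 (by linarith) hneg.1.ne (fun z => by rw [hden z]; ring) (by linarith) hb2
      hneg.2.ne'
  · match_scalars <;> field_simp <;> ring
  · refine hnorm q₁ (by rw [abs_le]; constructor <;> linarith) _ ?_
    rw [abs_div, abs_one, abs_sub_comm, abs_of_pos (by linarith : 0 < q₂ - q₁)]
    gcongr
  · refine hnorm q₂ (by rw [abs_le]; constructor <;> linarith) _ ?_
    rw [abs_div, abs_one, abs_of_pos (by linarith : 0 < q₂ - q₁)]
    gcongr

end TripleSolver

/-! ### The solvers for real and for complex data -/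

/-- The solver for real data: three values of alternating signs. -/
noncomputable def realSolver : TripleSolver ℝ where
  u := (1, -1, 1)
  a v := -v.2.1
  b v := v.2.2 + v.1
  c v := -v.2.1
  measurable_a := by fun_prop
  measurable_b := by fun_prop
  measurable_c := by fun_prop
  norm_u₁ := by norm_num
  norm_u₂ := by norm_num
  norm_u₃ := by norm_num
  pos := by
    intro o v h
    obtain ⟨p1, p2, p3, h1, h2, h3⟩ := h
    simp only [Real.norm_eq_abs, abs_le, smul_eq_mul] at h1 h2 h3
    refine ⟨?_, ?_, ?_⟩ <;> linarith [h1.1, h2.2, h3.1]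
  sum_le := by
    intro R o v hR ho h
    obtain ⟨p1, p2, p3, h1, h2, h3⟩ := h
    obtain ⟨c1, c2, c3, c4, c5, c6⟩ := ho
    simp only [Real.norm_eq_abs, abs_le, smul_eq_mul] at h1 h2 h3
    have k1 : R * o.2.1 ≤ R * (-(16 / 15) * v.2.1) := by gcongr; linarith [h2.2]
    have k2 : R * (o.1 + o.2.2) ≤ R * (16 / 15 * (v.2.2 + v.1)) := by
      gcongr; linarith [h1.1, h3.1]
    have k3 : -v.2.1 * 1 ≤ -v.2.1 * R := by gcongr; linarith [h2.2]
    have k4 : (v.2.2 + v.1) * 1 ≤ (v.2.2 + v.1) * R := by gcongr; linarith [h1.1, h3.1]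
    have k5 : 0 < R * (-v.2.1) := mul_pos (by linarith) (by linarith [h2.2])
    have k6 : 0 < R * (v.2.2 + v.1) := mul_pos (by linarith) (by linarith [h1.1, h3.1])
    refine ⟨?_, ?_, ?_⟩ <;> nlinarith [h1.1, h2.2, h3.1, h1.2, h2.1, h3.2]
  relation := by
    intro o v h
    simp only [smul_eq_mul]; ring
  lipschitz := by
    intro o v v' d h h' hd
    obtain ⟨p1, p2, p3, h1, h2, h3⟩ := h
    obtain ⟨hd0, d1, d2, d3⟩ := hd
    simp only [Real.norm_eq_abs, abs_le, smul_eq_mul] at h1 h2 h3 d1 d2 d3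
    have k2 : d * o.2.1 ≤ d * (-6 * v.2.1) := by gcongr; linarith [h2.2]
    have k1 : d * (o.1 + o.2.2) ≤ d * (6 * (v.2.2 + v.1)) := by
      gcongr; linarith [h1.1, h3.1]
    simp only [abs_le]
    refine ⟨⟨?_, ?_⟩, ⟨?_, ?_⟩, ?_, ?_⟩ <;> linarith [d1.1, d1.2, d2.1, d2.2, d3.1, d3.2]
  not_single := by
    intro o v h q r hq1 hq2 e1 e2 e3
    obtain ⟨p1, p2, p3, h1, h2, h3⟩ := h
    simp only [Real.norm_eq_abs, abs_le, smul_eq_mul] at h1 h2 h3 e1 e2 e3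
    have v1 : 0 < v.1 := by linarith [h1.1]
    have v3 : 0 < v.2.2 := by linarith [h3.1]
    have := mul_pos (by linarith : 0 < 1 - q) v3
    have := mul_pos (by linarith : 0 < 1 + q) v1
    linarith

/-- The cross product of two plane vectors. -/
def planeCross (p q : ℂ) : ℝ := p.re * q.im - p.im * q.re

theorem abs_planeCross_le (p q : ℂ) : |planeCross p q| ≤ ‖p‖ * ‖q‖ := by
  have : planeCross p q = ((starRingEnd ℂ) p * q).im := by
    simp [planeCross]; ring
  rw [this]
  refine (Complex.abs_im_le_norm _).trans ?_
  rw [norm_mul, Complex.norm_conj]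

theorem planeCross_near {p q u u' : ℂ} {s t : ℝ} (hs : 0 < s) (ht : 0 < t)
    (hp : ‖p - s • u‖ ≤ s / 16) (hq : ‖q - t • u'‖ ≤ t / 16) (hu : ‖u‖ ≤ 23 / 16)
    (hu' : ‖u'‖ ≤ 23 / 16) (h1 : planeCross u u' = 1) :
    s * t / 2 ≤ planeCross p q ∧ planeCross p q ≤ 3 / 2 * (s * t) := by
  have e : planeCross p q - s * t =
      planeCross (p - s • u) q + planeCross (s • u) (q - t • u') := by
    have e1 : s * t = s * t * planeCross u u' := by rw [h1, mul_one]
    rw [e1]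
    simp [planeCross]; ring
  have hq2 := norm_le_of_near ht hq hu'
  have k1 : |planeCross (p - s • u) q| ≤ s / 16 * (2 * t) :=
    (abs_planeCross_le _ _).trans (by gcongr)
  have k2 : |planeCross (s • u) (q - t • u')| ≤ (s * (23 / 16)) * (t / 16) := by
    refine (abs_planeCross_le _ _).trans ?_
    rw [norm_smul, Real.norm_of_nonneg hs.le]
    gcongr
  have hst := mul_pos hs ht
  rw [abs_le] at k1 k2
  constructor <;> nlinarith

theorem planeCross_sub_le {p q p' q' u u' : ℂ} {s t d : ℝ} (hs : 0 < s) (ht : 0 < t) (hd : 0 ≤ d)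
    (hp : ‖p - s • u‖ ≤ s / 16) (hq : ‖q - t • u'‖ ≤ t / 16) (hq' : ‖q' - t • u'‖ ≤ t / 16)
    (hu : ‖u‖ ≤ 23 / 16) (hu' : ‖u'‖ ≤ 23 / 16) (h1 : planeCross u u' = 1)
    (hpp : ‖p - p'‖ ≤ d * s) (hqq : ‖q - q'‖ ≤ d * t) :
    |planeCross p q - planeCross p' q'| ≤ 6 * d * planeCross p q := by
  have hlow := (planeCross_near hs ht hp hq hu hu' h1).1
  have key : ∀ {r : ℝ} {e f : ℂ}, 0 < r → ‖e - r • f‖ ≤ r / 16 → ‖f‖ ≤ 23 / 16 →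
      ‖e‖ ≤ 3 / 2 * r := by
    intro r e f hr h hf
    have h1 : ‖e‖ ≤ ‖e - r • f‖ + ‖r • f‖ := by
      simpa using norm_add_le (e - r • f) (r • f)
    rw [norm_smul, Real.norm_of_nonneg hr.le] at h1
    nlinarith
  have np := key hs hp hu
  have nq' := key ht hq' hu'
  have e : planeCross p q - planeCross p' q' = planeCross p (q - q') + planeCross (p - p') q' := by
    simp [planeCross]; ring
  rw [e]
  calc |planeCross p (q - q') + planeCross (p - p') q'|
      ≤ ‖p‖ * ‖q - q'‖ + ‖p - p'‖ * ‖q'‖ :=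
        (abs_add_le _ _).trans (add_le_add (abs_planeCross_le _ _) (abs_planeCross_le _ _))
    _ ≤ 3 / 2 * s * (d * t) + d * s * (3 / 2 * t) := by gcongr
    _ = 6 * d * (s * t / 2) := by ring
    _ ≤ _ := by gcongr

theorem norm_neg_one_sub_I : 1 ≤ ‖(-1 - Complex.I : ℂ)‖ ∧ ‖(-1 - Complex.I : ℂ)‖ ≤ 23 / 16 := by
  have h : ‖(-1 - Complex.I : ℂ)‖ ^ 2 = 2 := by
    rw [← Complex.normSq_eq_norm_sq]; norm_num [Complex.normSq_apply]
  constructor <;> nlinarith [norm_nonneg (-1 - Complex.I : ℂ)]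

/-- The solver for complex data: three values with the origin inside their triangle. -/
noncomputable def complexSolver : TripleSolver ℂ where
  u := (Complex.I, 1, -1 - Complex.I)
  a v := planeCross v.2.1 v.1
  b v := planeCross v.1 v.2.2
  c v := planeCross v.2.2 v.2.1
  measurable_a := by unfold planeCross; fun_prop
  measurable_b := by unfold planeCross; fun_prop
  measurable_c := by unfold planeCross; fun_prop
  norm_u₁ := by norm_num
  norm_u₂ := by norm_num
  norm_u₃ := norm_neg_one_sub_I
  pos := by
    intro o v h
    obtain ⟨p1, p2, p3, h1, h2, h3⟩ := h
    have k1 := (planeCross_near p2 p1 h2 h1 (by norm_num) (by norm_num)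
      (by simp [planeCross])).1
    have k2 := (planeCross_near p1 p3 h1 h3 (by norm_num) norm_neg_one_sub_I.2
      (by simp [planeCross])).1
    have k3 := (planeCross_near p3 p2 h3 h2 norm_neg_one_sub_I.2 (by norm_num)
      (by simp [planeCross])).1
    have := mul_pos p2 p1
    have := mul_pos p1 p3
    have := mul_pos p3 p2
    refine ⟨?_, ?_, ?_⟩ <;> linarith
  sum_le := by
    intro R o v hR ho h
    obtain ⟨p1, p2, p3, h1, h2, h3⟩ := h
    obtain ⟨c1, c2, c3, c4, c5, c6⟩ := ho
    obtain ⟨k1, l1⟩ := planeCross_near p2 p1 h2 h1 (by norm_num) (by norm_num)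
      (by simp [planeCross])
    obtain ⟨k2, l2⟩ := planeCross_near p1 p3 h1 h3 (by norm_num) norm_neg_one_sub_I.2
      (by simp [planeCross])
    obtain ⟨k3, l3⟩ := planeCross_near p3 p2 h3 h2 norm_neg_one_sub_I.2 (by norm_num)
      (by simp [planeCross])
    have key : ∀ {A B C P Q S : ℝ}, P / 2 ≤ A → B ≤ 3 / 2 * Q → C ≤ 3 / 2 * S → Q ≤ R * P →
        S ≤ R * P → 0 < P → A + B + C ≤ 7 * R * A := by
      intro A B C P Q S a1 a2 a3 a4 a5 a6
      have : R * (P / 2) ≤ R * A := by gcongr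
      have : 1 * A ≤ R * A := by gcongr; linarith
      linarith
    have q1 := mul_pos p2 p1
    have q2 := mul_pos p1 p3
    have q3 := mul_pos p3 p2
    refine ⟨?_, ?_, ?_⟩
    · exact key k1 l2 l3 (by nlinarith) (by nlinarith) q1
    · have := key k2 l1 l3 (by nlinarith) (by nlinarith) q2
      linarith
    · have := key k3 l1 l2 (by nlinarith) (by nlinarith) q3
      linarith
  relation := by
    intro o v h
    apply Complex.ext <;> simp [planeCross] <;> ring
  lipschitz := by
    intro o v v' d h h' hd
    obtain ⟨p1, p2, p3, h1, h2, h3⟩ := h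
    obtain ⟨-, -, -, h1', h2', h3'⟩ := h'
    obtain ⟨hd0, d1, d2, d3⟩ := hd
    refine ⟨?_, ?_, ?_⟩
    · exact planeCross_sub_le p2 p1 hd0 h2 h1 h1' (by norm_num) (by norm_num)
        (by simp [planeCross]) d2 d1
    · exact planeCross_sub_le p1 p3 hd0 h1 h3 h3' (by norm_num) norm_neg_one_sub_I.2
        (by simp [planeCross]) d1 d3
    · exact planeCross_sub_le p3 p2 hd0 h3 h2 h2' norm_neg_one_sub_I.2 (by norm_num)
        (by simp [planeCross]) d3 d2
  not_single := by
    intro o v h q r hq1 hq2 e1 e2 e3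
    obtain ⟨p1, p2, p3, h1, h2, h3⟩ := h
    have k2 := (planeCross_near p1 p3 h1 h3 (by norm_num) norm_neg_one_sub_I.2
      (by simp [planeCross])).1
    have hpos : 0 < planeCross v.1 v.2.2 := by
      have := mul_pos p1 p3
      linarith
    have e : (1 - q) * planeCross v.1 v.2.2 = (-1 - q) * planeCross v.1 v.1 := by
      have : (1 - q) • v.2.2 = (-1 - q) • v.1 := by rw [e1, e3]
      have hre := congrArg Complex.re this
      have him := congrArg Complex.im this
      simp only [Complex.smul_re, Complex.smul_im, smul_eq_mul] at hre him
      unfold planeCross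
      linear_combination v.1.re * him - v.1.im * hre
    have e0 : planeCross v.1 v.1 = 0 := by unfold planeCross; ring
    rw [e0, mul_zero] at e
    have := mul_pos (by linarith : 0 < 1 - q) hpos
    linarith

/-! ### A fixed point theorem for weighted contractions of sequences -/

section FixedPoint

variable {E : Type*} [NormedAddCommGroup E] {F : (ℤ → E) → ℤ → E} {ρ : ℤ → ℝ}

/-- `F` maps the polydisc `|e m| ≤ ρ m` to itself and halves weighted distances in it. -/
structure HalfContraction (F : (ℤ → E) → ℤ → E) (ρ : ℤ → ℝ) : Prop where
  nonneg : ∀ m, 0 ≤ ρ m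
  maps : ∀ e, (∀ m, ‖e m‖ ≤ ρ m) → ∀ m, ‖F e m‖ ≤ ρ m
  contract : ∀ e e' d, 0 ≤ d → (∀ m, ‖e m‖ ≤ ρ m) → (∀ m, ‖e' m‖ ≤ ρ m) →
    (∀ m, ‖e m - e' m‖ ≤ d * ρ m) → ∀ m, ‖F e m - F e' m‖ ≤ d / 2 * ρ m

namespace HalfContraction

theorem iterate_mem (h : HalfContraction F ρ) (k : ℕ) (m : ℤ) : ‖F^[k] 0 m‖ ≤ ρ m := by
  induction k generalizing m with
  | zero => simpa using h.nonneg m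
  | succ k ih => rw [Function.iterate_succ_apply']; exact h.maps _ ih m

theorem unique (h : HalfContraction F ρ) {e e' : ℤ → E} (he : ∀ m, ‖e m‖ ≤ ρ m)
    (he' : ∀ m, ‖e' m‖ ≤ ρ m) (hfe : F e = e) (hfe' : F e' = e') : e = e' := by
  have key : ∀ k : ℕ, ∀ m, ‖e m - e' m‖ ≤ (2 * (1 / 2) ^ k) * ρ m := by
    intro k
    induction k with
    | zero =>
      intro m
      have := norm_sub_le (e m) (e' m)
      linarith [he m, he' m]
    | succ k ih =>
      intro m
      have := h.contract e e' _ (by positivity) he he' ih m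
      rw [hfe, hfe'] at this
      refine this.trans (le_of_eq ?_)
      ring
  funext m
  rw [← sub_eq_zero, ← norm_le_zero_iff]
  have hlim : Filter.Tendsto (fun k : ℕ => (2 * (1 / 2 : ℝ) ^ k) * ρ m) Filter.atTop
      (nhds ((2 * 0) * ρ m)) :=
    ((tendsto_pow_atTop_nhds_zero_of_lt_one (by norm_num) (by norm_num)).const_mul 2).mul_const _
  have := ge_of_tendsto' hlim fun k => key k m
  simpa using this

theorem exists_fixed [CompleteSpace E] (h : HalfContraction F ρ) :
    ∃ e : ℤ → E, (∀ m, ‖e m‖ ≤ ρ m) ∧ F e = e ∧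
      ∀ m, Filter.Tendsto (fun k => F^[k] 0 m) Filter.atTop (nhds (e m)) := by
  have step : ∀ k : ℕ, ∀ m, ‖F^[k + 1] 0 m - F^[k] 0 m‖ ≤ (1 / 2) ^ k * ρ m := by
    intro k
    induction k with
    | zero =>
      intro m
      simpa using h.maps 0 (by simpa using h.nonneg) m
    | succ k ih =>
      intro m
      rw [Function.iterate_succ_apply', Function.iterate_succ_apply' F k]
      have := h.contract _ _ _ (by positivity) (h.iterate_mem (k + 1)) (h.iterate_mem k) ih m
      rw [Function.iterate_succ_apply'] at this
      refine this.trans (le_of_eq ?_)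
      ring
  have hgeom : ∀ m, ∀ k : ℕ, dist (F^[k] 0 m) (F^[k + 1] 0 m) ≤ 2 * ρ m / 2 / 2 ^ k := by
    intro m k
    rw [dist_eq_norm, norm_sub_rev]
    refine (step k m).trans (le_of_eq ?_)
    rw [one_div, inv_pow]; ring
  have hlim : ∀ m, ∃ x, Filter.Tendsto (fun k => F^[k] 0 m) Filter.atTop (nhds x) := fun m =>
    cauchySeq_tendsto_of_complete (cauchySeq_of_le_geometric_two (hgeom m))
  choose e he using hlim
  have hball : ∀ m, ‖e m‖ ≤ ρ m := fun m =>
    le_of_tendsto' (he m).norm fun k => h.iterate_mem k m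
  have hdist : ∀ k : ℕ, ∀ m, ‖F^[k] 0 m - e m‖ ≤ (2 * (1 / 2) ^ k) * ρ m := by
    intro k m
    rw [← dist_eq_norm]
    refine (dist_le_of_le_geometric_two_of_tendsto (hgeom m) (he m) k).trans (le_of_eq ?_)
    rw [one_div, inv_pow]; ring
  refine ⟨e, hball, ?_, he⟩
  funext m
  have h1 : Filter.Tendsto (fun k => F^[k + 1] 0 m) Filter.atTop (nhds (e m)) :=
    (he m).comp (Filter.tendsto_add_atTop_nat 1)
  have h2 : Filter.Tendsto (fun k => F^[k + 1] 0 m) Filter.atTop (nhds (F e m)) := by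
    rw [tendsto_iff_norm_sub_tendsto_zero]
    have hlim : Filter.Tendsto (fun k : ℕ => (2 * (1 / 2 : ℝ) ^ k) / 2 * ρ m) Filter.atTop
        (nhds ((2 * 0) / 2 * ρ m)) :=
      (((tendsto_pow_atTop_nhds_zero_of_lt_one (by norm_num)
        (by norm_num)).const_mul 2).div_const 2).mul_const _
    rw [mul_zero, zero_div, zero_mul] at hlim
    refine squeeze_zero (fun _ => norm_nonneg _) (fun k => ?_) hlim
    rw [Function.iterate_succ_apply']
    exact h.contract _ _ _ (by positivity) (h.iterate_mem k) hball (hdist k) m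
  exact tendsto_nhds_unique h2 h1

end HalfContraction

end FixedPoint

/-! ### The interpolation system -/

/-- The parameters of the construction: blocks consist of `n` cells of length `2 H`, with possible
triples around the centres of the cells in `allowed`. -/
structure Scheme (E : Type*) [NormedAddCommGroup E] [NormedSpace ℝ E] [MeasurableSpace E] where
  T : TripleSolver E
  δ : ℝ
  n : ℤ
  H : ℤ
  I : ℕ
  J : ℤ
  A : ℝ
  η : ℝ
  K : ℝ
  allowed : Set ℤ
  δ_pos : 0 < δ
  δ_le : δ ≤ 1
  n_pos : 1 ≤ n
  H_ge : 4 ≤ H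
  I_pos : 1 ≤ I
  J_nonneg : 0 ≤ J
  η_pos : 0 < η
  η_le : η ≤ 1 / 8
  K_ge : 1 ≤ K
  A_ge : 4 * n * δ⁻¹ ^ 3 + 1 ≤ A
  small : 64 * (n * (2 * H) : ℝ) ^ 2 * (η * (1 + K)) ≤ 1 / H
  core : (A / (2 * (H / 4) ^ 2) + 1 / H + n * (1014 * δ⁻¹ ^ 3 * (n * (2 * H)) / (H / 4) ^ 2 +
    50 * δ⁻¹ ^ 3 / (H / 4))) * (blockSum * δ⁻¹ ^ I +
      (8 * 2⁻¹ ^ I + 8 / (J + 1)) * (n * (2 * H)) / δ) ≤ 1 / 64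
  regular : (A / (2 * (1 / 8) ^ 2) + 1 + n * (1014 * δ⁻¹ ^ 3 * (n * (2 * H)) / (1 / 8) ^ 2 +
    50 * δ⁻¹ ^ 3 / (1 / 8))) * (blockSum * δ⁻¹ ^ 1 +
      (8 * 2⁻¹ ^ 1 + 8 / 1) * (n * (2 * H)) / δ) ≤ K / 2
  allowed_high : ∀ k ∈ allowed, J ≤ blockHeight (k / n)

namespace Scheme

variable {E : Type*} [NormedAddCommGroup E] [NormedSpace ℝ E] [MeasurableSpace E]
variable (S : Scheme E) (ω : ℝ → ℝ) (ζ : ℤ → E) (e : ℤ → E)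

/-- The length of the blocks. -/
def L : ℤ := S.n * (2 * S.H)

/-- The centre of the `k`-th cell. -/
def center (k : ℤ) : ℤ := (2 * k + 1) * S.H

/-- The main compensating pole of the `j`-th block. -/
noncomputable def comp (j : ℤ) : ℝ := j * S.L + 1 / 2

/-- The cells whose central triple is interpolated with two poles only. -/
def good : Set ℤ := {k | k ∈ S.allowed ∧ ‖ζ (S.center k - 1) - S.T.u.1‖ ≤ 1 / 32 ∧
  ‖ζ (S.center k) - S.T.u.2.1‖ ≤ 1 / 32 ∧ ‖ζ (S.center k + 1) - S.T.u.2.2‖ ≤ 1 / 32}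

/-- The integers belonging to a good triple. -/
def IsCore (m : ℤ) : Prop := ∃ k ∈ S.good ζ, |m - S.center k| ≤ 1

/-- The distance from an integer with datum `z` to its pole. -/
noncomputable def offset (z : E) : ℝ :=
  open Classical in if z = 0 then 0 else S.η / max 1 ‖z‖

/-- The values to be interpolated by the singular parts. -/
noncomputable def val (m : ℤ) : E := ω |(m : ℝ)| • (ζ m + e m)

/-- The values at the nodes of a triple. -/
noncomputable def tripleVal (k : ℤ) : E × E × E :=
  (val ω ζ e (S.center k - 1), val ω ζ e (S.center k), val ω ζ e (S.center k + 1))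

/-- The weights at the nodes of a triple. -/
noncomputable def tripleWeight (k : ℤ) : ℝ × ℝ × ℝ :=
  (ω |((S.center k - 1 : ℤ) : ℝ)|, ω |(S.center k : ℝ)|, ω |((S.center k + 1 : ℤ) : ℝ)|)

/-- The residue at the pole of a regular integer. -/
noncomputable def residue (m : ℤ) : E :=
  open Classical in if S.IsCore ζ m then 0 else -(S.offset (ζ m) • val ω ζ e m)

/-- The interaction of the regular integers `m'` and `m`. -/
noncomputable def kernel (m' m : ℤ) : ℝ :=
  (if m' = m then 0 else 1 / ((m : ℝ) - m' - S.offset (ζ m'))) - 1 / ((m : ℝ) - S.comp (m' / S.L))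

/-- The influence of the `k`-th triple on the integer `m`. -/
noncomputable def tripleTerm (k m : ℤ) : E :=
  open Classical in
  if k ∈ S.good ζ then
    if |m - S.center k| ≤ 1 then
      -((1 / ((m : ℝ) - S.comp (k / S.n))) • S.T.α (S.tripleVal ω ζ e k))
    else S.T.field (S.tripleVal ω ζ e k) (m - S.center k) (S.center k - S.comp (k / S.n))
  else 0

/-- The dipole of the `j`-th block. -/
noncomputable def dipole (j m : ℤ) : E :=
  (S.A * blockWeight ω S.L j *
    (1 / ((m : ℝ) - S.comp j) - 1 / ((m : ℝ) - (S.comp j + 1 / 4)))) • S.T.u.2.1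

/-- The influence of the `j`-th block on the integer `m`, without the singular part of `m`. -/
noncomputable def rest (j m : ℤ) : E :=
  S.dipole ω j m +
    ∑ m' ∈ Finset.Ico (j * S.L) ((j + 1) * S.L), S.kernel ζ m' m • S.residue ω ζ e m' +
    ∑ k ∈ Finset.Ico (j * S.n) ((j + 1) * S.n), S.tripleTerm ω ζ e k m

/-- The map whose fixed point solves the interpolation problem. -/
noncomputable def step (m : ℤ) : E := -((1 / ω |(m : ℝ)|) • ∑' j, S.rest ω ζ e j m)

/-- The admissible size of the correction at `m`. -/
noncomputable def radius (m : ℤ) : ℝ := open Classical in if S.IsCore ζ m then 1 / 32 else S.K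

variable {S ω ζ e}

theorem L_eq_cast : (S.L : ℝ) = S.n * (2 * S.H) := by simp [L]

theorem H_cast : (4 : ℝ) ≤ S.H := by exact_mod_cast S.H_ge

theorem n_cast : (1 : ℝ) ≤ S.n := by exact_mod_cast S.n_pos

theorem L_ge : (8 : ℝ) ≤ S.L := by
  rw [L_eq_cast]; nlinarith [S.H_cast, S.n_cast]

theorem two_H_le_L : 2 * (S.H : ℝ) ≤ S.L := by
  rw [L_eq_cast]; nlinarith [S.H_cast, S.n_cast]

theorem L_pos : 0 < S.L := by
  have := S.L_ge
  exact_mod_cast (by linarith : (0 : ℝ) < S.L)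

theorem div_L (m : ℤ) : ((m / S.L : ℤ) : ℝ) * S.L ≤ m ∧ (m : ℝ) + 1 ≤ ((m / S.L : ℤ) + 1) * S.L := by
  have h1 := Int.mul_ediv_add_emod m S.L
  have h2 := Int.emod_nonneg m S.L_pos.ne'
  have h3 := Int.emod_lt_of_pos m S.L_pos
  constructor
  · have : m / S.L * S.L ≤ m := by linarith [mul_comm S.L (m / S.L)]
    exact_mod_cast this
  · have : m + 1 ≤ (m / S.L + 1) * S.L := by linarith [mul_comm S.L (m / S.L)]
    exact_mod_cast this

theorem div_n (k : ℤ) : k / S.n * S.n ≤ k ∧ k + 1 ≤ (k / S.n + 1) * S.n := by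
  have h1 := Int.mul_ediv_add_emod k S.n
  have hn : 0 < S.n := by linarith [S.n_pos]
  have h2 := Int.emod_nonneg k hn.ne'
  have h3 := Int.emod_lt_of_pos k hn
  constructor <;> linarith [mul_comm S.n (k / S.n)]

/-- A triple stays away from the ends of its block. -/
theorem center_mem (k : ℤ) : ((k / S.n : ℤ) : ℝ) * S.L + S.H ≤ S.center k ∧
    (S.center k : ℝ) + S.H ≤ ((k / S.n : ℤ) + 1) * S.L := by
  obtain ⟨h1, h2⟩ := S.div_n k
  have hH : 0 ≤ S.H := by linarith [S.H_ge]
  constructor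
  · have : k / S.n * S.L + S.H ≤ S.center k := by
      have := mul_le_mul_of_nonneg_right h1 (by linarith : 0 ≤ 2 * S.H)
      unfold L center; linarith
    exact_mod_cast this
  · have : S.center k + S.H ≤ (k / S.n + 1) * S.L := by
      have := mul_le_mul_of_nonneg_right h2 (by linarith : 0 ≤ 2 * S.H)
      unfold L center; linarith
    exact_mod_cast this

theorem offset_nonneg (z : E) : 0 ≤ S.offset z := by
  unfold offset; have := S.η_pos; split_ifs <;> positivity

theorem offset_le (z : E) : S.offset z ≤ S.η := by
  unfold offset
  have := S.η_pos
  split_ifs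
  · exact this.le
  · exact div_le_self this.le (le_max_left _ _)

theorem offset_mul_norm_le (z : E) : S.offset z * ‖z‖ ≤ S.η := by
  unfold offset
  have := S.η_pos
  split_ifs
  · simpa using this.le
  · rw [div_mul_eq_mul_div, div_le_iff₀ (by positivity)]
    gcongr
    exact le_max_right _ _

theorem offset_pos {z : E} (hz : z ≠ 0) : 0 < S.offset z := by
  unfold offset
  have := S.η_pos
  rw [if_neg hz]; positivity

theorem radius_nonneg (m : ℤ) : 0 ≤ S.radius ζ m := by
  unfold radius
  have := S.K_ge
  split_ifs <;> linarith

theorem radius_le (m : ℤ) : S.radius ζ m ≤ S.K := by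
  unfold radius
  have := S.K_ge
  split_ifs <;> linarith

end Scheme

namespace Scheme

variable {E : Type*} [NormedAddCommGroup E] [NormedSpace ℝ E] [MeasurableSpace E]
variable {S : Scheme E} {ω : ℝ → ℝ} {ζ e e' : ℤ → E}

theorem radius_of_core {m : ℤ} (h : S.IsCore ζ m) : S.radius ζ m = 1 / 32 := if_pos h

theorem isCore_triple {k : ℤ} (hk : k ∈ S.good ζ) :
    S.IsCore ζ (S.center k - 1) ∧ S.IsCore ζ (S.center k) ∧ S.IsCore ζ (S.center k + 1) :=
  ⟨⟨k, hk, by simp⟩, ⟨k, hk, by simp⟩, ⟨k, hk, by simp⟩⟩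

theorem norm_val_sub_le {m : ℤ} {u : E} (hω : AdmissibleWeight S.δ ω) (hζ : ‖ζ m - u‖ ≤ 1 / 32)
    (he : ‖e m‖ ≤ 1 / 32) : ‖val ω ζ e m - ω |(m : ℝ)| • u‖ ≤ ω |(m : ℝ)| / 16 := by
  have hp := hω.pos |(m : ℝ)| (abs_nonneg _)
  have e1 : val ω ζ e m - ω |(m : ℝ)| • u = ω |(m : ℝ)| • ((ζ m - u) + e m) := by
    unfold val; rw [← smul_sub]; congr 1; abel
  rw [e1, norm_smul, Real.norm_of_nonneg hp.le]
  have := norm_add_le (ζ m - u) (e m)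
  nlinarith

theorem nearTriple (hω : AdmissibleWeight S.δ ω) (he : ∀ m, ‖e m‖ ≤ S.radius ζ m) {k : ℤ}
    (hk : k ∈ S.good ζ) : NearTriple S.T.u (S.tripleWeight ω k) (S.tripleVal ω ζ e k) := by
  obtain ⟨c1, c2, c3⟩ := isCore_triple hk
  obtain ⟨-, h1, h2, h3⟩ := hk
  have k1 := he (S.center k - 1)
  have k2 := he (S.center k)
  have k3 := he (S.center k + 1)
  rw [radius_of_core c1] at k1
  rw [radius_of_core c2] at k2
  rw [radius_of_core c3] at k3
  exact ⟨hω.pos _ (abs_nonneg _), hω.pos _ (abs_nonneg _), hω.pos _ (abs_nonneg _),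
    norm_val_sub_le hω h1 k1, norm_val_sub_le hω h2 k2, norm_val_sub_le hω h3 k3⟩

theorem one_le_inv_pow (S : Scheme E) : 1 ≤ S.δ⁻¹ ^ 3 :=
  one_le_pow₀ ((one_le_inv₀ S.δ_pos).2 S.δ_le)

theorem weight_le_of_close (hω : AdmissibleWeight S.δ ω) {a b : ℤ} (h : |a - b| ≤ 2) :
    ω |(a : ℝ)| ≤ S.δ⁻¹ ^ 3 * ω |(b : ℝ)| := by
  have hab : |(b : ℝ)| ≤ |(a : ℝ)| + 2 := by
    have h1 : |(b : ℝ) - a| ≤ 2 := by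
      rw [abs_sub_comm]; exact_mod_cast h
    have := abs_sub_abs_le_abs_sub (b : ℝ) a
    linarith
  have := hω.le_of_le_add_two S.δ_pos (abs_nonneg _) (abs_nonneg _) hab
  have hp : 0 < S.δ ^ 3 := pow_pos S.δ_pos 3
  rw [inv_pow, inv_mul_eq_div, le_div_iff₀ hp]
  linarith

theorem comparable (hω : AdmissibleWeight S.δ ω) (k : ℤ) :
    Comparable (S.δ⁻¹ ^ 3) (S.tripleWeight ω k) := by
  constructor <;> refine weight_le_of_close hω ?_ <;> rw [abs_le] <;> constructor <;> linarith

theorem norm_val_sub_val {d : ℝ} (hω : AdmissibleWeight S.δ ω) {m : ℤ}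
    (hd : ‖e m - e' m‖ ≤ d) : ‖val ω ζ e m - val ω ζ e' m‖ ≤ d * ω |(m : ℝ)| := by
  have hp := hω.pos |(m : ℝ)| (abs_nonneg _)
  have e1 : val ω ζ e m - val ω ζ e' m = ω |(m : ℝ)| • (e m - e' m) := by
    unfold val; rw [← smul_sub]; congr 1; abel
  rw [e1, norm_smul, Real.norm_of_nonneg hp.le, mul_comm]
  gcongr

theorem closeTriples {d : ℝ} (hω : AdmissibleWeight S.δ ω) (hd0 : 0 ≤ d)
    (hd : ∀ m, ‖e m - e' m‖ ≤ d * S.radius ζ m) {k : ℤ} (hk : k ∈ S.good ζ) :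
    CloseTriples d (S.tripleWeight ω k) (S.tripleVal ω ζ e k) (S.tripleVal ω ζ e' k) := by
  obtain ⟨c1, c2, c3⟩ := isCore_triple hk
  have key : ∀ {m}, S.IsCore ζ m → ‖e m - e' m‖ ≤ d := by
    intro m hm
    have := hd m
    rw [radius_of_core hm] at this
    linarith
  exact ⟨hd0, norm_val_sub_val hω (key c1), norm_val_sub_val hω (key c2),
    norm_val_sub_val hω (key c3)⟩

/-- The integer `m` is at distance at least `2 c` from the compensating poles and from the good
triples it does not belong to. -/
structure FarFrom (S : Scheme E) (ζ : ℤ → E) (c : ℝ) (m : ℤ) : Prop where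
  pos : 0 < c
  le : 3 * c ≤ S.L
  comp : ∀ j, 2 * c ≤ |(m : ℝ) - S.comp j|
  comp' : ∀ j, 2 * c ≤ |(m : ℝ) - (S.comp j + 1 / 4)|
  triple : ∀ k, 1 < |m - S.center k| → k ∈ S.good ζ → 2 * c ≤ |(m : ℝ) - S.center k|

theorem farFrom_all (m : ℤ) : FarFrom S ζ (1 / 8) m := by
  have key : ∀ j : ℤ, 1 / 2 ≤ |(m : ℝ) - S.comp j| ∧ 1 / 4 ≤ |(m : ℝ) - (S.comp j + 1 / 4)| := by
    intro j
    rcases le_or_gt m (j * S.L) with h | h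
    · have h' : (m : ℝ) ≤ j * S.L := by exact_mod_cast h
      unfold Scheme.comp
      constructor <;> refine le_trans ?_ (neg_le_abs _) <;> linarith
    · have h' : (j : ℝ) * S.L + 1 ≤ m := by exact_mod_cast h
      unfold Scheme.comp
      constructor <;> refine le_trans ?_ (le_abs_self _) <;> linarith
  refine ⟨by norm_num, by linarith [S.L_ge], fun j => by linarith [(key j).1],
    fun j => by linarith [(key j).2], fun k hk _ => ?_⟩
  have : (1 : ℝ) < |(m : ℝ) - S.center k| := by exact_mod_cast hk
  linarith

theorem farFrom_core {m : ℤ} (hm : S.IsCore ζ m) : FarFrom S ζ (S.H / 4) m := by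
  obtain ⟨k, hk, hmk⟩ := hm
  have hH := S.H_cast
  have hHi := S.H_ge
  rw [abs_le] at hmk
  have hmul : ∀ x : ℤ, (S.H : ℝ) - 1 ≤ |(m : ℝ) - x * (2 * S.H)| := by
    intro x
    have : S.H - 1 ≤ |m - x * (2 * S.H)| := by
      rcases le_or_gt x k with h | h
      · refine le_trans ?_ (le_abs_self _)
        have := mul_le_mul_of_nonneg_right h (by linarith : 0 ≤ 2 * S.H)
        unfold center at hmk; linarith
      · refine le_trans ?_ (neg_le_abs _)
        have := mul_le_mul_of_nonneg_right (Int.add_one_le_of_lt h) (by linarith : 0 ≤ 2 * S.H)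
        unfold center at hmk; linarith
    exact_mod_cast this
  have hcomp : ∀ j : ℤ, ∀ r : ℝ, 0 ≤ r → r ≤ 3 / 4 →
      2 * ((S.H : ℝ) / 4) ≤ |(m : ℝ) - (j * S.L + r)| := by
    intro j r hr hr'
    have h1 := hmul (j * S.n)
    have h2 : (((j * S.n : ℤ) : ℝ)) * (2 * S.H) = j * S.L := by rw [L_eq_cast]; push_cast; ring
    rw [h2] at h1
    have h3 : |(m : ℝ) - j * S.L| ≤ |(m : ℝ) - (j * S.L + r)| + |r| := by
      have := abs_add_le ((m : ℝ) - (j * S.L + r)) r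
      ring_nf at this ⊢; linarith
    rw [abs_of_nonneg hr] at h3
    linarith
  refine ⟨by linarith, by linarith [S.two_H_le_L], fun j => hcomp j _ (by norm_num) (by norm_num),
    fun j => ?_, fun k' hk' _ => ?_⟩
  · have := hcomp j (3 / 4) (by norm_num) (by norm_num)
    unfold Scheme.comp
    convert this using 3
    ring
  · have hne : k ≠ k' := by
      rintro rfl
      rw [lt_abs] at hk'
      rcases hk' with h | h <;> linarith
    have : 2 * S.H - 1 ≤ |m - S.center k'| := by
      rcases lt_or_gt_of_ne hne with h | h
      · refine le_trans ?_ (neg_le_abs _)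
        have := mul_le_mul_of_nonneg_right (Int.add_one_le_of_lt h) (by linarith : 0 ≤ 2 * S.H)
        unfold center at hmk ⊢; linarith
      · refine le_trans ?_ (le_abs_self _)
        have := mul_le_mul_of_nonneg_right (Int.add_one_le_of_lt h) (by linarith : 0 ≤ 2 * S.H)
        unfold center at hmk ⊢; linarith
    have h' : 2 * (S.H : ℝ) - 1 ≤ |(m : ℝ) - S.center k'| := by exact_mod_cast this
    linarith

/-- The decay factor between the block of `m` and the block `j`. -/
noncomputable def decay (S : Scheme E) (m j : ℤ) : ℝ := 1 / (1 + |((m / S.L : ℤ) : ℝ) - j|) ^ 2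

theorem decay_pos (m j : ℤ) : 0 < S.decay m j := by unfold decay; positivity

theorem decay_self (m : ℤ) : S.decay m (m / S.L) = 1 := by simp [decay]

theorem comp_mem (j : ℤ) : (j : ℝ) * S.L ≤ S.comp j ∧ S.comp j + 1 / 4 ≤ (j + 1) * S.L := by
  have := S.L_ge
  unfold comp
  constructor <;> linarith

theorem FarFrom.comp_ge {c : ℝ} {m : ℤ} (h : FarFrom S ζ c m) (j : ℤ) :
    c * (1 + |((m / S.L : ℤ) : ℝ) - j|) ≤ |(m : ℝ) - S.comp j| ∧
    c * (1 + |((m / S.L : ℤ) : ℝ) - j|) ≤ |(m : ℝ) - (S.comp j + 1 / 4)| := by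
  obtain ⟨h1, h2⟩ := S.div_L m
  obtain ⟨h3, h4⟩ := S.comp_mem j
  exact ⟨block_dist_le h.pos.le h1 (by linarith) h3 (by linarith) (h.comp j) h.le,
    block_dist_le h.pos.le h1 (by linarith) (by linarith) h4 (h.comp' j) h.le⟩

theorem inv_mul_le_decay {c x y : ℝ} {m j : ℤ} (hc : 0 < c)
    (hx : c * (1 + |((m / S.L : ℤ) : ℝ) - j|) ≤ x) (hy : c * (1 + |((m / S.L : ℤ) : ℝ) - j|) ≤ y) :
    1 / (x * y) ≤ 1 / c ^ 2 * S.decay m j := by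
  unfold decay
  have h1 : 0 < c * (1 + |((m / S.L : ℤ) : ℝ) - j|) := by positivity
  have hx0 : 0 ≤ x := h1.le.trans hx
  calc 1 / (x * y) ≤ 1 / ((c * (1 + |((m / S.L : ℤ) : ℝ) - j|)) *
        (c * (1 + |((m / S.L : ℤ) : ℝ) - j|))) := by gcongr
    _ = _ := by field_simp

theorem norm_dipole_le (hω : AdmissibleWeight S.δ ω) {c : ℝ} {m : ℤ} (h : FarFrom S ζ c m)
    (j : ℤ) : ‖S.dipole ω j m‖ ≤ S.A / (2 * c ^ 2) * (blockWeight ω S.L j * S.decay m j) := by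
  have hc := h.pos
  obtain ⟨h1, h2⟩ := h.comp_ge j
  have hpos : 0 < c * (1 + |((m / S.L : ℤ) : ℝ) - j|) := by positivity
  have hL : (0 : ℝ) < S.L := by linarith [S.L_ge]
  have hW := blockWeight_pos hω hL j
  have hA : 0 ≤ S.A := by
    have := S.A_ge
    have := S.one_le_inv_pow
    have := S.n_cast
    nlinarith
  have n1 : (m : ℝ) - S.comp j ≠ 0 := by
    intro h0; rw [h0, abs_zero] at h1; linarith
  have n2 : (m : ℝ) - (S.comp j + 1 / 4) ≠ 0 := by
    intro h0; rw [h0, abs_zero] at h2; linarith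
  have e1 : 1 / ((m : ℝ) - S.comp j) - 1 / ((m : ℝ) - (S.comp j + 1 / 4)) =
      -(1 / 4) * (1 / (((m : ℝ) - S.comp j) * ((m : ℝ) - (S.comp j + 1 / 4)))) := by
    rw [div_sub_div _ _ n1 n2, mul_one_div]
    congr 1; ring
  have e2 : |1 / ((m : ℝ) - S.comp j) - 1 / ((m : ℝ) - (S.comp j + 1 / 4))| ≤
      1 / 4 * (1 / c ^ 2 * S.decay m j) := by
    rw [e1, abs_mul, abs_neg, abs_div 1 (_ * _), abs_mul, abs_one]
    have := inv_mul_le_decay (S := S) hc h1 h2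
    rw [abs_of_pos (by norm_num : (0 : ℝ) < 1 / 4)]
    gcongr
  have hu := S.T.norm_u₂.2
  have hd := S.decay_pos m j
  unfold dipole
  rw [norm_smul, Real.norm_eq_abs, abs_mul, abs_of_nonneg (by positivity : 0 ≤ S.A * _)]
  calc S.A * blockWeight ω S.L j *
        |1 / ((m : ℝ) - S.comp j) - 1 / ((m : ℝ) - (S.comp j + 1 / 4))| * ‖S.T.u.2.1‖
      ≤ S.A * blockWeight ω S.L j * (1 / 4 * (1 / c ^ 2 * S.decay m j)) * 2 := by
        gcongr; linarith
    _ = _ := by field_simp; ring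

theorem abs_kernel_le (m' m : ℤ) : |S.kernel ζ m' m| ≤ 64 * S.L * S.decay m (m' / S.L) := by
  have hf := farFrom_all (S := S) (ζ := ζ) m
  obtain ⟨h1, -⟩ := hf.comp_ge (m' / S.L)
  have hL := S.L_ge
  have n1 : (m : ℝ) - S.comp (m' / S.L) ≠ 0 := by
    intro h0
    have := hf.comp (m' / S.L)
    rw [h0, abs_zero] at this; norm_num at this
  obtain ⟨a1, a2⟩ := S.div_L m
  obtain ⟨b1, b2⟩ := S.div_L m'
  obtain ⟨c1, c2⟩ := S.comp_mem (m' / S.L)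
  unfold kernel
  split_ifs with hmm
  · subst hmm
    rw [decay_self, zero_sub, abs_neg, abs_div, abs_one, div_le_iff₀ (abs_pos.2 n1)]
    have := hf.comp (m' / S.L)
    nlinarith
  · have o1 := S.offset_nonneg (ζ m')
    have o2 := (S.offset_le (ζ m')).trans S.η_le
    have hq : 2 * (1 / 8 : ℝ) ≤ |(m : ℝ) - (m' + S.offset (ζ m'))| := by
      rcases lt_or_gt_of_ne hmm with h | h
      · have h' : (m' : ℝ) + 1 ≤ m := by exact_mod_cast h
        refine le_trans ?_ (le_abs_self _); linarith
      · have h' : (m : ℝ) + 1 ≤ m' := by exact_mod_cast h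
        refine le_trans ?_ (neg_le_abs _); linarith
    have h2 := block_dist_le (j := m' / S.L) (y := m' + S.offset (ζ m')) (by norm_num) a1
      (by linarith) (by linarith) (by linarith) hq (by linarith)
    have n2 : (m : ℝ) - m' - S.offset (ζ m') ≠ 0 := by
      intro h0
      rw [← sub_sub, h0, abs_zero] at hq; norm_num at hq
    rw [← sub_sub] at h2
    have e1 : 1 / ((m : ℝ) - m' - S.offset (ζ m')) - 1 / ((m : ℝ) - S.comp (m' / S.L)) =
        ((m' + S.offset (ζ m')) - S.comp (m' / S.L)) *
          (1 / (((m : ℝ) - m' - S.offset (ζ m')) * ((m : ℝ) - S.comp (m' / S.L)))) := by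
      rw [div_sub_div _ _ n2 n1, mul_one_div]
      congr 1; ring
    rw [e1, abs_mul, abs_div 1 (_ * _), abs_mul, abs_one]
    have h3 := inv_mul_le_decay (S := S) (by norm_num) h2 h1
    have h4 : |((m' : ℝ) + S.offset (ζ m')) - S.comp (m' / S.L)| ≤ S.L := by
      rw [abs_le]; constructor <;> linarith
    calc _ ≤ (S.L : ℝ) * (1 / (1 / 8) ^ 2 * S.decay m (m' / S.L)) := by gcongr
      _ = _ := by norm_num; ring

theorem weight_le_block (hω : AdmissibleWeight S.δ ω) (m : ℤ) :
    ω |(m : ℝ)| ≤ blockWeight ω S.L (m / S.L) := by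
  obtain ⟨a1, a2⟩ := S.div_L m
  exact le_blockWeight hω (by linarith [S.L_ge]) a1 (by linarith)

theorem norm_residue_le (hω : AdmissibleWeight S.δ ω) (he : ∀ m, ‖e m‖ ≤ S.radius ζ m) (m : ℤ) :
    ‖S.residue ω ζ e m‖ ≤ S.η * (1 + S.K) * blockWeight ω S.L (m / S.L) := by
  have hL : (0 : ℝ) < S.L := by linarith [S.L_ge]
  have hW := blockWeight_pos hω hL (m / S.L)
  have hη := S.η_pos
  have hK := S.K_ge
  unfold residue
  split_ifs
  · rw [norm_zero]; positivity
  · have hp := hω.pos |(m : ℝ)| (abs_nonneg _)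
    have o1 := S.offset_nonneg (ζ m)
    have o2 := S.offset_le (ζ m)
    have o3 := S.offset_mul_norm_le (ζ m)
    have hle := weight_le_block (S := S) hω m
    rw [norm_neg, norm_smul, val, norm_smul, Real.norm_of_nonneg o1, Real.norm_of_nonneg hp.le]
    have h1 : S.offset (ζ m) * ‖ζ m + e m‖ ≤ S.η * (1 + S.K) := by
      calc S.offset (ζ m) * ‖ζ m + e m‖ ≤ S.offset (ζ m) * (‖ζ m‖ + S.K) := by
            gcongr
            exact (norm_add_le _ _).trans (by linarith [he m, S.radius_le (ζ := ζ) m])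
        _ = S.offset (ζ m) * ‖ζ m‖ + S.offset (ζ m) * S.K := by ring
        _ ≤ S.η + S.η * S.K := by gcongr
        _ = _ := by ring
    calc S.offset (ζ m) * (ω |(m : ℝ)| * ‖ζ m + e m‖)
        = (S.offset (ζ m) * ‖ζ m + e m‖) * ω |(m : ℝ)| := by ring
      _ ≤ _ := by gcongr

theorem norm_residue_sub_le {d : ℝ} (hω : AdmissibleWeight S.δ ω) (hd0 : 0 ≤ d)
    (hd : ∀ m, ‖e m - e' m‖ ≤ d * S.radius ζ m) (m : ℤ) :
    ‖S.residue ω ζ e m - S.residue ω ζ e' m‖ ≤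
      d * (S.η * (1 + S.K)) * blockWeight ω S.L (m / S.L) := by
  have hL : (0 : ℝ) < S.L := by linarith [S.L_ge]
  have hW := blockWeight_pos hω hL (m / S.L)
  have hη := S.η_pos
  have hK := S.K_ge
  unfold residue
  split_ifs
  · rw [sub_zero, norm_zero]; positivity
  · have hp := hω.pos |(m : ℝ)| (abs_nonneg _)
    have o1 := S.offset_nonneg (ζ m)
    have o2 := S.offset_le (ζ m)
    have hle := weight_le_block (S := S) hω m
    have h1 : ‖val ω ζ e m - val ω ζ e' m‖ ≤ d * S.K * ω |(m : ℝ)| := by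
      refine norm_val_sub_val hω ((hd m).trans ?_)
      gcongr
      exact S.radius_le m
    rw [← neg_sub_neg, neg_neg, neg_neg, ← smul_sub, norm_smul, Real.norm_of_nonneg o1,
      norm_sub_rev]
    calc S.offset (ζ m) * ‖val ω ζ e m - val ω ζ e' m‖ ≤ S.η * (d * S.K * ω |(m : ℝ)|) := by gcongr
      _ = d * (S.η * S.K) * ω |(m : ℝ)| := by ring
      _ ≤ _ := by gcongr; linarith

theorem center_div (k : ℤ) : S.center k / S.L = k / S.n := by
  obtain ⟨h1, h2⟩ := S.center_mem k
  have hH := S.H_cast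
  have h1' : k / S.n * S.L ≤ S.center k := by
    exact_mod_cast (by linarith : ((k / S.n : ℤ) : ℝ) * S.L ≤ S.center k)
  have h2' : S.center k < (k / S.n + 1) * S.L := by
    exact_mod_cast (by linarith : (S.center k : ℝ) < ((k / S.n : ℤ) + 1) * S.L)
  rw [Int.ediv_eq_iff_of_pos S.L_pos]
  constructor <;> linarith

theorem block_of_core {k m : ℤ} (h : |m - S.center k| ≤ 1) : m / S.L = k / S.n := by
  obtain ⟨h1, h2⟩ := S.center_mem k
  have hH := S.H_cast
  have h' : |(m : ℝ) - S.center k| ≤ 1 := by exact_mod_cast h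
  rw [abs_le] at h'
  have h1' : k / S.n * S.L ≤ m := by
    exact_mod_cast (by linarith : ((k / S.n : ℤ) : ℝ) * S.L ≤ m)
  have h2' : m < (k / S.n + 1) * S.L := by
    exact_mod_cast (by linarith : (m : ℝ) < ((k / S.n : ℤ) + 1) * S.L)
  rw [Int.ediv_eq_iff_of_pos S.L_pos]
  constructor <;> linarith

theorem weight_center_le (hω : AdmissibleWeight S.δ ω) (k : ℤ) :
    (S.tripleWeight ω k).2.1 ≤ blockWeight ω S.L (k / S.n) := by
  have := weight_le_block (S := S) hω (S.center k)
  rwa [center_div] at this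

/-- The constant in the estimate of the influence of a triple. -/
noncomputable def tripleConst (S : Scheme E) (c : ℝ) : ℝ :=
  1014 * S.δ⁻¹ ^ 3 * S.L / c ^ 2 + 50 * S.δ⁻¹ ^ 3 / c

theorem triple_factor_le {c : ℝ} {m k : ℤ} (h : FarFrom S ζ c m) (hk : k ∈ S.good ζ)
    (hm : ¬ |m - S.center k| ≤ 1) :
    2 ≤ |(m : ℝ) - S.center k| ∧
    (m : ℝ) - S.center k + (S.center k - S.comp (k / S.n)) ≠ 0 ∧
    (1 + |S.center k - S.comp (k / S.n)|) / (|(m : ℝ) - S.center k| *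
      |(m : ℝ) - S.center k + (S.center k - S.comp (k / S.n))|) ≤
      S.L * (1 / c ^ 2 * S.decay m (k / S.n)) := by
  rw [not_le] at hm
  have hc := h.pos
  obtain ⟨h1, -⟩ := h.comp_ge (k / S.n)
  obtain ⟨a1, a2⟩ := S.div_L m
  obtain ⟨b1, b2⟩ := S.center_mem k
  have hH := S.H_cast
  have hL := S.L_ge
  have h2 := block_dist_le (j := k / S.n) hc.le a1 (by linarith) (by linarith)
    (by linarith) (h.triple k hm hk) h.le
  have hpos : 0 < c * (1 + |((m / S.L : ℤ) : ℝ) - ((k / S.n : ℤ) : ℝ)|) := by positivity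
  have h3 := inv_mul_le_decay (S := S) hc h2 h1
  have e1 : (m : ℝ) - S.center k + (S.center k - S.comp (k / S.n)) = m - S.comp (k / S.n) := by
    ring
  have hm2 : 2 ≤ |m - S.center k| := by omega
  rw [e1]
  refine ⟨by exact_mod_cast hm2, fun h0 => ?_, ?_⟩
  · rw [h0, abs_zero] at h1; linarith
  · rw [div_eq_mul_one_div]
    have h4 : 1 + |S.center k - S.comp (k / S.n)| ≤ S.L := by
      have : |S.center k - S.comp (k / S.n)| ≤ S.L - 1 := by
        unfold comp
        rw [abs_le]; constructor <;> linarith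
      linarith
    gcongr

theorem own_factor_le {c : ℝ} {m k : ℤ} (h : FarFrom S ζ c m) (hm : |m - S.center k| ≤ 1) :
    |1 / ((m : ℝ) - S.comp (k / S.n))| ≤ 1 / c * S.decay m (k / S.n) := by
  rw [← block_of_core hm, decay_self, mul_one, abs_div, abs_one]
  have hc := h.pos
  have := h.comp (m / S.L)
  gcongr
  linarith

theorem norm_tripleTerm_le (hω : AdmissibleWeight S.δ ω) (he : ∀ m, ‖e m‖ ≤ S.radius ζ m)
    {c : ℝ} {m : ℤ} (h : FarFrom S ζ c m) (k : ℤ) :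
    ‖S.tripleTerm ω ζ e k m‖ ≤
      S.tripleConst c * (blockWeight ω S.L (k / S.n) * S.decay m (k / S.n)) := by
  have hL := S.L_ge
  have hW := blockWeight_pos hω (by linarith : (0 : ℝ) < S.L) (k / S.n)
  have hd := S.decay_pos m (k / S.n)
  have hR := S.one_le_inv_pow
  have hc := h.pos
  unfold tripleTerm
  split_ifs with hk hm
  · have hnear := nearTriple hω he hk
    obtain ⟨n1, -⟩ := TripleSolver.norm_αβ_le hR (comparable hω k) hnear
    have hw := weight_center_le (S := S) hω k
    have hf := own_factor_le h hm
    have hw0 := hnear.pos₂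
    rw [norm_neg, norm_smul, Real.norm_eq_abs]
    calc _ ≤ (1 / c * S.decay m (k / S.n)) *
          (4 * S.δ⁻¹ ^ 3 * blockWeight ω S.L (k / S.n)) := by
          gcongr
          exact n1.trans (by gcongr)
      _ = (4 * S.δ⁻¹ ^ 3 / c) * (blockWeight ω S.L (k / S.n) * S.decay m (k / S.n)) := by ring
      _ ≤ (0 + 50 * S.δ⁻¹ ^ 3 / c) * (blockWeight ω S.L (k / S.n) * S.decay m (k / S.n)) := by
          rw [zero_add]; gcongr; norm_num
      _ ≤ _ := by unfold tripleConst; gcongr; positivity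
  · have hnear := nearTriple hω he hk
    obtain ⟨f1, f2, f3⟩ := triple_factor_le h hk hm
    have hw := weight_center_le (S := S) hω k
    have hw0 := hnear.pos₂
    refine (TripleSolver.norm_field_le hR (comparable hω k) hnear f1 f2).trans ?_
    calc _ ≤ 1014 * S.δ⁻¹ ^ 3 * blockWeight ω S.L (k / S.n) *
          (S.L * (1 / c ^ 2 * S.decay m (k / S.n))) := by gcongr
      _ = (1014 * S.δ⁻¹ ^ 3 * S.L / c ^ 2 + 0) *
          (blockWeight ω S.L (k / S.n) * S.decay m (k / S.n)) := by ring
      _ ≤ _ := by unfold tripleConst; gcongr; positivity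
  · rw [norm_zero]; unfold tripleConst; positivity

theorem norm_tripleTerm_sub_le {d : ℝ} (hω : AdmissibleWeight S.δ ω)
    (he : ∀ m, ‖e m‖ ≤ S.radius ζ m) (he' : ∀ m, ‖e' m‖ ≤ S.radius ζ m) (hd0 : 0 ≤ d)
    (hd : ∀ m, ‖e m - e' m‖ ≤ d * S.radius ζ m) {c : ℝ} {m : ℤ} (h : FarFrom S ζ c m) (k : ℤ) :
    ‖S.tripleTerm ω ζ e k m - S.tripleTerm ω ζ e' k m‖ ≤
      d * (S.tripleConst c * (blockWeight ω S.L (k / S.n) * S.decay m (k / S.n))) := by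
  have hL := S.L_ge
  have hW := blockWeight_pos hω (by linarith : (0 : ℝ) < S.L) (k / S.n)
  have hdec := S.decay_pos m (k / S.n)
  have hR := S.one_le_inv_pow
  have hc := h.pos
  unfold tripleTerm
  split_ifs with hk hm
  · have hnear := nearTriple hω he hk
    obtain ⟨n1, -⟩ := TripleSolver.norm_αβ_sub_le hR (comparable hω k) hnear
      (nearTriple hω he' hk) (closeTriples hω hd0 hd hk)
    have hw := weight_center_le (S := S) hω k
    have hf := own_factor_le h hm
    have hw0 := hnear.pos₂
    rw [neg_sub_neg, ← smul_sub, norm_smul, Real.norm_eq_abs, norm_sub_rev]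
    calc _ ≤ (1 / c * S.decay m (k / S.n)) *
          (50 * S.δ⁻¹ ^ 3 * d * blockWeight ω S.L (k / S.n)) := by
          gcongr
          exact n1.trans (by gcongr)
      _ = d * ((0 + 50 * S.δ⁻¹ ^ 3 / c) *
          (blockWeight ω S.L (k / S.n) * S.decay m (k / S.n))) := by ring
      _ ≤ _ := by unfold tripleConst; gcongr; positivity
  · have hnear := nearTriple hω he hk
    obtain ⟨f1, f2, f3⟩ := triple_factor_le h hk hm
    have hw := weight_center_le (S := S) hω k
    have hw0 := hnear.pos₂
    refine (TripleSolver.norm_field_sub_le hR (comparable hω k) hnear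
      (nearTriple hω he' hk) (closeTriples hω hd0 hd hk) f1 f2).trans ?_
    refine mul_le_mul_of_nonneg_left ?_ hd0
    calc _ ≤ 1014 * S.δ⁻¹ ^ 3 * blockWeight ω S.L (k / S.n) *
          (S.L * (1 / c ^ 2 * S.decay m (k / S.n))) := by gcongr
      _ = (1014 * S.δ⁻¹ ^ 3 * S.L / c ^ 2 + 0) *
          (blockWeight ω S.L (k / S.n) * S.decay m (k / S.n)) := by ring
      _ ≤ _ := by unfold tripleConst; gcongr; positivity
  · rw [sub_zero, norm_zero]; unfold tripleConst; positivity

/-- The constant in the estimate of the influence of a block. -/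
noncomputable def restConst (S : Scheme E) (c : ℝ) : ℝ :=
  S.A / (2 * c ^ 2) + 1 / S.H + S.n * S.tripleConst c

theorem div_L_of_mem {j m : ℤ} (h : m ∈ Finset.Ico (j * S.L) ((j + 1) * S.L)) : m / S.L = j := by
  rw [Finset.mem_Ico] at h
  rw [Int.ediv_eq_iff_of_pos S.L_pos]
  constructor <;> linarith

theorem div_n_of_mem {j k : ℤ} (h : k ∈ Finset.Ico (j * S.n) ((j + 1) * S.n)) : k / S.n = j := by
  rw [Finset.mem_Ico] at h
  have hn : 0 < S.n := by linarith [S.n_pos]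
  rw [Int.ediv_eq_iff_of_pos hn]
  constructor <;> linarith

theorem card_block (j : ℤ) : ((Finset.Ico (j * S.L) ((j + 1) * S.L)).card : ℝ) = S.L := by
  have : (((Finset.Ico (j * S.L) ((j + 1) * S.L)).card : ℤ) : ℝ) = S.L := by
    rw [Int.card_Ico, Int.toNat_of_nonneg (by linarith [S.L_pos])]; push_cast; ring
  exact_mod_cast this

theorem card_cells (j : ℤ) : ((Finset.Ico (j * S.n) ((j + 1) * S.n)).card : ℝ) = S.n := by
  have : (((Finset.Ico (j * S.n) ((j + 1) * S.n)).card : ℤ) : ℝ) = S.n := by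
    rw [Int.card_Ico, Int.toNat_of_nonneg (by linarith [S.n_pos])]; push_cast; ring
  exact_mod_cast this

theorem norm_kernel_sum_le (hω : AdmissibleWeight S.δ ω) {f : ℤ → E} {d : ℝ} (hd : 0 ≤ d)
    (hf : ∀ m, ‖f m‖ ≤ d * (S.η * (1 + S.K)) * blockWeight ω S.L (m / S.L)) (j m : ℤ) :
    ‖∑ m' ∈ Finset.Ico (j * S.L) ((j + 1) * S.L), S.kernel ζ m' m • f m'‖ ≤
      d * (1 / S.H * (blockWeight ω S.L j * S.decay m j)) := by
  have hL := S.L_ge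
  have hW := blockWeight_pos hω (by linarith : (0 : ℝ) < S.L) j
  have hdec := S.decay_pos m j
  have hη := S.η_pos
  have hK := S.K_ge
  have hsmall := S.small
  rw [← L_eq_cast] at hsmall
  calc _ ≤ ∑ m' ∈ Finset.Ico (j * S.L) ((j + 1) * S.L),
        (64 * S.L * S.decay m j) * (d * (S.η * (1 + S.K)) * blockWeight ω S.L j) := by
        refine norm_sum_le_of_le _ fun m' hm' => ?_
        have h1 := abs_kernel_le (S := S) (ζ := ζ) m' m
        have h2 := hf m'
        rw [div_L_of_mem hm'] at h1 h2
        rw [norm_smul, Real.norm_eq_abs]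
        gcongr
    _ = d * ((64 * (S.L : ℝ) ^ 2 * (S.η * (1 + S.K))) * (blockWeight ω S.L j * S.decay m j)) := by
        rw [Finset.sum_const, nsmul_eq_mul, card_block]; ring
    _ ≤ _ := by gcongr

theorem norm_rest_le (hω : AdmissibleWeight S.δ ω) (he : ∀ m, ‖e m‖ ≤ S.radius ζ m)
    {c : ℝ} {m : ℤ} (h : FarFrom S ζ c m) (j : ℤ) :
    ‖S.rest ω ζ e j m‖ ≤ S.restConst c * (blockWeight ω S.L j * S.decay m j) := by
  have h1 := norm_dipole_le hω h j
  have h2 := norm_kernel_sum_le (S := S) (ζ := ζ) hω (d := 1) zero_le_one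
    (by simpa using norm_residue_le hω he) j m
  have h3 : ‖∑ k ∈ Finset.Ico (j * S.n) ((j + 1) * S.n), S.tripleTerm ω ζ e k m‖ ≤
      S.n * (S.tripleConst c * (blockWeight ω S.L j * S.decay m j)) := by
    calc _ ≤ ∑ k ∈ Finset.Ico (j * S.n) ((j + 1) * S.n),
          S.tripleConst c * (blockWeight ω S.L j * S.decay m j) := by
          refine norm_sum_le_of_le _ fun k hk => ?_
          have := norm_tripleTerm_le hω he h k
          rwa [div_n_of_mem hk] at this
      _ = _ := by rw [Finset.sum_const, nsmul_eq_mul, card_cells]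
  unfold rest
  refine (norm_add_le _ _).trans ((add_le_add ((norm_add_le _ _).trans (add_le_add h1 h2))
    h3).trans (le_of_eq ?_))
  unfold restConst; ring

theorem norm_rest_sub_le {d : ℝ} (hω : AdmissibleWeight S.δ ω)
    (he : ∀ m, ‖e m‖ ≤ S.radius ζ m) (he' : ∀ m, ‖e' m‖ ≤ S.radius ζ m) (hd0 : 0 ≤ d)
    (hd : ∀ m, ‖e m - e' m‖ ≤ d * S.radius ζ m) {c : ℝ} {m : ℤ} (h : FarFrom S ζ c m) (j : ℤ) :
    ‖S.rest ω ζ e j m - S.rest ω ζ e' j m‖ ≤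
      d * (S.restConst c * (blockWeight ω S.L j * S.decay m j)) := by
  have h2 := norm_kernel_sum_le (S := S) (ζ := ζ) hω (d := d) hd0
    (norm_residue_sub_le hω hd0 hd) j m
  have h3 : ‖∑ k ∈ Finset.Ico (j * S.n) ((j + 1) * S.n),
      (S.tripleTerm ω ζ e k m - S.tripleTerm ω ζ e' k m)‖ ≤
      S.n * (d * (S.tripleConst c * (blockWeight ω S.L j * S.decay m j))) := by
    calc _ ≤ ∑ k ∈ Finset.Ico (j * S.n) ((j + 1) * S.n),
          d * (S.tripleConst c * (blockWeight ω S.L j * S.decay m j)) := by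
          refine norm_sum_le_of_le _ fun k hk => ?_
          have := norm_tripleTerm_sub_le hω he he' hd0 hd h k
          rwa [div_n_of_mem hk] at this
      _ = _ := by rw [Finset.sum_const, nsmul_eq_mul, card_cells]
  have e1 : S.rest ω ζ e j m - S.rest ω ζ e' j m =
      ∑ m' ∈ Finset.Ico (j * S.L) ((j + 1) * S.L),
        S.kernel ζ m' m • (S.residue ω ζ e m' - S.residue ω ζ e' m') +
      ∑ k ∈ Finset.Ico (j * S.n) ((j + 1) * S.n),
        (S.tripleTerm ω ζ e k m - S.tripleTerm ω ζ e' k m) := by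
    unfold rest
    simp only [smul_sub, Finset.sum_sub_distrib]
    abel
  have h4 : 0 ≤ ‖S.dipole ω j m‖ := norm_nonneg _
  have h5 := norm_dipole_le hω h j
  rw [e1]
  refine (norm_add_le _ _).trans ((add_le_add h2 h3).trans ?_)
  unfold restConst
  have h6 : 0 ≤ d * (S.A / (2 * c ^ 2) * (blockWeight ω S.L j * S.decay m j)) :=
    mul_nonneg hd0 (h4.trans h5)
  linarith

end Scheme

namespace Scheme

variable {E : Type*} [NormedAddCommGroup E] [NormedSpace ℝ E] [MeasurableSpace E]
variable {S : Scheme E} {ω : ℝ → ℝ} {ζ e e' : ℤ → E}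

theorem block_decay_eq (m : ℤ) : (fun j => blockWeight ω S.L j * S.decay m j) =
    fun j : ℤ => blockWeight ω S.L j / (1 + |((m / S.L : ℤ) : ℝ) - j|) ^ 2 := by
  funext j; unfold decay; ring

theorem summable_block_decay (hω : AdmissibleWeight S.δ ω) (m : ℤ) :
    Summable fun j => blockWeight ω S.L j * S.decay m j := by
  rw [block_decay_eq]
  exact summable_blockWeight hω (by linarith [S.L_ge]) _

theorem restConst_pos {c : ℝ} (hc : 0 < c) : 0 < S.restConst c := by
  have hL := S.L_ge
  have hn := S.n_cast
  have hH := S.H_cast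
  have hδ := S.δ_pos
  have hA : 0 < S.A := by
    have := S.A_ge
    have := S.one_le_inv_pow
    nlinarith
  unfold restConst tripleConst
  positivity

theorem exists_farFrom (hω : AdmissibleWeight S.δ ω) (m : ℤ) :
    ∃ c, FarFrom S ζ c m ∧
      S.restConst c * ∑' j, blockWeight ω S.L j * S.decay m j ≤
        ω |(m : ℝ)| * (S.radius ζ m / 2) := by
  have hL := S.L_ge
  have hp := hω.pos |(m : ℝ)| (abs_nonneg _)
  obtain ⟨a1, a2⟩ := S.div_L m
  have hδ := S.δ_pos
  have hbh : (0 : ℝ) ≤ blockHeight (m / S.L) := by exact_mod_cast blockHeight_nonneg _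
  by_cases hm : S.IsCore ζ m
  · have hfar := farFrom_core hm
    refine ⟨_, hfar, ?_⟩
    have hsum := tsum_blockWeight_le hω S.δ_pos (by linarith) a1 (by linarith) S.I_pos
    rw [radius_of_core hm, block_decay_eq]
    have hc := S.core
    rw [← L_eq_cast] at hc
    have hJ : (S.J : ℝ) ≤ blockHeight (m / S.L) := by
      obtain ⟨k, hk, hmk⟩ := hm
      rw [block_of_core hmk]
      exact_mod_cast S.allowed_high k hk.1
    have hJ0 : (0 : ℝ) ≤ S.J := by exact_mod_cast S.J_nonneg
    have hrc := restConst_pos (S := S) hfar.pos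
    calc _ ≤ S.restConst (S.H / 4) * (ω |(m : ℝ)| * (blockSum * S.δ⁻¹ ^ S.I +
          (8 * 2⁻¹ ^ S.I + 8 / (S.J + 1)) * S.L / S.δ)) := by
          gcongr
          refine hsum.trans ?_
          gcongr
      _ = ω |(m : ℝ)| * (S.restConst (S.H / 4) * (blockSum * S.δ⁻¹ ^ S.I +
          (8 * 2⁻¹ ^ S.I + 8 / (S.J + 1)) * S.L / S.δ)) := by ring
      _ ≤ ω |(m : ℝ)| * (1 / 64) := by
          gcongr
          exact hc
      _ = _ := by norm_num
  · have hfar := farFrom_all (S := S) (ζ := ζ) m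
    refine ⟨_, hfar, ?_⟩
    have hsum := tsum_blockWeight_le hω S.δ_pos (by linarith) a1 (by linarith) (le_refl 1)
    have hrad : S.radius ζ m = S.K := if_neg hm
    rw [hrad, block_decay_eq]
    have hc := S.regular
    rw [← L_eq_cast] at hc
    have hrc := restConst_pos (S := S) hfar.pos
    have hbs := one_le_blockSum
    have hle : S.restConst (1 / 8) ≤ S.A / (2 * (1 / 8) ^ 2) + 1 +
        S.n * (1014 * S.δ⁻¹ ^ 3 * S.L / (1 / 8) ^ 2 + 50 * S.δ⁻¹ ^ 3 / (1 / 8)) := by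
      unfold restConst tripleConst
      have : 1 / (S.H : ℝ) ≤ 1 := by
        have hH := S.H_cast
        rw [div_le_one (by linarith)]; linarith
      linarith
    calc _ ≤ S.restConst (1 / 8) * (ω |(m : ℝ)| * (blockSum * S.δ⁻¹ ^ 1 +
          (8 * 2⁻¹ ^ 1 + 8 / 1) * S.L / S.δ)) := by
          gcongr
          refine hsum.trans ?_
          gcongr
          linarith
      _ ≤ (S.A / (2 * (1 / 8) ^ 2) + 1 +
        S.n * (1014 * S.δ⁻¹ ^ 3 * S.L / (1 / 8) ^ 2 + 50 * S.δ⁻¹ ^ 3 / (1 / 8))) *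
          (ω |(m : ℝ)| * (blockSum * S.δ⁻¹ ^ 1 + (8 * 2⁻¹ ^ 1 + 8 / 1) * S.L / S.δ)) := by
          gcongr
      _ = ω |(m : ℝ)| * ((S.A / (2 * (1 / 8) ^ 2) + 1 +
        S.n * (1014 * S.δ⁻¹ ^ 3 * S.L / (1 / 8) ^ 2 + 50 * S.δ⁻¹ ^ 3 / (1 / 8))) *
          (blockSum * S.δ⁻¹ ^ 1 + (8 * 2⁻¹ ^ 1 + 8 / 1) * S.L / S.δ)) := by ring
      _ ≤ _ := by gcongr

theorem summable_rest [CompleteSpace E] (hω : AdmissibleWeight S.δ ω)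
    (he : ∀ m, ‖e m‖ ≤ S.radius ζ m) (m : ℤ) : Summable fun j => S.rest ω ζ e j m := by
  obtain ⟨c, hc, -⟩ := exists_farFrom (S := S) (ζ := ζ) hω m
  exact Summable.of_norm_bounded ((summable_block_decay hω m).mul_left _)
    (norm_rest_le hω he hc)

theorem step_halfContraction [CompleteSpace E] (hω : AdmissibleWeight S.δ ω) :
    HalfContraction (S.step ω ζ) (S.radius ζ) := by
  have key : ∀ (m : ℤ) (x : E) (d : ℝ), 0 ≤ d → ‖x‖ ≤ d * (ω |(m : ℝ)| * (S.radius ζ m / 2)) →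
      ‖-((1 / ω |(m : ℝ)|) • x)‖ ≤ d / 2 * S.radius ζ m := by
    intro m x d hd hx
    have hp := hω.pos |(m : ℝ)| (abs_nonneg _)
    rw [norm_neg, norm_smul, Real.norm_of_nonneg (by positivity), one_div,
      inv_mul_le_iff₀ hp]
    linarith
  refine ⟨radius_nonneg, fun e he m => ?_, fun e e' d hd0 he he' hd m => ?_⟩
  · obtain ⟨c, hc, hle⟩ := exists_farFrom (S := S) (ζ := ζ) hω m
    have h1 : ‖∑' j, S.rest ω ζ e j m‖ ≤
        S.restConst c * ∑' j, blockWeight ω S.L j * S.decay m j := by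
      rw [← tsum_mul_left]
      exact tsum_of_norm_bounded ((summable_block_decay hω m).mul_left _).hasSum
        (norm_rest_le hω he hc)
    have h2 := key m _ 1 zero_le_one (by rw [one_mul]; exact h1.trans hle)
    have h3 := S.radius_nonneg (ζ := ζ) m
    unfold step
    linarith
  · obtain ⟨c, hc, hle⟩ := exists_farFrom (S := S) (ζ := ζ) hω m
    have h1 : ‖∑' j, S.rest ω ζ e j m - ∑' j, S.rest ω ζ e' j m‖ ≤
        d * (S.restConst c * ∑' j, blockWeight ω S.L j * S.decay m j) := by
      rw [← (summable_rest hω he m).tsum_sub (summable_rest hω he' m), ← tsum_mul_left,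
        ← tsum_mul_left]
      exact tsum_of_norm_bounded (((summable_block_decay hω m).mul_left _).mul_left _).hasSum
        (norm_rest_sub_le hω he he' hd0 hd hc)
    have h2 := key m _ d hd0 (h1.trans (by gcongr))
    unfold step
    rw [smul_sub, neg_sub] at h2
    rwa [neg_sub_neg]

/-- The solution of the interpolation system. -/
noncomputable def sol [CompleteSpace E] (hω : AdmissibleWeight S.δ ω) (ζ : ℤ → E) : ℤ → E :=
  Classical.choose (step_halfContraction (S := S) (ζ := ζ) hω).exists_fixed

theorem sol_spec [CompleteSpace E] (hω : AdmissibleWeight S.δ ω) (ζ : ℤ → E) :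
    (∀ m, ‖sol hω ζ m‖ ≤ S.radius ζ m) ∧ S.step ω ζ (sol hω ζ) = sol hω ζ ∧
      ∀ m, Filter.Tendsto (fun k => (S.step ω ζ)^[k] 0 m) Filter.atTop (nhds (sol hω ζ m)) :=
  Classical.choose_spec (step_halfContraction (S := S) (ζ := ζ) hω).exists_fixed

/-- The equation solved by the fixed point. -/
theorem sol_eq [CompleteSpace E] (hω : AdmissibleWeight S.δ ω) (ζ : ℤ → E) (m : ℤ) :
    val ω ζ (sol hω ζ) m + ∑' j, S.rest ω ζ (sol hω ζ) j m = ω |(m : ℝ)| • ζ m := by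
  have hp := hω.pos |(m : ℝ)| (abs_nonneg _)
  have h := congrFun (sol_spec hω ζ).2.1 m
  have h1 : ω |(m : ℝ)| • sol hω ζ m = -∑' j, S.rest ω ζ (sol hω ζ) j m := by
    rw [← h, step, smul_neg, smul_smul, mul_one_div_cancel hp.ne', one_smul]
  rw [val, smul_add, h1]; abel

/-! ### Vanishing values -/

theorem good_update {m : ℤ} (hm : ¬ S.IsCore ζ m) :
    S.good (Function.update ζ m 0) = S.good ζ := by
  have h1 := S.T.norm_u₁.1
  have h2 := S.T.norm_u₂.1
  have h3 := S.T.norm_u₃.1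
  ext k
  constructor
  · rintro ⟨ha, k1, k2, k3⟩
    have n1 : S.center k - 1 ≠ m := by
      rintro rfl
      rw [Function.update_self, zero_sub, norm_neg] at k1; linarith
    have n2 : S.center k ≠ m := by
      rintro rfl
      rw [Function.update_self, zero_sub, norm_neg] at k2; linarith
    have n3 : S.center k + 1 ≠ m := by
      rintro rfl
      rw [Function.update_self, zero_sub, norm_neg] at k3; linarith
    rw [Function.update_of_ne n1] at k1
    rw [Function.update_of_ne n2] at k2
    rw [Function.update_of_ne n3] at k3
    exact ⟨ha, k1, k2, k3⟩
  · intro hk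
    obtain ⟨c1, c2, c3⟩ := isCore_triple hk
    have n1 : S.center k - 1 ≠ m := fun h => hm (h ▸ c1)
    have n2 : S.center k ≠ m := fun h => hm (h ▸ c2)
    have n3 : S.center k + 1 ≠ m := fun h => hm (h ▸ c3)
    obtain ⟨ha, k1, k2, k3⟩ := hk
    refine ⟨ha, ?_, ?_, ?_⟩
    · rwa [Function.update_of_ne n1]
    · rwa [Function.update_of_ne n2]
    · rwa [Function.update_of_ne n3]

/-- If the value at a regular integer vanishes, then the solution does not depend on the datum
there. -/
theorem sol_update [CompleteSpace E] (hω : AdmissibleWeight S.δ ω) {m : ℤ}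
    (hm : ¬ S.IsCore ζ m) (hv : val ω ζ (sol hω ζ) m = 0) :
    sol hω (Function.update ζ m 0) = sol hω ζ := by
  set ζ' := Function.update ζ m 0 with hζ'
  have hg : S.good ζ' = S.good ζ := good_update hm
  have hcore : ∀ m', S.IsCore ζ' m' ↔ S.IsCore ζ m' := by
    intro m'; unfold IsCore; rw [hg]
  have hrad : S.radius ζ' = S.radius ζ := by
    funext m'
    unfold radius
    by_cases h : S.IsCore ζ m'
    · rw [if_pos h, if_pos ((hcore m').2 h)]
    · rw [if_neg h, if_neg (mt (hcore m').1 h)]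
  have hne : ∀ m', m' ≠ m → ζ' m' = ζ m' := fun m' h => Function.update_of_ne h _ _
  have hval : ∀ e m', m' ≠ m → val ω ζ' e m' = val ω ζ e m' := by
    intro e m' h; unfold val; rw [hne m' h]
  have htrip : ∀ e m' k, S.tripleTerm ω ζ' e k m' = S.tripleTerm ω ζ e k m' := by
    intro e m' k
    unfold tripleTerm
    rw [hg]
    by_cases hk : k ∈ S.good ζ
    · obtain ⟨c1, c2, c3⟩ := isCore_triple hk
      have n1 : S.center k - 1 ≠ m := fun h => hm (h ▸ c1)
      have n2 : S.center k ≠ m := fun h => hm (h ▸ c2)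
      have n3 : S.center k + 1 ≠ m := fun h => hm (h ▸ c3)
      have : S.tripleVal ω ζ' e k = S.tripleVal ω ζ e k := by
        unfold tripleVal
        rw [hval e _ n1, hval e _ n2, hval e _ n3]
      rw [this]
    · simp [hk]
  have hres : ∀ m₁ m₂, S.kernel ζ' m₁ m₂ • S.residue ω ζ' (sol hω ζ) m₁ =
      S.kernel ζ m₁ m₂ • S.residue ω ζ (sol hω ζ) m₁ := by
    intro m₁ m₂
    rcases eq_or_ne m₁ m with rfl | h
    · have r1 : S.residue ω ζ (sol hω ζ) m₁ = 0 := by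
        unfold residue; rw [hv]; simp
      have r2 : S.residue ω ζ' (sol hω ζ) m₁ = 0 := by
        unfold residue offset
        have : ζ' m₁ = 0 := Function.update_self _ _ _
        rw [if_pos this]; simp
      rw [r1, r2, smul_zero, smul_zero]
    · have r1 : S.residue ω ζ' (sol hω ζ) m₁ = S.residue ω ζ (sol hω ζ) m₁ := by
        unfold residue
        rw [hval _ _ h, hne _ h]
        by_cases hc : S.IsCore ζ m₁
        · rw [if_pos hc, if_pos ((hcore m₁).2 hc)]
        · rw [if_neg hc, if_neg (mt (hcore m₁).1 hc)]
      unfold kernel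
      rw [r1, hne _ h]
  have hrest : ∀ j m', S.rest ω ζ' (sol hω ζ) j m' = S.rest ω ζ (sol hω ζ) j m' := by
    intro j m'
    unfold rest
    simp only [hres, htrip]
  obtain ⟨s1, s2, -⟩ := sol_spec hω ζ
  obtain ⟨t1, t2, -⟩ := sol_spec hω ζ'
  refine (step_halfContraction (S := S) (ζ := ζ') hω).unique t1 ?_ t2 ?_
  · rw [hrad]; exact s1
  · nth_rw 2 [← s2]
    funext m'
    unfold step
    simp only [hrest]

/-! ### Measurability of the solution -/

section Measurability

variable [BorelSpace E]

theorem measurableSet_good (k : ℤ) : MeasurableSet {ζ : ℤ → E | k ∈ S.good ζ} := by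
  by_cases hk : k ∈ S.allowed
  · have : {ζ : ℤ → E | k ∈ S.good ζ} =
        {ζ | ‖ζ (S.center k - 1) - S.T.u.1‖ ≤ 1 / 32} ∩
        ({ζ | ‖ζ (S.center k) - S.T.u.2.1‖ ≤ 1 / 32} ∩
          {ζ | ‖ζ (S.center k + 1) - S.T.u.2.2‖ ≤ 1 / 32}) := by
      ext ζ; simp [good, hk]
    rw [this]
    refine MeasurableSet.inter ?_ (MeasurableSet.inter ?_ ?_) <;>
    exact measurableSet_le (by fun_prop) measurable_const
  · have : {ζ : ℤ → E | k ∈ S.good ζ} = ∅ := by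
      ext ζ; simp [good, hk]
    rw [this]; exact MeasurableSet.empty

theorem measurableSet_isCore (m : ℤ) : MeasurableSet {ζ : ℤ → E | S.IsCore ζ m} := by
  have : {ζ : ℤ → E | S.IsCore ζ m} =
      ⋃ k : ℤ, {ζ | k ∈ S.good ζ} ∩ {_ζ | |m - S.center k| ≤ 1} := by
    ext ζ; simp [IsCore]
  rw [this]
  exact MeasurableSet.iUnion fun k => (measurableSet_good k).inter (MeasurableSet.const _)

theorem measurable_offset : Measurable (S.offset : E → ℝ) := by
  unfold offset
  refine Measurable.ite (measurableSet_singleton 0) measurable_const ?_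
  fun_prop

variable [SecondCountableTopology E] {e : (ℤ → E) → ℤ → E}

theorem measurable_val (he : ∀ m, Measurable fun ζ => e ζ m) (m : ℤ) :
    Measurable fun ζ => val ω ζ (e ζ) m := by
  unfold val
  exact ((measurable_pi_apply m).add (he m)).const_smul _

theorem measurable_step [CompleteSpace E] (he : ∀ m, Measurable fun ζ => e ζ m) (m : ℤ) :
    Measurable fun ζ => S.step ω ζ (e ζ) m := by
  have hv := measurable_val (ω := ω) he
  have hres : ∀ m', Measurable fun ζ => S.residue ω ζ (e ζ) m' := by
    intro m'
    unfold residue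
    refine Measurable.ite (measurableSet_isCore m') measurable_const ?_
    exact ((measurable_offset.comp (measurable_pi_apply m')).smul (hv m')).neg
  have hker : ∀ m', Measurable fun ζ : ℤ → E => S.kernel ζ m' m := by
    intro m'
    unfold kernel
    refine Measurable.sub_const ?_ _
    by_cases h : m' = m
    · simp only [h, if_true]; exact measurable_const
    · simp only [h, if_false]
      exact measurable_const.div
        (measurable_const.sub (measurable_offset.comp (measurable_pi_apply m')))
  have htv : ∀ k, Measurable fun ζ => S.tripleVal ω ζ (e ζ) k := fun k =>
    (hv _).prodMk ((hv _).prodMk (hv _))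
  have hx : Measurable S.T.x :=
    S.T.measurable_a.div ((S.T.measurable_a.add S.T.measurable_b).add S.T.measurable_c)
  have hy : Measurable S.T.y :=
    S.T.measurable_b.div ((S.T.measurable_a.add S.T.measurable_b).add S.T.measurable_c)
  have hw : Measurable S.T.w :=
    S.T.measurable_c.div ((S.T.measurable_a.add S.T.measurable_b).add S.T.measurable_c)
  have hα : Measurable S.T.α := by
    unfold TripleSolver.α
    exact (hx.smul measurable_snd.snd).sub (hw.smul measurable_fst)
  have hβ : Measurable S.T.β := by
    unfold TripleSolver.β
    exact (hy.smul measurable_snd.fst).neg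
  have hfield : ∀ z s : ℝ, Measurable fun v => S.T.field v z s := by
    intro z s
    have hden : Measurable fun v => S.T.den v z := by
      unfold TripleSolver.den
      exact (measurable_const.sub ((hw.sub hx).mul_const _)).sub hy
    unfold TripleSolver.field
    exact (((measurable_const.div hden).sub_const _).smul hα).add
      ((measurable_const.div hden).smul hβ)
  have htrip : ∀ k, Measurable fun ζ => S.tripleTerm ω ζ (e ζ) k m := by
    intro k
    unfold tripleTerm
    refine Measurable.ite (measurableSet_good k) ?_ measurable_const
    by_cases h : |m - S.center k| ≤ 1
    · simp only [h, if_true]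
      exact ((hα.comp (htv k)).const_smul _).neg
    · simp only [h, if_false]
      exact (hfield _ _).comp (htv k)
  have hrest : ∀ j, Measurable fun ζ => S.rest ω ζ (e ζ) j m := by
    intro j
    unfold rest
    refine Measurable.add (Measurable.add measurable_const ?_) ?_
    · exact Finset.measurable_fun_sum _ fun m' _ => (hker m').smul (hres m')
    · exact Finset.measurable_fun_sum _ fun k _ => htrip k
  unfold step
  exact ((Measurable.tsum hrest).const_smul _).neg

theorem measurable_sol [CompleteSpace E] (hω : AdmissibleWeight S.δ ω) (m : ℤ) :
    Measurable fun ζ => sol hω ζ m := by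
  have hit : ∀ k : ℕ, ∀ m, Measurable fun ζ => (S.step ω ζ)^[k] 0 m := by
    intro k
    induction k with
    | zero => intro m; exact measurable_const
    | succ k ih =>
      intro m
      simp only [Function.iterate_succ_apply']
      exact measurable_step ih m
  refine measurable_of_tendsto_metrizable (fun k => hit k m) ?_
  rw [tendsto_pi_nhds]
  exact fun ζ => (sol_spec hω ζ).2.2 m

end Measurability

end Scheme

/-! ### The poles of the interpolating function -/

namespace Scheme

variable {E : Type*} [NormedAddCommGroup E] [NormedSpace ℝ E] [MeasurableSpace E]
variable {S : Scheme E} {ω : ℝ → ℝ} {ζ e : ℤ → E} {q₁ q₂ : ℤ → ℝ} {c₁ c₂ : ℤ → E}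

/-- Poles `center k + q₁ k`, `center k + q₂ k` with residues `c₁ k`, `c₂ k` interpolating the
values at the good triples. -/
structure TriplePoles (S : Scheme E) (ω : ℝ → ℝ) (ζ e : ℤ → E) (q₁ q₂ : ℤ → ℝ)
    (c₁ c₂ : ℤ → E) : Prop where
  gt₁ : ∀ k ∈ S.good ζ, -1 < q₁ k
  le₁ : ∀ k ∈ S.good ζ, q₁ k ≤ -(1 / (7 * S.δ⁻¹ ^ 3))
  gt₂ : ∀ k ∈ S.good ζ, 0 < q₂ k
  le₂ : ∀ k ∈ S.good ζ, q₂ k ≤ 1 - 1 / (7 * S.δ⁻¹ ^ 3)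
  ne₁ : ∀ k ∈ S.good ζ, c₁ k ≠ 0
  ne₂ : ∀ k ∈ S.good ζ, c₂ k ≠ 0
  sum : ∀ k ∈ S.good ζ, c₁ k + c₂ k = S.T.α (S.tripleVal ω ζ e k)
  norm₁ : ∀ k ∈ S.good ζ, ‖c₁ k‖ ≤ 42 * (S.δ⁻¹ ^ 3) ^ 2
  norm₂ : ∀ k ∈ S.good ζ, ‖c₂ k‖ ≤ 42 * (S.δ⁻¹ ^ 3) ^ 2
  field : ∀ k ∈ S.good ζ, ∀ z : ℝ, z ≠ q₁ k → z ≠ q₂ k →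
    (z / S.T.den (S.tripleVal ω ζ e k) z) • S.T.α (S.tripleVal ω ζ e k) +
      (1 / S.T.den (S.tripleVal ω ζ e k) z) • S.T.β (S.tripleVal ω ζ e k) =
      (1 / (z - q₁ k)) • c₁ k + (1 / (z - q₂ k)) • c₂ k

theorem weight_center_le_one (hω : AdmissibleWeight S.δ ω) (k : ℤ) :
    (S.tripleWeight ω k).2.1 ≤ 1 := hω.le_one _ (abs_nonneg _)

theorem exists_triplePoles (hω : AdmissibleWeight S.δ ω) (he : ∀ m, ‖e m‖ ≤ S.radius ζ m) :
    ∃ q₁ q₂ c₁ c₂, TriplePoles S ω ζ e q₁ q₂ c₁ c₂ := by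
  have h : ∀ k, ∃ (q₁ q₂ : ℝ) (c₁ c₂ : E), k ∈ S.good ζ →
      -1 ≤ q₁ ∧ q₁ ≤ -(1 / (7 * S.δ⁻¹ ^ 3)) ∧ 0 ≤ q₂ ∧ q₂ ≤ 1 - 1 / (7 * S.δ⁻¹ ^ 3) ∧
      -1 < q₁ ∧ 0 < q₂ ∧ c₁ ≠ 0 ∧ c₂ ≠ 0 ∧ c₁ + c₂ = S.T.α (S.tripleVal ω ζ e k) ∧
      ‖c₁‖ ≤ 42 * (S.δ⁻¹ ^ 3) ^ 2 * (S.tripleWeight ω k).2.1 ∧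
      ‖c₂‖ ≤ 42 * (S.δ⁻¹ ^ 3) ^ 2 * (S.tripleWeight ω k).2.1 ∧
      ∀ z : ℝ, z ≠ q₁ → z ≠ q₂ →
        (z / S.T.den (S.tripleVal ω ζ e k) z) • S.T.α (S.tripleVal ω ζ e k) +
          (1 / S.T.den (S.tripleVal ω ζ e k) z) • S.T.β (S.tripleVal ω ζ e k) =
          (1 / (z - q₁)) • c₁ + (1 / (z - q₂)) • c₂ := by
    intro k
    by_cases hk : k ∈ S.good ζ
    · obtain ⟨q₁, q₂, c₁, c₂, h⟩ := TripleSolver.exists_poles S.one_le_inv_pow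
        (comparable hω k) (nearTriple hω he hk)
      exact ⟨q₁, q₂, c₁, c₂, fun _ => h⟩
    · exact ⟨0, 0, 0, 0, fun h => absurd h hk⟩
  choose q₁ q₂ c₁ c₂ h using h
  have hb : ∀ k, 42 * (S.δ⁻¹ ^ 3) ^ 2 * (S.tripleWeight ω k).2.1 ≤ 42 * (S.δ⁻¹ ^ 3) ^ 2 :=
    fun k => mul_le_of_le_one_right (by positivity) (weight_center_le_one hω k)
  refine ⟨q₁, q₂, c₁, c₂, ?_⟩
  constructor <;> intro k hk <;> obtain ⟨-, a1, -, a2, a3, a4, a5, a6, a7, a8, a9, a10⟩ := h k hk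
  · exact a3
  · exact a1
  · exact a4
  · exact a2
  · exact a5
  · exact a6
  · exact a7
  · exact a8.trans (hb k)
  · exact a9.trans (hb k)
  · exact a10

/-- Indices of poles: regular integers, left and right poles of triples, the two compensators. -/
abbrev PoleIndex : Type := (ℤ ⊕ (ℤ ⊕ ℤ)) ⊕ (ℤ ⊕ ℤ)

open Classical in
/-- The regular integers in the `j`-th block. -/
noncomputable def regularIn (S : Scheme E) (ζ : ℤ → E) (j : ℤ) : Finset ℤ :=
  {m ∈ Finset.Ico (j * S.L) ((j + 1) * S.L) | ¬ S.IsCore ζ m}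

open Classical in
/-- The good cells in the `j`-th block. -/
noncomputable def goodIn (S : Scheme E) (ζ : ℤ → E) (j : ℤ) : Finset ℤ :=
  {k ∈ Finset.Ico (j * S.n) ((j + 1) * S.n) | k ∈ S.good ζ}

/-- The poles in the `j`-th block. -/
noncomputable def poleIn (S : Scheme E) (ζ : ℤ → E) (j : ℤ) : Finset PoleIndex :=
  ((S.regularIn ζ j).disjSum ((S.goodIn ζ j).disjSum (S.goodIn ζ j))).disjSum
    (Finset.disjSum {j} {j})

/-- The integer parts of the poles. -/
def poleFloor (S : Scheme E) : PoleIndex → ℤ :=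
  Sum.elim (Sum.elim id (Sum.elim (fun k => S.center k - 1) S.center))
    (Sum.elim (fun j => j * S.L) fun j => j * S.L)

/-- The positions of the poles. -/
noncomputable def polePt (S : Scheme E) (ζ : ℤ → E) (q₁ q₂ : ℤ → ℝ) : PoleIndex → ℝ :=
  Sum.elim (Sum.elim (fun m => m + S.offset (ζ m))
    (Sum.elim (fun k => S.center k + q₁ k) fun k => S.center k + q₂ k))
    (Sum.elim S.comp fun j => S.comp j + 1 / 4)

/-- The total residue of a block without its compensators. -/
noncomputable def totalRes (S : Scheme E) (ω : ℝ → ℝ) (ζ e : ℤ → E) (j : ℤ) : E :=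
  ∑ m ∈ S.regularIn ζ j, S.residue ω ζ e m + ∑ k ∈ S.goodIn ζ j, S.T.α (S.tripleVal ω ζ e k)

/-- The residues at the poles. -/
noncomputable def poleRes (S : Scheme E) (ω : ℝ → ℝ) (ζ e c₁ c₂ : ℤ → E) : PoleIndex → E :=
  Sum.elim (Sum.elim (S.residue ω ζ e) (Sum.elim c₁ c₂))
    (Sum.elim (fun j => (S.A * blockWeight ω S.L j) • S.T.u.2.1 - S.totalRes ω ζ e j)
      fun j => -((S.A * blockWeight ω S.L j) • S.T.u.2.1))

theorem mem_regularIn {j m : ℤ} : m ∈ S.regularIn ζ j ↔ m / S.L = j ∧ ¬ S.IsCore ζ m := by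
  classical
  unfold regularIn
  rw [Finset.mem_filter]
  refine and_congr_left fun _ => ⟨div_L_of_mem, ?_⟩
  rintro rfl
  obtain ⟨h1, h2⟩ := S.div_L m
  rw [Finset.mem_Ico]
  constructor
  · exact_mod_cast h1
  · have : m + 1 ≤ (m / S.L + 1) * S.L := by exact_mod_cast h2
    linarith

theorem mem_goodIn {j k : ℤ} : k ∈ S.goodIn ζ j ↔ k / S.n = j ∧ k ∈ S.good ζ := by
  classical
  unfold goodIn
  rw [Finset.mem_filter]
  refine and_congr_left fun _ => ⟨div_n_of_mem, ?_⟩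
  rintro rfl
  obtain ⟨h1, h2⟩ := S.div_n k
  rw [Finset.mem_Ico]
  exact ⟨h1, by linarith⟩

theorem center_injective : Function.Injective S.center := by
  intro k k' h
  unfold center at h
  have hH : S.H ≠ 0 := by linarith [S.H_ge]
  have := mul_right_cancel₀ hH h
  linarith

theorem center_close {k k' : ℤ} (h : |S.center k - S.center k'| ≤ 2) : k = k' := by
  by_contra hne
  have e : S.center k - S.center k' = 2 * (k - k') * S.H := by unfold center; ring
  rw [e, abs_mul, abs_mul] at h
  have h1 : 1 ≤ |k - k'| := Int.one_le_abs (sub_ne_zero.2 hne)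
  have h2 : 4 ≤ |S.H| := S.H_ge.trans (le_abs_self _)
  norm_num at h
  nlinarith

theorem pole_floor_mem {j : ℤ} {a : PoleIndex} (ha : a ∈ S.poleIn ζ j) :
    j * S.L ≤ S.poleFloor a ∧ S.poleFloor a + 1 ≤ (j + 1) * S.L := by
  have hL := S.L_pos
  have key : ∀ m : ℤ, m / S.L = j → j * S.L ≤ m ∧ m + 1 ≤ (j + 1) * S.L := by
    rintro m rfl
    obtain ⟨h1, h2⟩ := S.div_L m
    exact ⟨by exact_mod_cast h1, by exact_mod_cast h2⟩
  rcases a with (m | k | k) | (i | i)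
  · simp only [poleIn, Finset.inl_mem_disjSum, mem_regularIn] at ha
    exact key m ha.1
  · simp only [poleIn, Finset.inl_mem_disjSum, Finset.inr_mem_disjSum, mem_goodIn] at ha
    exact key (S.center k - 1) ((block_of_core (k := k) (by simp)).trans ha.1)
  · simp only [poleIn, Finset.inl_mem_disjSum, Finset.inr_mem_disjSum, mem_goodIn] at ha
    exact key (S.center k) ((block_of_core (k := k) (by simp)).trans ha.1)
  all_goals
    simp only [poleIn, Finset.inl_mem_disjSum, Finset.inr_mem_disjSum,
      Finset.mem_singleton] at ha
    subst ha
    simp only [poleFloor, Sum.elim_inr, Sum.elim_inl]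
    constructor <;> linarith

theorem pole_floor (h : TriplePoles S ω ζ e q₁ q₂ c₁ c₂) (h0 : ∀ m, ζ m ≠ 0) {j : ℤ}
    {a : PoleIndex} (ha : a ∈ S.poleIn ζ j) :
    S.poleFloor a < S.polePt ζ q₁ q₂ a ∧
      S.polePt ζ q₁ q₂ a ≤ S.poleFloor a + 1 - 1 / (7 * S.δ⁻¹ ^ 3) := by
  have hR := S.one_le_inv_pow
  have hκ : 1 / (7 * S.δ⁻¹ ^ 3) ≤ 1 / 7 := by
    apply one_div_le_one_div_of_le <;> linarith
  rcases a with (m | k | k) | (i | i)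
  · have := S.offset_pos (h0 m)
    have := S.offset_le (ζ m)
    have := S.η_le
    simp only [poleFloor, polePt, Sum.elim_inl, id]
    constructor <;> linarith
  · simp only [poleIn, Finset.inl_mem_disjSum, Finset.inr_mem_disjSum, mem_goodIn] at ha
    have := h.gt₁ k ha.2
    have := h.le₁ k ha.2
    simp only [poleFloor, polePt, Sum.elim_inl, Sum.elim_inr]
    push_cast
    constructor <;> linarith
  · simp only [poleIn, Finset.inl_mem_disjSum, Finset.inr_mem_disjSum, mem_goodIn] at ha
    have := h.gt₂ k ha.2
    have := h.le₂ k ha.2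
    simp only [poleFloor, polePt, Sum.elim_inl, Sum.elim_inr]
    constructor <;> linarith
  all_goals
    simp only [poleFloor, polePt, Sum.elim_inl, Sum.elim_inr, comp]
    push_cast
    constructor <;> linarith

theorem center_ne_block (k j : ℤ) : S.center k - 1 ≠ j * S.L ∧ S.center k ≠ j * S.L := by
  obtain ⟨h1, h2⟩ := S.center_mem k
  have hH := S.H_cast
  have hL := S.L_ge
  have key : ∀ x : ℤ, |x - S.center k| ≤ 1 → x ≠ j * S.L := by
    rintro x hx rfl
    have h' : |((j * S.L : ℤ) : ℝ) - S.center k| ≤ 1 := by exact_mod_cast hx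
    rw [abs_le] at h'
    have hb := block_of_core hx
    rw [Int.mul_ediv_cancel _ S.L_pos.ne'] at hb
    subst hb
    push_cast at h'
    linarith
  exact ⟨key _ (by simp), key _ (by simp)⟩

theorem pole_sep (h : TriplePoles S ω ζ e q₁ q₂ c₁ c₂) (h0 : ∀ m, ζ m ≠ 0) {i j : ℤ}
    {a b : PoleIndex} (ha : a ∈ S.poleIn ζ i) (hb : b ∈ S.poleIn ζ j) (hab : a ≠ b) :
    1 / (7 * S.δ⁻¹ ^ 3) ≤ |S.polePt ζ q₁ q₂ a - S.polePt ζ q₁ q₂ b| := by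
  have hR := S.one_le_inv_pow
  have hκ : 1 / (7 * S.δ⁻¹ ^ 3) ≤ 1 / 7 := by
    apply one_div_le_one_div_of_le <;> linarith
  obtain ⟨a1, a2⟩ := pole_floor h h0 ha
  obtain ⟨b1, b2⟩ := pole_floor h h0 hb
  rcases lt_trichotomy (S.poleFloor a) (S.poleFloor b) with hlt | heq | hlt
  · have : (S.poleFloor a : ℝ) + 1 ≤ S.poleFloor b := by exact_mod_cast hlt
    rw [abs_of_neg (by linarith [one_div_pos.2 (by linarith : 0 < 7 * S.δ⁻¹ ^ 3)])]
    linarith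
  · have hreg : ∀ {i m k}, m ∈ S.regularIn ζ i → k ∈ S.good ζ →
        m ≠ S.center k - 1 ∧ m ≠ S.center k := by
      intro i m k hm hk
      obtain ⟨k1, k2, -⟩ := isCore_triple hk
      rw [mem_regularIn] at hm
      exact ⟨fun h => hm.2 (h ▸ k1), fun h => hm.2 (h ▸ k2)⟩
    have hcc : ∀ k k', S.center k - 1 ≠ S.center k' := by
      intro k k' hk
      have : k = k' := center_close (by rw [← hk]; norm_num)
      subst this
      linarith
    have hroff : ∀ m : ℤ, 0 ≤ S.offset (ζ m) ∧ S.offset (ζ m) ≤ 1 / 8 := fun m =>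
      ⟨S.offset_nonneg _, (S.offset_le _).trans S.η_le⟩
    have hrc : ∀ m j' : ℤ, m = j' * S.L →
        1 / 7 ≤ |(m : ℝ) + S.offset (ζ m) - S.comp j'| ∧
        1 / 7 ≤ |(m : ℝ) + S.offset (ζ m) - (S.comp j' + 1 / 4)| := by
      rintro m j' hm
      have hm' : (m : ℝ) = j' * S.L := by rw [hm]; push_cast; ring
      obtain ⟨o1, o2⟩ := hroff m
      unfold comp
      rw [hm']
      constructor <;> rw [le_abs] <;> right <;> linarith
    have hinj : ∀ i' j' : ℤ, i' * S.L = j' * S.L → i' = j' := fun i' j' h =>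
      mul_right_cancel₀ S.L_pos.ne' h
    rcases a with (m | k | k) | (i' | i') <;> rcases b with (m' | k' | k') | (j' | j') <;>
      simp only [poleIn, Finset.inl_mem_disjSum, Finset.inr_mem_disjSum] at ha hb <;>
      simp only [poleFloor, Sum.elim_inl, Sum.elim_inr, id] at heq <;>
      simp only [polePt, Sum.elim_inl, Sum.elim_inr]
    · exact absurd (by rw [heq]) hab
    · exact absurd heq (hreg ha (mem_goodIn.1 hb).2).1
    · exact absurd heq (hreg ha (mem_goodIn.1 hb).2).2
    · exact hκ.trans (hrc _ _ heq).1
    · exact hκ.trans (hrc _ _ heq).2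
    · exact absurd heq.symm (hreg hb (mem_goodIn.1 ha).2).1
    · exact absurd (by rw [center_injective (by linarith : S.center k = S.center k')]) hab
    · exact absurd heq (hcc _ _)
    · exact absurd heq (center_ne_block _ _).1
    · exact absurd heq (center_ne_block _ _).1
    · exact absurd heq.symm (hreg hb (mem_goodIn.1 ha).2).2
    · exact absurd heq.symm (hcc _ _)
    · exact absurd (by rw [center_injective heq]) hab
    · exact absurd heq (center_ne_block _ _).2
    · exact absurd heq (center_ne_block _ _).2
    · rw [abs_sub_comm]; exact hκ.trans (hrc _ _ heq.symm).1
    · exact absurd heq.symm (center_ne_block _ _).1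
    · exact absurd heq.symm (center_ne_block _ _).2
    · exact absurd (by rw [hinj _ _ heq]) hab
    · rw [hinj _ _ heq, le_abs]; right; linarith
    · rw [abs_sub_comm]; exact hκ.trans (hrc _ _ heq.symm).2
    · exact absurd heq.symm (center_ne_block _ _).1
    · exact absurd heq.symm (center_ne_block _ _).2
    · rw [hinj _ _ heq, le_abs]; left; linarith
    · exact absurd (by rw [hinj _ _ heq]) hab
  · have : (S.poleFloor b : ℝ) + 1 ≤ S.poleFloor a := by exact_mod_cast hlt
    rw [abs_of_pos (by linarith [one_div_pos.2 (by linarith : 0 < 7 * S.δ⁻¹ ^ 3)])]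
    linarith

theorem residue_factor_le : S.L * (S.η * (1 + S.K)) ≤ 1 / 2 := by
  have hs := S.small
  rw [← L_eq_cast] at hs
  have hL := S.L_ge
  have hH := S.H_cast
  have h1 : 1 / (S.H : ℝ) ≤ 1 := by rw [div_le_one (by linarith)]; linarith
  have hη := S.η_pos
  have hK := S.K_ge
  have hp : 0 ≤ S.L * (S.η * (1 + S.K)) := by positivity
  nlinarith

theorem card_goodIn_le (j : ℤ) : ((S.goodIn ζ j).card : ℝ) ≤ S.n := by
  classical
  rw [← S.card_cells j]
  exact_mod_cast Finset.card_filter_le _ _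

theorem card_regularIn_le (j : ℤ) : ((S.regularIn ζ j).card : ℝ) ≤ S.L := by
  classical
  rw [← S.card_block j]
  exact_mod_cast Finset.card_filter_le _ _

theorem norm_totalRes_le (hω : AdmissibleWeight S.δ ω) (he : ∀ m, ‖e m‖ ≤ S.radius ζ m) (j : ℤ) :
    ‖S.totalRes ω ζ e j‖ ≤ (S.A - 1 / 2) * blockWeight ω S.L j := by
  have hL := S.L_ge
  have hW := blockWeight_pos hω (by linarith : (0 : ℝ) < S.L) j
  have hR := S.one_le_inv_pow
  have hη := S.η_pos
  have hK := S.K_ge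
  have h1 : ‖∑ m ∈ S.regularIn ζ j, S.residue ω ζ e m‖ ≤
      S.L * (S.η * (1 + S.K) * blockWeight ω S.L j) := by
    calc _ ≤ ∑ m ∈ S.regularIn ζ j, S.η * (1 + S.K) * blockWeight ω S.L j := by
          refine norm_sum_le_of_le _ fun m hm => ?_
          have := norm_residue_le hω he m
          rwa [(mem_regularIn.1 hm).1] at this
      _ = (S.regularIn ζ j).card * (S.η * (1 + S.K) * blockWeight ω S.L j) := by simp
      _ ≤ _ := by gcongr; exact card_regularIn_le j
  have h2 : ‖∑ k ∈ S.goodIn ζ j, S.T.α (S.tripleVal ω ζ e k)‖ ≤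
      S.n * (4 * S.δ⁻¹ ^ 3 * blockWeight ω S.L j) := by
    calc _ ≤ ∑ k ∈ S.goodIn ζ j, 4 * S.δ⁻¹ ^ 3 * blockWeight ω S.L j := by
          refine norm_sum_le_of_le _ fun k hk => ?_
          obtain ⟨rfl, hg⟩ := mem_goodIn.1 hk
          refine (TripleSolver.norm_αβ_le hR (comparable hω k) (nearTriple hω he hg)).1.trans ?_
          gcongr
          exact weight_center_le hω k
      _ = (S.goodIn ζ j).card * (4 * S.δ⁻¹ ^ 3 * blockWeight ω S.L j) := by simp
      _ ≤ _ := by gcongr; exact card_goodIn_le j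
  have h3 := S.A_ge
  have h4 := S.residue_factor_le
  calc ‖S.totalRes ω ζ e j‖ ≤ S.L * (S.η * (1 + S.K) * blockWeight ω S.L j) +
        S.n * (4 * S.δ⁻¹ ^ 3 * blockWeight ω S.L j) := norm_add_le_of_le h1 h2
    _ = (S.L * (S.η * (1 + S.K)) + 4 * S.n * S.δ⁻¹ ^ 3) * blockWeight ω S.L j := by ring
    _ ≤ _ := by gcongr; linarith

/-- A bound for the residues. -/
noncomputable def resBound (S : Scheme E) : ℝ := 42 * (S.δ⁻¹ ^ 3) ^ 2 + 3 * S.A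

theorem one_le_A : 1 ≤ S.A := by
  have := S.A_ge
  have := S.one_le_inv_pow
  have := S.n_cast
  nlinarith

theorem norm_poleRes_le (hω : AdmissibleWeight S.δ ω) (he : ∀ m, ‖e m‖ ≤ S.radius ζ m)
    (h : TriplePoles S ω ζ e q₁ q₂ c₁ c₂) {j : ℤ} {a : PoleIndex} (ha : a ∈ S.poleIn ζ j) :
    ‖S.poleRes ω ζ e c₁ c₂ a‖ ≤ S.resBound := by
  have hL := S.L_ge
  have hA := S.one_le_A
  have hu := S.T.norm_u₂
  have hR : 0 ≤ 42 * (S.δ⁻¹ ^ 3) ^ 2 := by positivity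
  have hW1 : ∀ j, blockWeight ω S.L j ≤ 1 :=
    fun j => blockWeight_le_one hω (by linarith : (0 : ℝ) < S.L) j
  have hW0 : ∀ j, 0 < blockWeight ω S.L j :=
    fun j => blockWeight_pos hω (by linarith : (0 : ℝ) < S.L) j
  have hd : ∀ j, ‖(S.A * blockWeight ω S.L j) • S.T.u.2.1‖ ≤ 2 * S.A := by
    intro j
    have := hW0 j
    rw [norm_smul, Real.norm_of_nonneg (by positivity)]
    calc _ ≤ S.A * 1 * 2 := by
          gcongr
          · exact hW1 j
          · linarith
      _ = _ := by ring
  unfold resBound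
  rcases a with (m | k | k) | (i | i) <;>
    simp only [poleIn, Finset.inl_mem_disjSum, Finset.inr_mem_disjSum] at ha <;>
    simp only [poleRes, Sum.elim_inl, Sum.elim_inr]
  · have h1 := norm_residue_le hω he m
    have h2 := S.residue_factor_le
    have h3 := hW0 (m / S.L)
    have h4 := hW1 (m / S.L)
    have hη := S.η_pos
    have hK := S.K_ge
    have h5 : 0 ≤ S.η * (1 + S.K) := by positivity
    nlinarith
  · linarith [h.norm₁ k (mem_goodIn.1 ha).2]
  · linarith [h.norm₂ k (mem_goodIn.1 ha).2]
  · have h1 := norm_totalRes_le hω he i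
    have h2 : (S.A - 1 / 2) * blockWeight ω S.L i ≤ S.A := by nlinarith [hW0 i, hW1 i]
    linarith [hd i, norm_sub_le ((S.A * blockWeight ω S.L i) • S.T.u.2.1) (S.totalRes ω ζ e i)]
  · rw [norm_neg]; linarith [hd i]

theorem poleRes_ne_zero (hω : AdmissibleWeight S.δ ω) (he : ∀ m, ‖e m‖ ≤ S.radius ζ m)
    (h : TriplePoles S ω ζ e q₁ q₂ c₁ c₂) (h0 : ∀ m, ζ m ≠ 0)
    (hv : ∀ m, ¬ S.IsCore ζ m → val ω ζ e m ≠ 0) {j : ℤ} {a : PoleIndex}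
    (ha : a ∈ S.poleIn ζ j) : S.poleRes ω ζ e c₁ c₂ a ≠ 0 := by
  have hL := S.L_ge
  have hA := S.one_le_A
  have hu := S.T.norm_u₂
  have hW0 : ∀ j, 0 < blockWeight ω S.L j :=
    fun j => blockWeight_pos hω (by linarith : (0 : ℝ) < S.L) j
  have hd : ∀ j, S.A * blockWeight ω S.L j ≤ ‖(S.A * blockWeight ω S.L j) • S.T.u.2.1‖ := by
    intro j
    have := hW0 j
    rw [norm_smul, Real.norm_of_nonneg (by positivity)]
    exact le_mul_of_one_le_right (by positivity) hu.1
  rcases a with (m | k | k) | (i | i) <;>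
    simp only [poleIn, Finset.inl_mem_disjSum, Finset.inr_mem_disjSum] at ha <;>
    simp only [poleRes, Sum.elim_inl, Sum.elim_inr]
  · have hm := (mem_regularIn.1 ha).2
    unfold residue
    rw [if_neg hm]
    exact neg_ne_zero.2 (smul_ne_zero (S.offset_pos (h0 m)).ne' (hv m hm))
  · exact h.ne₁ k (mem_goodIn.1 ha).2
  · exact h.ne₂ k (mem_goodIn.1 ha).2
  · intro hz
    have h1 := norm_totalRes_le hω he i
    rw [← sub_eq_zero.1 hz] at h1
    nlinarith [hd i, hW0 i]
  · intro hz
    have := hd i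
    rw [neg_eq_zero.1 hz, norm_zero] at this
    nlinarith [hW0 i]

theorem sum_poleIn {F : Type*} [AddCommMonoid F] (f : PoleIndex → F) (j : ℤ) :
    ∑ a ∈ S.poleIn ζ j, f a = ∑ m ∈ S.regularIn ζ j, f (.inl (.inl m)) +
      (∑ k ∈ S.goodIn ζ j, f (.inl (.inr (.inl k))) +
        ∑ k ∈ S.goodIn ζ j, f (.inl (.inr (.inr k)))) +
      (f (.inr (.inl j)) + f (.inr (.inr j))) := by
  simp [poleIn, Finset.sum_disjSum]

theorem sum_poleRes (h : TriplePoles S ω ζ e q₁ q₂ c₁ c₂) (j : ℤ) :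
    ∑ a ∈ S.poleIn ζ j, S.poleRes ω ζ e c₁ c₂ a = 0 := by
  rw [sum_poleIn]
  simp only [poleRes, Sum.elim_inl, Sum.elim_inr]
  rw [← Finset.sum_add_distrib,
    Finset.sum_congr rfl fun k hk => h.sum k (mem_goodIn.1 hk).2]
  unfold totalRes
  abel

theorem card_regularIn (j : ℤ) :
    ((S.regularIn ζ j).card : ℝ) + 3 * (S.goodIn ζ j).card = S.L := by
  classical
  have hinj1 : Function.Injective fun k => S.center k - 1 := fun k k' h =>
    center_injective (by simpa using h)
  have hinj3 : Function.Injective fun k => S.center k + 1 := fun k k' h =>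
    center_injective (by simpa using h)
  have hcl : ∀ {k k'}, |S.center k - S.center k'| ≤ 2 → k = k' := center_close
  set A₁ := (S.goodIn ζ j).image fun k => S.center k - 1 with hA1
  set A₂ := (S.goodIn ζ j).image S.center with hA2
  set A₃ := (S.goodIn ζ j).image fun k => S.center k + 1 with hA3
  have d12 : Disjoint A₁ A₂ := by
    rw [Finset.disjoint_left]
    simp only [hA1, hA2, Finset.mem_image]
    rintro _ ⟨k, -, rfl⟩ ⟨k', -, h⟩
    have : k = k' := hcl (by rw [h]; norm_num)
    subst this; linarith
  have d123 : Disjoint (A₁ ∪ A₂) A₃ := by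
    rw [Finset.disjoint_left]
    simp only [hA1, hA2, hA3, Finset.mem_image, Finset.mem_union]
    rintro _ (⟨k, -, rfl⟩ | ⟨k, -, rfl⟩) ⟨k', -, h⟩
    · have : k = k' := hcl (by rw [show S.center k = S.center k' + 2 by linarith]; norm_num)
      subst this; linarith
    · have : k = k' := hcl (by rw [← h]; norm_num)
      subst this; linarith
  have hcore : {m ∈ Finset.Ico (j * S.L) ((j + 1) * S.L) | S.IsCore ζ m} = A₁ ∪ A₂ ∪ A₃ := by
    ext m
    have hmem : m ∈ Finset.Ico (j * S.L) ((j + 1) * S.L) ↔ m / S.L = j := by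
      refine ⟨div_L_of_mem, ?_⟩
      rintro rfl
      obtain ⟨h1, h2⟩ := S.div_L m
      rw [Finset.mem_Ico]
      have h2' : m + 1 ≤ (m / S.L + 1) * S.L := by exact_mod_cast h2
      exact ⟨by exact_mod_cast h1, by linarith⟩
    rw [Finset.mem_filter, hmem]
    simp only [hA1, hA2, hA3, Finset.mem_image, Finset.mem_union, mem_goodIn]
    constructor
    · rintro ⟨rfl, k, hk, hmk⟩
      have hb := (block_of_core hmk).symm
      rw [abs_le] at hmk
      have : m = S.center k - 1 ∨ m = S.center k ∨ m = S.center k + 1 := by omega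
      rcases this with h | h | h
      · exact Or.inl (Or.inl ⟨k, ⟨hb, hk⟩, h.symm⟩)
      · exact Or.inl (Or.inr ⟨k, ⟨hb, hk⟩, h.symm⟩)
      · exact Or.inr ⟨k, ⟨hb, hk⟩, h.symm⟩
    · have key : ∀ k, k / S.n = j ∧ k ∈ S.good ζ → |m - S.center k| ≤ 1 →
          m / S.L = j ∧ S.IsCore ζ m := fun k hk hm =>
        ⟨(block_of_core hm).trans hk.1, k, hk.2, hm⟩
      rintro ((⟨k, hk, rfl⟩ | ⟨k, hk, rfl⟩) | ⟨k, hk, rfl⟩)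
      · exact key k hk (by simp)
      · exact key k hk (by simp)
      · exact key k hk (by simp)
  have hcard := Finset.card_filter_add_card_filter_not (s := Finset.Ico (j * S.L) ((j + 1) * S.L))
    (fun m => S.IsCore ζ m)
  rw [hcore, Finset.card_union_of_disjoint d123, Finset.card_union_of_disjoint d12,
    Finset.card_image_of_injective _ hinj1, Finset.card_image_of_injective _ center_injective,
    Finset.card_image_of_injective _ hinj3] at hcard
  have hreg : S.regularIn ζ j =
      {m ∈ Finset.Ico (j * S.L) ((j + 1) * S.L) | ¬ S.IsCore ζ m} := by
    ext m; simp [regularIn]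
  rw [← hreg] at hcard
  rw [← S.card_block j, ← hcard]
  push_cast
  ring

theorem card_poleIn (j : ℤ) : ((S.poleIn ζ j).card : ℝ) = S.L + 2 - (S.goodIn ζ j).card := by
  have := S.card_regularIn (ζ := ζ) j
  simp only [poleIn, Finset.card_disjSum, Finset.card_singleton]
  push_cast
  linarith

theorem blockPoles (ι : E →ₗᵢ[ℝ] ℂ) (hω : AdmissibleWeight S.δ ω)
    (he : ∀ m, ‖e m‖ ≤ S.radius ζ m)
    (h : TriplePoles S ω ζ e q₁ q₂ c₁ c₂) (h0 : ∀ m, ζ m ≠ 0)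
    (hv : ∀ m, ¬ S.IsCore ζ m → val ω ζ e m ≠ 0) :
    BlockPoles S.L (1 / (7 * S.δ⁻¹ ^ 3)) S.resBound (S.L + 2) (S.polePt ζ q₁ q₂)
      (fun a => ι (S.poleRes ω ζ e c₁ c₂ a)) (S.poleIn ζ) where
  one_le := by linarith [S.L_ge]
  c_pos := by have := S.one_le_inv_pow; positivity
  K_nonneg := by unfold resBound; have := S.one_le_A; positivity
  mem j a ha := by
    obtain ⟨a1, a2⟩ := pole_floor h h0 ha
    obtain ⟨b1, b2⟩ := pole_floor_mem ha
    have b1' : (j : ℝ) * S.L ≤ S.poleFloor a := by exact_mod_cast b1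
    have b2' : (S.poleFloor a : ℝ) + 1 ≤ (j + 1) * S.L := by exact_mod_cast b2
    have hR := S.one_le_inv_pow
    have : 0 < 1 / (7 * S.δ⁻¹ ^ 3) := by positivity
    constructor <;> linarith
  sep i j a ha b hb hab := pole_sep h h0 ha hb hab
  ne_zero j a ha := by
    have := poleRes_ne_zero hω he h h0 hv ha
    rwa [Ne, map_eq_zero_iff _ ι.injective]
  bound j a ha := by
    rw [ι.norm_map]; exact norm_poleRes_le hω he h ha
  card_le j := by
    rw [card_poleIn]
    linarith [Nat.cast_nonneg (α := ℝ) (S.goodIn ζ j).card]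
  sum_zero j := by rw [← map_sum, sum_poleRes h, map_zero]

end Scheme

/-! ### The interpolating function -/

namespace Scheme

variable {E : Type*} [NormedAddCommGroup E] [NormedSpace ℝ E] [MeasurableSpace E]
variable {S : Scheme E} {ω : ℝ → ℝ} {ζ e : ℤ → E} {q₁ q₂ : ℤ → ℝ} {c₁ c₂ : ℤ → E}

theorem regular_term (h0 : ∀ m, ζ m ≠ 0) {j m m' : ℤ} (hm' : m' ∈ S.regularIn ζ j) :
    (1 / ((m : ℝ) - (m' + S.offset (ζ m')))) • S.residue ω ζ e m' -
      (1 / ((m : ℝ) - S.comp j)) • S.residue ω ζ e m' =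
      S.kernel ζ m' m • S.residue ω ζ e m' + if m' = m then val ω ζ e m else 0 := by
  obtain ⟨hj, hc⟩ := mem_regularIn.1 hm'
  unfold kernel
  rw [hj]
  split_ifs with h
  · subst h
    have ho := (S.offset_pos (h0 m')).ne'
    have : (1 / ((m' : ℝ) - (m' + S.offset (ζ m')))) • S.residue ω ζ e m' = val ω ζ e m' := by
      unfold residue
      rw [if_neg hc, smul_neg, smul_smul, ← neg_smul]
      have : -(1 / ((m' : ℝ) - (m' + S.offset (ζ m'))) * S.offset (ζ m')) = 1 := by
        rw [sub_add_cancel_left]; field_simp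
      rw [this, one_smul]
    rw [this, zero_sub, neg_smul]
    abel
  · rw [add_zero, sub_smul, sub_add_eq_sub_sub]

theorem triple_term (h : TriplePoles S ω ζ e q₁ q₂ c₁ c₂) (hω : AdmissibleWeight S.δ ω)
    (he : ∀ m, ‖e m‖ ≤ S.radius ζ m) {j k m : ℤ}
    (hk : k ∈ S.goodIn ζ j) :
    (1 / ((m : ℝ) - (S.center k + q₁ k))) • c₁ k + (1 / ((m : ℝ) - (S.center k + q₂ k))) • c₂ k -
      (1 / ((m : ℝ) - S.comp j)) • S.T.α (S.tripleVal ω ζ e k) =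
      S.tripleTerm ω ζ e k m + if |m - S.center k| ≤ 1 then val ω ζ e m else 0 := by
  obtain ⟨hj, hg⟩ := mem_goodIn.1 hk
  have hR := S.one_le_inv_pow
  have hκ : 0 < 1 / (7 * S.δ⁻¹ ^ 3) := by positivity
  have hq1 := h.gt₁ k hg
  have hq1' := h.le₁ k hg
  have hq2 := h.gt₂ k hg
  have hq2' := h.le₂ k hg
  set z : ℤ := m - S.center k with hz
  have hzr : (z : ℝ) = m - S.center k := by rw [hz]; push_cast; ring
  have n1 : (z : ℝ) ≠ q₁ k := by
    intro h
    have a : -1 < z := by exact_mod_cast (by linarith : (-1 : ℝ) < z)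
    have b : z < 0 := by exact_mod_cast (by linarith : (z : ℝ) < 0)
    omega
  have n2 : (z : ℝ) ≠ q₂ k := by
    intro h
    have a : 0 < z := by exact_mod_cast (by linarith : (0 : ℝ) < z)
    have b : z < 1 := by exact_mod_cast (by linarith : (z : ℝ) < 1)
    omega
  have hf := h.field k hg z n1 n2
  have e1 : (m : ℝ) - (S.center k + q₁ k) = z - q₁ k := by rw [hzr]; ring
  have e2 : (m : ℝ) - (S.center k + q₂ k) = z - q₂ k := by rw [hzr]; ring
  rw [e1, e2, ← hf]
  unfold tripleTerm
  rw [if_pos hg, hj]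
  split_ifs with hm
  · obtain ⟨v1, v2, v3⟩ := TripleSolver.eval_nodes (nearTriple hω he hg)
    have hval : ((z : ℝ) / S.T.den (S.tripleVal ω ζ e k) z) • S.T.α (S.tripleVal ω ζ e k) +
      (1 / S.T.den (S.tripleVal ω ζ e k) z) • S.T.β (S.tripleVal ω ζ e k) = val ω ζ e m := by
      rw [abs_le] at hm
      have : z = -1 ∨ z = 0 ∨ z = 1 := by omega
      rcases this with hz1 | hz1 | hz1
      · have : m = S.center k - 1 := by omega
        rw [this, hz1]; push_cast; exact v3
      · have : m = S.center k := by omega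
        rw [this, hz1]; push_cast; exact v2
      · have : m = S.center k + 1 := by omega
        rw [this, hz1]; push_cast; exact v1
    rw [hval]
    abel
  · rw [← hzr, TripleSolver.field, sub_smul]
    have : (z : ℝ) + (S.center k - S.comp j) = m - S.comp j := by rw [hzr]; ring
    rw [this]
    abel

theorem own_term {v : E} (j m : ℤ) :
    (∑ m' ∈ S.regularIn ζ j, if m' = m then v else 0) +
      (∑ k ∈ S.goodIn ζ j, if |m - S.center k| ≤ 1 then v else 0) =
      if m / S.L = j then v else 0 := by
  by_cases hc : S.IsCore ζ m
  · have h1 : (∑ m' ∈ S.regularIn ζ j, if m' = m then v else 0) = 0 := by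
      refine Finset.sum_eq_zero fun m' hm' => if_neg ?_
      rintro rfl
      exact (mem_regularIn.1 hm').2 hc
    obtain ⟨k, hk, hmk⟩ := hc
    have huniq : ∀ k', |m - S.center k'| ≤ 1 → k' = k := by
      intro k' hk'
      refine (center_close (S := S) ?_)
      rw [abs_le] at *
      constructor <;> linarith [hk'.1, hk'.2, hmk.1, hmk.2]
    rw [h1, zero_add]
    have hb := block_of_core hmk
    split_ifs with hj
    · rw [Finset.sum_eq_single k]
      · rw [if_pos hmk]
      · exact fun k' _ hne => if_neg fun h => hne (huniq k' h)
      · intro hn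
        exact absurd (mem_goodIn.2 ⟨hb.symm.trans hj, hk⟩) hn
    · refine Finset.sum_eq_zero fun k' hk' => if_neg fun h => hj ?_
      have := huniq k' h
      subst this
      exact hb.trans (mem_goodIn.1 hk').1
  · have h1 : (∑ k ∈ S.goodIn ζ j, if |m - S.center k| ≤ 1 then v else 0) = 0 :=
      Finset.sum_eq_zero fun k hk => if_neg fun h => hc ⟨k, (mem_goodIn.1 hk).2, h⟩
    rw [h1, add_zero, Finset.sum_ite_eq']
    simp only [mem_regularIn, hc, not_false_iff, and_true]

/-- The values of the block fields at the integers. -/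
theorem block_eval (h : TriplePoles S ω ζ e q₁ q₂ c₁ c₂) (hω : AdmissibleWeight S.δ ω)
    (he : ∀ m, ‖e m‖ ≤ S.radius ζ m) (h0 : ∀ m, ζ m ≠ 0) (j m : ℤ) :
    ∑ a ∈ S.poleIn ζ j, (1 / ((m : ℝ) - S.polePt ζ q₁ q₂ a)) • S.poleRes ω ζ e c₁ c₂ a =
      S.rest ω ζ e j m + if m / S.L = j then val ω ζ e m else 0 := by
  have hsum1 : ∑ m' ∈ Finset.Ico (j * S.L) ((j + 1) * S.L), S.kernel ζ m' m • S.residue ω ζ e m' =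
      ∑ m' ∈ S.regularIn ζ j, S.kernel ζ m' m • S.residue ω ζ e m' := by
    classical
    unfold regularIn
    rw [Finset.sum_filter]
    refine Finset.sum_congr rfl fun m' _ => ?_
    split_ifs with hc
    · unfold residue; rw [if_pos hc, smul_zero]
    · rfl
  have hsum2 : ∑ k ∈ Finset.Ico (j * S.n) ((j + 1) * S.n), S.tripleTerm ω ζ e k m =
      ∑ k ∈ S.goodIn ζ j, S.tripleTerm ω ζ e k m := by
    classical
    unfold goodIn
    rw [Finset.sum_filter]
    refine Finset.sum_congr rfl fun k _ => ?_
    split_ifs with hc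
    · rfl
    · unfold tripleTerm; rw [if_neg hc]
  have r1 := Finset.sum_congr (rfl : S.regularIn ζ j = S.regularIn ζ j) fun m' hm' =>
    regular_term (ω := ω) (e := e) (m := m) h0 hm'
  have r2 := Finset.sum_congr (rfl : S.goodIn ζ j = S.goodIn ζ j) fun k hk =>
    triple_term (m := m) h hω he hk
  rw [Finset.sum_sub_distrib, Finset.sum_add_distrib, ← Finset.smul_sum] at r1
  rw [Finset.sum_sub_distrib, Finset.sum_add_distrib, Finset.sum_add_distrib,
    ← Finset.smul_sum] at r2
  rw [sum_poleIn]
  simp only [polePt, poleRes, Sum.elim_inl, Sum.elim_inr]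
  rw [rest, hsum1, hsum2, ← own_term, dipole, totalRes, mul_sub, sub_smul, smul_sub, smul_add,
    smul_neg, smul_smul, smul_smul, mul_comm (1 / ((m : ℝ) - S.comp j)) (S.A * _),
    mul_comm (1 / ((m : ℝ) - (S.comp j + 1 / 4))) (S.A * _)]
  rw [sub_eq_iff_eq_add] at r1 r2
  rw [r1, r2]
  abel

/-- The deterministic part of the bound for the interpolating function. -/
noncomputable def baseConst (S : Scheme E) : ℝ :=
  (9 * blockSum + 3) * S.resBound * (S.L + 2) + 2 * S.L + (S.L + 2)

theorem sum_goodIn_blocks (a : ℤ) (M : ℕ) :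
    ∑ j ∈ Finset.Ico a (a + M), ((S.goodIn ζ j).card : ℝ) =
      ∑ k ∈ Finset.Ico (a * S.n) ((a + M) * S.n), (S.good ζ).indicator (fun _ => (1 : ℝ)) k := by
  classical
  induction M with
  | zero => simp
  | succ M ih =>
    have h1 : Finset.Ico a (a + (M + 1 : ℕ)) = Finset.Ico a (a + M) ∪ {a + (M : ℤ)} := by
      ext x; simp only [Finset.mem_Ico, Finset.mem_union, Finset.mem_singleton]; push_cast; omega
    have hn : 0 ≤ S.n := by linarith [S.n_pos]
    have h2 : Finset.Ico (a * S.n) ((a + (M + 1 : ℕ)) * S.n) =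
        Finset.Ico (a * S.n) ((a + M) * S.n) ∪
          Finset.Ico ((a + M) * S.n) ((a + M + 1) * S.n) := by
      rw [Finset.Ico_union_Ico_eq_Ico]
      · push_cast; ring_nf
      · nlinarith [Int.natCast_nonneg M]
      · nlinarith
    rw [h1, h2, Finset.sum_union, Finset.sum_union, ih, Finset.sum_singleton]
    · congr 1
      simp only [goodIn, Set.indicator_apply]
      rw [← Finset.sum_filter, Finset.sum_const, nsmul_eq_mul, mul_one]
    · rw [Finset.disjoint_left]
      intro x hx hx'
      rw [Finset.mem_Ico] at hx hx'
      omega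
    · rw [Finset.disjoint_left]
      intro x hx hx'
      rw [Finset.mem_Ico, Finset.mem_singleton] at *
      omega

/-- If the data and the regular values do not vanish, and the good cells have the right density,
then there is an interpolating function. -/
theorem hasCauchyInterpolant [CompleteSpace E] (ι : E →ₗᵢ[ℝ] ℂ) (hω : AdmissibleWeight S.δ ω)
    (h0 : ∀ m, ζ m ≠ 0) (hv : ∀ m, ¬ S.IsCore ζ m → val ω ζ (sol hω ζ) m ≠ 0)
    {ε C : ℝ} (hε0 : 0 ≤ ε) (hε1 : ε ≤ 1) (hC : 0 ≤ C)
    (hpos : ∀ M : ℕ, |∑ k ∈ Finset.Ico (0 : ℤ) (M * S.n),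
      (S.good ζ).indicator (fun _ => (1 : ℝ)) k - (ε * S.L + 2) * M| ≤
        C * (1 + (M : ℝ) ^ (2 / 3 : ℝ)))
    (hneg : ∀ M : ℕ, |∑ k ∈ Finset.Ico (-(M * S.n)) (0 : ℤ),
      (S.good ζ).indicator (fun _ => (1 : ℝ)) k - (ε * S.L + 2) * M| ≤
        C * (1 + (M : ℝ) ^ (2 / 3 : ℝ))) :
    HasCauchyInterpolant ε (C + S.baseConst) fun m => ι (ω |(m : ℝ)| • ζ m) := by
  obtain ⟨he, -⟩ := sol_spec hω ζ
  obtain ⟨q₁, q₂, c₁, c₂, h⟩ := exists_triplePoles hω he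
  have hB := blockPoles ι hω he h h0 hv
  obtain ⟨hmer, hset⟩ := hB.poleSet_series
  have hL := S.L_ge
  have hbs := one_le_blockSum
  have hK := hB.K_nonneg
  have hreal : ∀ (m : ℤ) (x : ℝ) (v : E), ι v / ((m : ℂ) - x) = ι ((1 / ((m : ℝ) - x)) • v) := by
    intro m x v
    rw [map_smul, Complex.real_smul]
    push_cast
    ring
  have hcount : ∀ (a : ℤ) (M : ℕ), |∑ k ∈ Finset.Ico (a * S.n) ((a + M) * S.n),
      (S.good ζ).indicator (fun _ => (1 : ℝ)) k - (ε * S.L + 2) * M| ≤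
        C * (1 + (M : ℝ) ^ (2 / 3 : ℝ)) →
      |∑ j ∈ Finset.Ico a (a + M), ((S.poleIn ζ j).card : ℝ) - (1 - ε) * S.L * M| ≤
        C * (1 + (M : ℝ) ^ (2 / 3 : ℝ)) := by
    intro a M hM
    rw [← sum_goodIn_blocks] at hM
    simp only [card_poleIn]
    rw [Finset.sum_sub_distrib, Finset.sum_const, Int.card_Ico, add_sub_cancel_left,
      Int.toNat_natCast, nsmul_eq_mul, ← abs_neg]
    convert hM using 2
    ring
  refine ⟨_, _, hmer, hset, hB.separated, fun m => ⟨?_, ?_⟩, fun z hz => ?_, fun t => ?_⟩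
  · rintro ⟨j, a, ha, hp⟩
    obtain ⟨f1, f2⟩ := pole_floor h h0 ha
    rw [hp] at f1 f2
    have hκ := hB.c_pos
    have g1 : S.poleFloor a < m := by exact_mod_cast f1
    have g2 : m < S.poleFloor a + 1 := by
      exact_mod_cast (by linarith : (m : ℝ) < S.poleFloor a + 1)
    omega
  · have hfield : ∀ j, blockField (S.polePt ζ q₁ q₂)
        (fun a => ι (S.poleRes ω ζ (sol hω ζ) c₁ c₂ a)) (S.poleIn ζ) j (m : ℂ) =
        ι (S.rest ω ζ (sol hω ζ) j m + if m / S.L = j then val ω ζ (sol hω ζ) m else 0) := by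
      intro j
      rw [← block_eval h hω he h0, map_sum]
      exact Finset.sum_congr rfl fun a _ => hreal m _ _
    have hs1 := (summable_rest (S := S) hω he m).hasSum
    have hs2 : HasSum (fun j => if m / S.L = j then val ω ζ (sol hω ζ) m else 0)
        (val ω ζ (sol hω ζ) m) := by
      have := hasSum_ite_eq (m / S.L) (val ω ζ (sol hω ζ) m)
      simpa only [eq_comm] using this
    have hs := (hs1.add hs2).mapL ι.toContinuousLinearMap
    rw [add_comm, sol_eq] at hs
    unfold poleSeries
    simp only [hfield]
    exact hs.tsum_eq
  · rw [hset] at hz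
    refine (hB.norm_series_le hz).trans ?_
    have : 0 ≤ Metric.infDist z (Complex.ofReal '' blockPoleSet (S.polePt ζ q₁ q₂) (S.poleIn ζ)) :=
      Metric.infDist_nonneg
    gcongr
    unfold baseConst
    linarith
  · refine (hB.counting_le hε0 hε1 hC (fun M => ?_) (fun M => ?_) t).trans ?_
    · have := hcount 0 M (by simpa using hpos M)
      simpa using this
    · have := hcount (-M) M (by simpa using hneg M)
      simpa using this
    · have : 0 ≤ (9 * blockSum + 3) * S.resBound * (S.L + 2) := by positivity
      refine mul_le_mul_of_nonneg_right ?_ (by positivity)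
      unfold baseConst
      linarith

end Scheme

/-! ### Almost sure nonvanishing -/

section Product

variable {E : Type*} [MeasurableSpace E] {ν : Measure E} [IsProbabilityMeasure ν]

theorem indepFun_update [Zero E] (m : ℤ) : IndepFun (fun ζ : ℤ → E => ζ m)
    (fun ζ : ℤ → E => Function.update ζ m 0) (Measure.infinitePi fun _ => ν) := by
  have h : iIndepFun (fun (i : ℤ) (ζ : ℤ → E) => ζ i) (Measure.infinitePi fun _ => ν) :=
    iIndepFun_infinitePi (X := fun _ x => x) fun _ => measurable_id
  have hI := indep_iSup_of_disjoint (m := fun i : ℤ =>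
    MeasurableSpace.comap (fun ζ : ℤ → E => ζ i) inferInstance)
    (fun i => (measurable_pi_apply i).comap_le) h.iIndep
    (disjoint_compl_right (a := ({m} : Set ℤ)))
  refine indep_of_indep_of_le_left (indep_of_indep_of_le_right hI ?_) ?_
  · refine Measurable.comap_le ?_
    refine @measurable_pi_lambda _ _ _ (⨆ i ∈ ({m} : Set ℤ)ᶜ,
      MeasurableSpace.comap (fun ζ : ℤ → E => ζ i) inferInstance) _ _ fun i => ?_
    by_cases hi : i = m
    · subst hi
      simp only [Function.update_self]
      exact measurable_const
    · simp only [Function.update_of_ne hi]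
      exact (comap_measurable _).mono (le_iSup₂_of_le i hi le_rfl) le_rfl
  · exact le_iSup₂_of_le (f := fun (i : ℤ) (_ : i ∈ ({m} : Set ℤ)) =>
      MeasurableSpace.comap (fun ζ : ℤ → E => ζ i) inferInstance) m rfl le_rfl

theorem ae_ne_of_update [Zero E] [MeasurableSingletonClass E] [MeasurableEq E]
    [NullSingletonClass ν] {g : (ℤ → E) → E}
    (hg : Measurable g) (m : ℤ) :
    ∀ᵐ ζ ∂(Measure.infinitePi fun _ : ℤ => ν), ζ m ≠ g (Function.update ζ m 0) := by
  have hup : Measurable fun ζ : ℤ → E => Function.update ζ m 0 := by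
    refine measurable_pi_lambda _ fun i => ?_
    by_cases hi : i = m
    · subst hi; simp only [Function.update_self]; exact measurable_const
    · simp only [Function.update_of_ne hi]; exact measurable_pi_apply i
  have hgu : Measurable fun ζ : ℤ → E => g (Function.update ζ m 0) := hg.comp hup
  have hind : IndepFun (fun ζ : ℤ → E => g (Function.update ζ m 0)) (fun ζ : ℤ → E => ζ m)
      (Measure.infinitePi fun _ => ν) :=
    (indepFun_update (ν := ν) m).symm.comp hg measurable_id
  have hprod := (indepFun_iff_map_prod_eq_prod_map_map hgu.aemeasurable
    (measurable_pi_apply m).aemeasurable).1 hind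
  rw [Measure.infinitePi_map_eval] at hprod
  have hdiag : MeasurableSet {y : E × E | y.1 = y.2} := measurableSet_eq_fun measurable_fst
    measurable_snd
  have hnull : ((Measure.infinitePi fun _ : ℤ => ν).map
      fun ζ => g (Function.update ζ m 0)).prod ν {y : E × E | y.1 = y.2} = 0 := by
    rw [Measure.measure_prod_null hdiag]
    refine Filter.Eventually.of_forall fun x => ?_
    have : Prod.mk x ⁻¹' {y : E × E | y.1 = y.2} = {x} := by ext y; simp [eq_comm]
    simp only [this, Pi.zero_apply]
    exact measure_singleton x
  rw [← hprod, Measure.map_apply (hgu.prodMk (measurable_pi_apply m)) hdiag] at hnull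
  rw [ae_iff]
  convert hnull using 2
  ext ζ; simp [eq_comm]

end Product

namespace Scheme

variable {E : Type*} [NormedAddCommGroup E] [NormedSpace ℝ E] [MeasurableSpace E]
  [BorelSpace E] [SecondCountableTopology E] [CompleteSpace E]
variable {S : Scheme E} {ω : ℝ → ℝ} {ν : Measure E} [IsProbabilityMeasure ν]
  [NullSingletonClass ν]

theorem ae_val_ne_zero (hω : AdmissibleWeight S.δ ω) :
    ∀ᵐ ζ ∂(Measure.infinitePi fun _ : ℤ => ν),
      (∀ m, ζ m ≠ 0) ∧ ∀ m, ¬ S.IsCore ζ m → val ω ζ (sol hω ζ) m ≠ 0 := by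
  refine Filter.Eventually.and ?_ ?_ <;> rw [ae_all_iff] <;> intro m
  · exact ae_ne_of_update (g := fun _ => 0) measurable_const m
  · filter_upwards [ae_ne_of_update (ν := ν) (measurable_sol (S := S) hω m).neg m] with ζ hζ hc hv
    refine hζ ?_
    rw [Pi.neg_apply, sol_update hω hc hv]
    have hp := hω.pos |(m : ℝ)| (abs_nonneg _)
    rw [val, smul_eq_zero] at hv
    exact eq_neg_of_add_eq_zero_left (hv.resolve_left hp.ne')

end Scheme

/-! ### A law of large numbers -/

section LargeNumbers

variable {Ω : Type*} [MeasurableSpace Ω] {μ : Measure Ω} [IsProbabilityMeasure μ] {Y : ℕ → Ω → ℝ}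

theorem exp_neg_cbrt_le {N : ℕ} (hN : 0 < N) :
    Real.exp (-2 * (N : ℝ) ^ (1 / 3 : ℝ)) ≤ 12 * (1 / (N : ℝ) ^ 2) := by
  have hN' : (0 : ℝ) < N := by exact_mod_cast hN
  set x : ℝ := (N : ℝ) ^ (1 / 3 : ℝ) with hx
  have hx0 : 0 < x := Real.rpow_pos_of_pos hN' _
  have hx3 : x ^ 3 = N := by
    rw [hx, ← Real.rpow_natCast, ← Real.rpow_mul hN'.le]; norm_num
  have h1 := Real.pow_div_factorial_le_exp (2 * x) (by positivity) 6
  have h2 : (2 * x) ^ 6 / (Nat.factorial 6 : ℝ) = 64 / 720 * (N : ℝ) ^ 2 := by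
    rw [← hx3]; norm_num [Nat.factorial]; ring
  rw [h2] at h1
  rw [neg_mul, Real.exp_neg, inv_le_comm₀ (Real.exp_pos _) (by positivity)]
  refine le_trans ?_ h1
  rw [one_div, mul_inv, inv_inv]
  gcongr
  norm_num

theorem measure_centered_sum_ge (hind : iIndepFun Y μ) (hm : ∀ i, Measurable (Y i))
    (hb : ∀ i x, Y i x ∈ Set.Icc (0 : ℝ) 1) {N : ℕ} (hN : 0 < N) :
    μ {x | (N : ℝ) ^ (2 / 3 : ℝ) ≤ |∑ i ∈ Finset.range N, (Y i x - μ[Y i])|} ≤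
      ENNReal.ofReal (24 * (1 / (N : ℝ) ^ 2)) := by
  have hN' : (0 : ℝ) < N := by exact_mod_cast hN
  have hsub : ∀ i, HasSubgaussianMGF (fun x => Y i x - μ[Y i]) ((‖(1 : ℝ) - 0‖₊ / 2) ^ 2) μ :=
    fun i => hasSubgaussianMGF_of_mem_Icc (hm i).aemeasurable (Filter.Eventually.of_forall (hb i))
  have hind1 : iIndepFun (fun i x => Y i x - μ[Y i]) μ :=
    hind.comp (fun i y => y - ∫ x, Y i x ∂μ) fun i => measurable_id.sub_const _
  have hind2 : iIndepFun (fun i x => -(Y i x - μ[Y i])) μ :=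
    hind.comp (fun i y => -(y - ∫ x, Y i x ∂μ)) fun i => (measurable_id.sub_const _).neg
  have h1 := HasSubgaussianMGF.measure_sum_range_ge_le_of_iIndepFun hind1 (n := N)
    (fun i _ => hsub i) (ε := (N : ℝ) ^ (2 / 3 : ℝ)) (by positivity)
  have h2 := HasSubgaussianMGF.measure_sum_range_ge_le_of_iIndepFun hind2 (n := N)
    (fun i _ => (hsub i).neg) (ε := (N : ℝ) ^ (2 / 3 : ℝ)) (by positivity)
  have hexp : -((N : ℝ) ^ (2 / 3 : ℝ)) ^ 2 /
      (2 * N * (((‖(1 : ℝ) - 0‖₊ / 2) ^ 2 : NNReal) : ℝ)) = -2 * (N : ℝ) ^ (1 / 3 : ℝ) := by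
    have e : ((N : ℝ) ^ (2 / 3 : ℝ)) ^ 2 = N * (N : ℝ) ^ (1 / 3 : ℝ) := by
      rw [← Real.rpow_natCast, ← Real.rpow_mul hN'.le]
      nth_rw 2 [← Real.rpow_one (N : ℝ)]
      rw [← Real.rpow_add hN']; norm_num
    rw [e]
    push_cast
    norm_num
    field_simp
    norm_num
  rw [hexp] at h1 h2
  have h3 := exp_neg_cbrt_le hN
  have hsubset : {x | (N : ℝ) ^ (2 / 3 : ℝ) ≤ |∑ i ∈ Finset.range N, (Y i x - μ[Y i])|} ⊆
      {x | (N : ℝ) ^ (2 / 3 : ℝ) ≤ ∑ i ∈ Finset.range N, (Y i x - μ[Y i])} ∪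
      {x | (N : ℝ) ^ (2 / 3 : ℝ) ≤ ∑ i ∈ Finset.range N, -(Y i x - μ[Y i])} := by
    intro x hx
    rw [Set.mem_ofPred_eq, le_abs, ← Finset.sum_neg_distrib] at hx
    exact hx
  have h4 : μ.real {x | (N : ℝ) ^ (2 / 3 : ℝ) ≤ |∑ i ∈ Finset.range N, (Y i x - μ[Y i])|} ≤
      24 * (1 / (N : ℝ) ^ 2) := by
    refine (measureReal_mono hsubset).trans ((measureReal_union_le _ _).trans ?_)
    linarith
  rw [← ofReal_measureReal]
  exact ENNReal.ofReal_le_ofReal h4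

/-- Centred sums of bounded independent variables are almost surely `O(N ^ (2 / 3))`. -/
theorem ae_centered_sum_le (hind : iIndepFun Y μ) (hm : ∀ i, Measurable (Y i))
    (hb : ∀ i x, Y i x ∈ Set.Icc (0 : ℝ) 1) :
    ∀ᵐ x ∂μ, ∃ C : ℝ, 0 ≤ C ∧ ∀ N : ℕ, |∑ i ∈ Finset.range N, (Y i x - μ[Y i])| ≤
      C * (1 + (N : ℝ) ^ (2 / 3 : ℝ)) := by
  have hsum : ∑' N : ℕ, μ {x | ((N + 1 : ℕ) : ℝ) ^ (2 / 3 : ℝ) ≤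
      |∑ i ∈ Finset.range (N + 1), (Y i x - μ[Y i])|} ≠ ⊤ := by
    have hs : Summable fun N : ℕ => 24 * (1 / ((N + 1 : ℕ) : ℝ) ^ 2) :=
      ((summable_nat_add_iff 1).2 (Real.summable_one_div_nat_pow.2 (by norm_num))).mul_left 24
    refine ne_top_of_le_ne_top hs.tsum_ofReal_ne_top ?_
    exact ENNReal.tsum_le_tsum fun N => measure_centered_sum_ge hind hm hb N.succ_pos
  filter_upwards [ae_eventually_notMem hsum] with x hx
  obtain ⟨N₀, hN₀⟩ := Filter.eventually_atTop.1 hx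
  refine ⟨N₀ + 1, by positivity, fun N => ?_⟩
  have hp : 0 ≤ (N : ℝ) ^ (2 / 3 : ℝ) := by positivity
  rcases le_or_gt N N₀ with h | h
  · have hint : ∀ i, μ[Y i] ∈ Set.Icc (0 : ℝ) 1 := fun i =>
      ⟨integral_nonneg fun x => (hb i x).1, by
        have : μ[Y i] ≤ ∫ _, (1 : ℝ) ∂μ := integral_mono
          (Integrable.of_mem_Icc 0 1 (hm i).aemeasurable (Filter.Eventually.of_forall (hb i)))
          (integrable_const _) fun x => (hb i x).2
        simpa using this⟩
    have h1 : |∑ i ∈ Finset.range N, (Y i x - μ[Y i])| ≤ ∑ i ∈ Finset.range N, (1 : ℝ) := by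
      refine (Finset.abs_sum_le_sum_abs _ _).trans (Finset.sum_le_sum fun i _ => ?_)
      rw [abs_le]
      constructor <;> linarith [(hb i x).1, (hb i x).2, (hint i).1, (hint i).2]
    rw [Finset.sum_const, Finset.card_range, nsmul_eq_mul, mul_one] at h1
    have h2 : (N : ℝ) ≤ N₀ := by exact_mod_cast h
    nlinarith [Nat.cast_nonneg (α := ℝ) N₀]
  · obtain ⟨M, rfl⟩ : ∃ M, N = M + 1 := ⟨N - 1, by omega⟩
    have := hN₀ M (by omega)
    rw [not_le] at this
    nlinarith [Nat.cast_nonneg (α := ℝ) N₀]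

end LargeNumbers

/-! ### The density of the good cells -/

theorem sum_Ico_nat (f : ℤ → ℝ) (N : ℕ) :
    ∑ k ∈ Finset.Ico (0 : ℤ) N, f k = ∑ i ∈ Finset.range N, f i := by
  induction N with
  | zero => simp
  | succ N ih =>
    have h : Finset.Ico (0 : ℤ) ((N + 1 : ℕ) : ℤ) = insert (N : ℤ) (Finset.Ico (0 : ℤ) N) := by
      ext x; simp only [Finset.mem_Ico, Finset.mem_insert]; push_cast; omega
    rw [h, Finset.sum_insert (by simp), Finset.sum_range_succ, ih, add_comm]

theorem sum_Ico_neg (f : ℤ → ℝ) (N : ℕ) :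
    ∑ k ∈ Finset.Ico (-N : ℤ) 0, f k = ∑ i ∈ Finset.range N, f (-1 - i) := by
  induction N with
  | zero => simp
  | succ N ih =>
    have h : Finset.Ico (-((N + 1 : ℕ) : ℤ)) 0 =
        insert (-1 - (N : ℤ)) (Finset.Ico (-N : ℤ) 0) := by
      ext x; simp only [Finset.mem_Ico, Finset.mem_insert]; push_cast; omega
    rw [h, Finset.sum_insert (by simp), Finset.sum_range_succ, ih, add_comm]

/-- The integers where a Beatty sequence of slope `ρ` jumps, outside the low blocks. -/
def beattySet (ρ : ℝ) (n J : ℤ) : Set ℤ :=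
  {k | ⌊((k : ℝ) + 1) * ρ⌋ ≠ ⌊(k : ℝ) * ρ⌋ ∧ J ≤ blockHeight (k / n)}

theorem sum_beatty {ρ : ℝ} (h0 : 0 ≤ ρ) (h1 : ρ ≤ 1) (a : ℤ) (N : ℕ) :
    ∑ k ∈ Finset.Ico a (a + N), (if ⌊((k : ℝ) + 1) * ρ⌋ ≠ ⌊(k : ℝ) * ρ⌋ then (1 : ℝ) else 0) =
      ⌊((a : ℝ) + N) * ρ⌋ - ⌊(a : ℝ) * ρ⌋ := by
  induction N with
  | zero => simp
  | succ N ih =>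
    have h : Finset.Ico a (a + ((N + 1 : ℕ) : ℤ)) = insert (a + N) (Finset.Ico a (a + N)) := by
      ext x; simp only [Finset.mem_Ico, Finset.mem_insert]; push_cast; omega
    rw [h, Finset.sum_insert (by simp), ih]
    have hstep : (if ⌊(((a + N : ℤ) : ℝ) + 1) * ρ⌋ ≠ ⌊((a + N : ℤ) : ℝ) * ρ⌋ then (1 : ℝ) else 0) =
        ⌊(((a + N : ℤ) : ℝ) + 1) * ρ⌋ - ⌊((a + N : ℤ) : ℝ) * ρ⌋ := by
      set x : ℝ := ((a + N : ℤ) : ℝ) with hx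
      have l1 : ⌊x * ρ⌋ ≤ ⌊(x + 1) * ρ⌋ := Int.floor_mono (by nlinarith)
      have l2 : ⌊(x + 1) * ρ⌋ ≤ ⌊x * ρ⌋ + 1 := by
        rw [← Int.floor_add_one]; exact Int.floor_mono (by nlinarith)
      split_ifs with hne
      · have : ⌊(x + 1) * ρ⌋ = ⌊x * ρ⌋ + 1 := by omega
        rw [this]; push_cast; ring
      · rw [not_not.1 hne]; ring
    rw [hstep]
    push_cast
    rw [add_assoc (a : ℝ) (N : ℝ) 1]
    ring

theorem low_block {n J k : ℤ} (hn : 1 ≤ n) (h : blockHeight (k / n) < J) :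
    k ∈ Finset.Ico (-(J * n)) (J * n) := by
  have e1 := Int.mul_ediv_add_emod k n
  have e2 := Int.emod_nonneg k (by omega : n ≠ 0)
  have e3 := Int.emod_lt_of_pos k (by omega : 0 < n)
  rw [Finset.mem_Ico]
  unfold blockHeight at h
  have hq : -J ≤ k / n ∧ k / n + 1 ≤ J := by split_ifs at h <;> omega
  constructor
  · nlinarith
  · nlinarith

theorem beatty_density {ρ : ℝ} (h0 : 0 ≤ ρ) (h1 : ρ ≤ 1) {n J : ℤ} (hn : 1 ≤ n) (hJ : 0 ≤ J)
    (a : ℤ) (N : ℕ) :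
    |∑ k ∈ Finset.Ico a (a + N), (beattySet ρ n J).indicator (fun _ => (1 : ℝ)) k - ρ * N| ≤
      1 + 2 * (J * n) := by
  classical
  have hb := sum_beatty h0 h1 a N
  set g : ℤ → ℝ := fun k => if ⌊((k : ℝ) + 1) * ρ⌋ ≠ ⌊(k : ℝ) * ρ⌋ then (1 : ℝ) else 0 with hg
  set lo := Finset.Ico (-(J * n)) (J * n) with hlo
  have hcmp : ∀ k, |(beattySet ρ n J).indicator (fun _ => (1 : ℝ)) k - g k| ≤
      if k ∈ lo then 1 else 0 := by
    intro k
    by_cases hk : J ≤ blockHeight (k / n)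
    · have : (beattySet ρ n J).indicator (fun _ => (1 : ℝ)) k = g k := by
        simp [hg, beattySet, Set.indicator_apply, hk]
      rw [this, sub_self, abs_zero]
      split_ifs <;> norm_num
    · rw [if_pos (low_block hn (not_le.1 hk))]
      have : (beattySet ρ n J).indicator (fun _ => (1 : ℝ)) k = 0 := by
        simp [beattySet, hk]
      rw [this, hg]
      simp only
      split_ifs <;> norm_num
  have hsum : |∑ k ∈ Finset.Ico a (a + N), (beattySet ρ n J).indicator (fun _ => (1 : ℝ)) k -
      ∑ k ∈ Finset.Ico a (a + N), g k| ≤ 2 * (J * n) := by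
    rw [← Finset.sum_sub_distrib]
    calc _ ≤ ∑ k ∈ Finset.Ico a (a + N), if k ∈ lo then (1 : ℝ) else 0 :=
          (Finset.abs_sum_le_sum_abs _ _).trans (Finset.sum_le_sum fun k _ => hcmp k)
      _ = ({k ∈ Finset.Ico a (a + N) | k ∈ lo}.card : ℝ) := by
          rw [← Finset.sum_filter, Finset.sum_const, nsmul_eq_mul, mul_one]
      _ ≤ (lo.card : ℝ) := by
          exact_mod_cast Finset.card_le_card fun k hk => (Finset.mem_filter.1 hk).2
      _ = _ := by
          have : ((lo.card : ℤ) : ℝ) = 2 * (J * n) := by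
            rw [hlo, Int.card_Ico, Int.toNat_of_nonneg (by nlinarith)]; push_cast; ring
          exact_mod_cast this
  rw [hb] at hsum
  have f1 := Int.floor_le (((a : ℝ) + N) * ρ)
  have f2 := Int.lt_floor_add_one (((a : ℝ) + N) * ρ)
  have f3 := Int.floor_le ((a : ℝ) * ρ)
  have f4 := Int.lt_floor_add_one ((a : ℝ) * ρ)
  rw [abs_le] at hsum ⊢
  constructor <;> nlinarith [hsum.1, hsum.2]

namespace Scheme

variable {E : Type*} [NormedAddCommGroup E] [NormedSpace ℝ E] [MeasurableSpace E]
variable {S : Scheme E} {ν : Measure E} [IsProbabilityMeasure ν]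

/-- The data at the nodes of the `k`-th cell. -/
def nodes (S : Scheme E) (k : ℤ) (ζ : ℤ → E) (i : Fin 3) : E := ζ (S.center k - 1 + (i : ℕ))

theorem map_nodes (k : ℤ) : (Measure.infinitePi fun _ : ℤ => ν).map (S.nodes k) =
    Measure.infinitePi fun _ : Fin 3 => ν :=
  Measure.map_infinitePi_infinitePi_of_inj (P := fun _ : ℤ => ν)
    (f := fun i : Fin 3 => S.center k - 1 + (i : ℕ)) fun i j h => by
      ext; simpa using h

theorem measurable_nodes (k : ℤ) : Measurable (S.nodes k) :=
  measurable_pi_lambda _ fun _ => measurable_pi_apply _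

theorem iIndepFun_nodes : iIndepFun S.nodes (Measure.infinitePi fun _ : ℤ => ν) := by
  rw [iIndepFun_iff_map_fun_eq_infinitePi_map measurable_nodes]
  simp only [map_nodes]
  have hinj : Function.Injective fun p : ℤ × Fin 3 => S.center p.1 - 1 + ((p.2 : ℕ) : ℤ) := by
    rintro ⟨k, i⟩ ⟨k', i'⟩ h
    simp only at h
    have h1 := i.2
    have h2 := i'.2
    have hk : k = k' := by
      refine center_close (S := S) ?_
      rw [abs_le]; omega
    subst hk
    have : i = i' := by ext; omega
    rw [this]
  have h1 := Measure.map_infinitePi_infinitePi_of_inj (P := fun _ : ℤ => ν) hinj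
  have hm : Measurable fun (ζ : ℤ → E) (p : ℤ × Fin 3) => ζ (S.center p.1 - 1 + ((p.2 : ℕ) : ℤ)) :=
    measurable_pi_lambda _ fun _ => measurable_pi_apply _
  rw [← Measure.infinitePi_map_curry fun _ _ => ν, ← h1, Measure.map_map (by fun_prop) hm]
  rfl

/-- The neighbourhoods of the model values of a triple. -/
def nodeBall (T : TripleSolver E) : Fin 3 → Set E :=
  ![Metric.closedBall T.u.1 (1 / 32), Metric.closedBall T.u.2.1 (1 / 32),
    Metric.closedBall T.u.2.2 (1 / 32)]

/-- The probability that a triple is close to the model. -/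
noncomputable def tripleProb (T : TripleSolver E) (ν : Measure E) : ℝ :=
  ∏ i, ν.real (nodeBall T i)

open Classical in
/-- Whether the `k`-th cell is good, as a function of the data at its nodes. -/
noncomputable def goodFun (S : Scheme E) (k : ℤ) (v : Fin 3 → E) : ℝ :=
  if k ∈ S.allowed then (Set.univ.pi (nodeBall S.T)).indicator (fun _ => 1) v else 0

theorem goodFun_nodes (k : ℤ) (ζ : ℤ → E) :
    S.goodFun k (S.nodes k ζ) = (S.good ζ).indicator (fun _ => 1) k := by
  have h : k ∈ S.good ζ ↔ k ∈ S.allowed ∧ S.nodes k ζ ∈ Set.univ.pi (nodeBall S.T) := by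
    have e0 : S.center k - 1 + ((0 : Fin 3) : ℕ) = S.center k - 1 := by simp
    have e1 : S.center k - 1 + ((1 : Fin 3) : ℕ) = S.center k := by simp
    have e2 : S.center k - 1 + ((2 : Fin 3) : ℕ) = S.center k + 1 := by
      rw [show ((2 : Fin 3) : ℕ) = 2 from rfl]; push_cast; ring
    rw [Set.mem_univ_pi, Fin.forall_fin_succ, Fin.forall_fin_two]
    change _ ↔ _ ∧ (ζ (S.center k - 1 + ((0 : Fin 3) : ℕ)) ∈ Metric.closedBall S.T.u.1 (1 / 32) ∧
      ζ (S.center k - 1 + ((1 : Fin 3) : ℕ)) ∈ Metric.closedBall S.T.u.2.1 (1 / 32) ∧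
      ζ (S.center k - 1 + ((2 : Fin 3) : ℕ)) ∈ Metric.closedBall S.T.u.2.2 (1 / 32))
    rw [e0, e1, e2, mem_closedBall_iff_norm, mem_closedBall_iff_norm, mem_closedBall_iff_norm]
    rfl
  classical
  rw [Set.indicator_apply, goodFun, Set.indicator_apply]
  by_cases ha : k ∈ S.allowed
  · rw [if_pos ha]
    exact if_congr (by rw [h]; simp [ha]) rfl rfl
  · rw [if_neg ha, if_neg fun hk => ha (h.1 hk).1]

theorem goodFun_mem (k : ℤ) (v : Fin 3 → E) : S.goodFun k v ∈ Set.Icc (0 : ℝ) 1 := by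
  unfold goodFun
  split_ifs
  · by_cases h : v ∈ Set.univ.pi (nodeBall S.T) <;> simp [h]
  · simp

theorem tripleProb_le_one (T : TripleSolver E) : tripleProb T ν ≤ 1 :=
  Finset.prod_le_one (fun _ _ => measureReal_nonneg) fun _ _ => measureReal_le_one

theorem tripleProb_nonneg {ν : Measure E} (T : TripleSolver E) : 0 ≤ tripleProb T ν :=
  Finset.prod_nonneg fun _ _ => measureReal_nonneg

variable [BorelSpace E]

theorem measurableSet_nodeBall (T : TripleSolver E) (i : Fin 3) :
    MeasurableSet (nodeBall T i) := by
  fin_cases i <;> exact measurableSet_closedBall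

theorem measurableSet_pi_nodeBall (T : TripleSolver E) :
    MeasurableSet (Set.univ.pi (nodeBall T)) :=
  MeasurableSet.univ_pi (measurableSet_nodeBall T)

theorem measurable_goodFun (k : ℤ) : Measurable (S.goodFun k) := by
  unfold goodFun
  split_ifs
  · exact measurable_const.indicator (measurableSet_pi_nodeBall S.T)
  · exact measurable_const

theorem integral_goodFun (k : ℤ) :
    ∫ ζ, S.goodFun k (S.nodes k ζ) ∂(Measure.infinitePi fun _ : ℤ => ν) =
      tripleProb S.T ν * S.allowed.indicator (fun _ => 1) k := by
  classical
  by_cases ha : k ∈ S.allowed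
  · rw [Set.indicator_of_mem ha, mul_one]
    simp only [goodFun, if_pos ha]
    rw [← integral_map (φ := S.nodes k)
      (f := (Set.univ.pi (nodeBall S.T)).indicator fun _ => (1 : ℝ))
      (measurable_nodes k).aemeasurable
      (measurable_const.indicator (measurableSet_pi_nodeBall S.T)).aestronglyMeasurable,
      map_nodes, Measure.infinitePi_eq_pi]
    have := integral_indicator_one (μ := Measure.pi fun _ : Fin 3 => ν)
      (measurableSet_pi_nodeBall S.T)
    refine Eq.trans this ?_
    rw [measureReal_def, Measure.pi_pi, ENNReal.toReal_prod]
    rfl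
  · simp [goodFun, ha]

/-- Along an injective sequence of cells, the good ones have the expected density. -/
theorem ae_good_sum (f : ℕ → ℤ) (hf : Function.Injective f) :
    ∀ᵐ ζ ∂(Measure.infinitePi fun _ : ℤ => ν), ∃ C : ℝ, 0 ≤ C ∧ ∀ N : ℕ,
      |∑ i ∈ Finset.range N, (S.good ζ).indicator (fun _ => (1 : ℝ)) (f i) -
        tripleProb S.T ν * ∑ i ∈ Finset.range N, S.allowed.indicator (fun _ => (1 : ℝ)) (f i)| ≤
      C * (1 + (N : ℝ) ^ (2 / 3 : ℝ)) := by
  have hind : iIndepFun (fun i ζ => S.goodFun (f i) (S.nodes (f i) ζ))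
      (Measure.infinitePi fun _ : ℤ => ν) :=
    ((iIndepFun_nodes (S := S) (ν := ν)).precomp hf).comp (fun i => S.goodFun (f i))
      fun i => measurable_goodFun _
  filter_upwards [ae_centered_sum_le hind
    (fun i => (measurable_goodFun _).comp (measurable_nodes _)) fun i ζ => goodFun_mem _ _]
    with ζ ⟨C, hC, h⟩
  refine ⟨C, hC, fun N => ?_⟩
  have := h N
  simp only [integral_goodFun] at this
  simp only [goodFun_nodes] at this
  rwa [Finset.sum_sub_distrib, ← Finset.mul_sum] at this

theorem ae_good_density {ρ : ℝ} (h0 : 0 ≤ ρ) (h1 : ρ ≤ 1)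
    (hS : S.allowed = beattySet ρ S.n S.J) :
    ∀ᵐ ζ ∂(Measure.infinitePi fun _ : ℤ => ν), ∃ C : ℝ, 0 ≤ C ∧
      (∀ M : ℕ, |∑ k ∈ Finset.Ico (0 : ℤ) (M * S.n),
        (S.good ζ).indicator (fun _ => (1 : ℝ)) k - S.n * (tripleProb S.T ν * ρ) * M| ≤
          C * (1 + (M : ℝ) ^ (2 / 3 : ℝ))) ∧
      (∀ M : ℕ, |∑ k ∈ Finset.Ico (-(M * S.n)) (0 : ℤ),
        (S.good ζ).indicator (fun _ => (1 : ℝ)) k - S.n * (tripleProb S.T ν * ρ) * M| ≤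
          C * (1 + (M : ℝ) ^ (2 / 3 : ℝ))) := by
  have hn := S.n_pos
  have hnr := S.n_cast
  have hJ := S.J_nonneg
  obtain ⟨n, hn'⟩ := Int.eq_ofNat_of_zero_le (by omega : 0 ≤ S.n)
  have hn'' : (S.n : ℝ) = n := by rw [hn']; simp
  have hJr : (0 : ℝ) ≤ S.J := by exact_mod_cast hJ
  set p := tripleProb S.T ν with hp
  have hp0 : 0 ≤ p := tripleProb_nonneg _
  have hp1 : p ≤ 1 := tripleProb_le_one _
  filter_upwards [ae_good_sum (S := S) (ν := ν) (fun i : ℕ => (i : ℤ)) Nat.cast_injective,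
    ae_good_sum (S := S) (ν := ν) (fun i : ℕ => (-1 - i : ℤ)) fun i j h => by simpa using h]
    with ζ ⟨C₁, hC1, k1⟩ ⟨C₂, hC2, k2⟩
  have key : ∀ (C G B : ℝ) (M : ℕ), 0 ≤ C → C ≤ C₁ + C₂ →
      |G - p * B| ≤ C * (1 + ((M * n : ℕ) : ℝ) ^ (2 / 3 : ℝ)) →
      |B - ρ * (M * n : ℕ)| ≤ 1 + 2 * (S.J * S.n) →
      |G - S.n * (p * ρ) * M| ≤
        ((C₁ + C₂) * S.n + (1 + 2 * (S.J * S.n))) * (1 + (M : ℝ) ^ (2 / 3 : ℝ)) := by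
    intro C G B M hC hle hG hB
    have hM : 0 ≤ (M : ℝ) ^ (2 / 3 : ℝ) := by positivity
    have e1 : G - S.n * (p * ρ) * M = (G - p * B) + p * (B - ρ * (M * n : ℕ)) := by
      rw [hn'']; push_cast; ring
    have e2 : ((M * n : ℕ) : ℝ) ^ (2 / 3 : ℝ) ≤ S.n * (M : ℝ) ^ (2 / 3 : ℝ) := by
      push_cast
      rw [Real.mul_rpow (by positivity) (by positivity), ← hn'', mul_comm]
      gcongr
      calc (S.n : ℝ) ^ (2 / 3 : ℝ) ≤ (S.n : ℝ) ^ (1 : ℝ) :=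
            Real.rpow_le_rpow_of_exponent_le hnr (by norm_num)
        _ = S.n := Real.rpow_one _
    have e3 : 1 + ((M * n : ℕ) : ℝ) ^ (2 / 3 : ℝ) ≤ S.n * (1 + (M : ℝ) ^ (2 / 3 : ℝ)) := by
      linarith
    have hJn : (0 : ℝ) ≤ S.J * S.n := by positivity
    calc |G - S.n * (p * ρ) * M| ≤ |G - p * B| + p * |B - ρ * (M * n : ℕ)| := by
          rw [e1]
          refine (abs_add_le _ _).trans ?_
          rw [abs_mul, abs_of_nonneg hp0]
      _ ≤ (C₁ + C₂) * (S.n * (1 + (M : ℝ) ^ (2 / 3 : ℝ))) + 1 * (1 + 2 * (S.J * S.n)) := by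
          refine add_le_add (hG.trans ?_) ?_
          · gcongr
          · gcongr
      _ ≤ _ := by nlinarith
  refine ⟨(C₁ + C₂) * S.n + (1 + 2 * (S.J * S.n)), by positivity, fun M => ?_, fun M => ?_⟩
  · have hB := beatty_density h0 h1 hn hJ 0 (M * n)
    rw [← hS, zero_add] at hB
    rw [hn']
    have hG := k1 (M * n)
    rw [← sum_Ico_nat, ← sum_Ico_nat] at hG
    have := key C₁ _ _ M hC1 (by linarith) hG hB
    simpa [hn'] using this
  · have hB := beatty_density h0 h1 hn hJ (-(M * n : ℕ)) (M * n)
    rw [← hS, neg_add_cancel] at hB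
    have hG := k2 (M * n)
    rw [← sum_Ico_neg, ← sum_Ico_neg fun k => S.allowed.indicator (fun _ => (1 : ℝ)) k] at hG
    have := key C₂ _ _ M hC2 (by linarith) hG hB
    simpa [hn'] using this

end Scheme

/-! ### The choice of the parameters -/

/-- The parameters of a scheme. -/
structure SchemeParams (δ : ℝ) (n H : ℤ) (I : ℕ) (J : ℤ) (A η K : ℝ) : Prop where
  H_ge : 4 ≤ H
  I_pos : 1 ≤ I
  J_nonneg : 0 ≤ J
  η_pos : 0 < η
  η_le : η ≤ 1 / 8
  K_ge : 1 ≤ K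
  A_ge : 4 * n * δ⁻¹ ^ 3 + 1 ≤ A
  small : 64 * (n * (2 * H) : ℝ) ^ 2 * (η * (1 + K)) ≤ 1 / H
  core : (A / (2 * (H / 4) ^ 2) + 1 / H + n * (1014 * δ⁻¹ ^ 3 * (n * (2 * H)) / (H / 4) ^ 2 +
    50 * δ⁻¹ ^ 3 / (H / 4))) * (blockSum * δ⁻¹ ^ I +
      (8 * 2⁻¹ ^ I + 8 / (J + 1)) * (n * (2 * H)) / δ) ≤ 1 / 64
  regular : (A / (2 * (1 / 8) ^ 2) + 1 + n * (1014 * δ⁻¹ ^ 3 * (n * (2 * H)) / (1 / 8) ^ 2 +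
    50 * δ⁻¹ ^ 3 / (1 / 8))) * (blockSum * δ⁻¹ ^ 1 +
      (8 * 2⁻¹ ^ 1 + 8 / 1) * (n * (2 * H)) / δ) ≤ K / 2

theorem exists_schemeParams {δ : ℝ} (h0 : 0 < δ) {n : ℤ} (hn : 1 ≤ n) :
    ∃ H I J A η K, SchemeParams δ n H I J A η K := by
  have hnr : (1 : ℝ) ≤ n := by exact_mod_cast hn
  have hbs := one_le_blockSum
  set R : ℝ := δ⁻¹ ^ 3 with hR
  have hR0 : 0 < R := by positivity
  set A : ℝ := 4 * n * R + 1 with hA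
  have hA0 : 0 < A := by positivity
  set c : ℝ := 8 * A + 1 + n * (32448 * R * n + 200 * R) with hc
  have hc0 : 0 < c := by positivity
  obtain ⟨I, hI1, hI⟩ : ∃ I : ℕ, 1 ≤ I ∧ (2⁻¹ : ℝ) ^ I ≤ δ / (c * 16 * n * 256) := by
    have := (tendsto_pow_atTop_nhds_zero_of_lt_one (by norm_num : (0 : ℝ) ≤ 2⁻¹)
      (by norm_num)).eventually_le_const (show 0 < δ / (c * 16 * n * 256) by positivity)
    obtain ⟨I, h1, h2⟩ := (this.and (Filter.eventually_ge_atTop 1)).exists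
    exact ⟨I, h2, h1⟩
  obtain ⟨H, hH4, hH⟩ : ∃ H : ℤ, 4 ≤ H ∧ 256 * c * (blockSum * δ⁻¹ ^ I) ≤ H := by
    obtain ⟨H, hH⟩ := exists_int_ge (256 * c * (blockSum * δ⁻¹ ^ I))
    exact ⟨max 4 H, le_max_left _ _, hH.trans (by exact_mod_cast le_max_right _ _)⟩
  have hHr : (4 : ℝ) ≤ H := by exact_mod_cast hH4
  have hH0 : (0 : ℝ) < H := by linarith
  obtain ⟨J, hJ0, hJ⟩ : ∃ J : ℤ, 0 ≤ J ∧ c * 16 * n * 256 / δ ≤ J := by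
    obtain ⟨J, hJ⟩ := exists_int_ge (c * 16 * n * 256 / δ)
    exact ⟨max 0 J, le_max_left _ _, hJ.trans (by exact_mod_cast le_max_right _ _)⟩
  have hJr : (0 : ℝ) ≤ J := by exact_mod_cast hJ0
  set D : ℝ := (A / (2 * (1 / 8) ^ 2) + 1 + n * (1014 * R * (n * (2 * H)) / (1 / 8) ^ 2 +
    50 * R / (1 / 8))) * (blockSum * δ⁻¹ ^ 1 +
      (8 * 2⁻¹ ^ 1 + 8 / 1) * (n * (2 * H)) / δ) with hD
  have hD0 : 0 ≤ D := by positivity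
  set K : ℝ := 2 * D + 1 with hK
  set B : ℝ := 64 * (n * (2 * H) : ℝ) ^ 2 * (1 + K) * H with hB
  have hB0 : 0 < B := by positivity
  refine ⟨H, I, J, A, min (1 / 8) (1 / B), K, hH4, hI1, hJ0, by positivity, min_le_left _ _,
    by linarith, le_rfl, ?_, ?_, by linarith⟩
  · calc 64 * (n * (2 * H) : ℝ) ^ 2 * (min (1 / 8) (1 / B) * (1 + K))
        ≤ 64 * (n * (2 * H) : ℝ) ^ 2 * (1 / B * (1 + K)) := by
          gcongr; exact min_le_right _ _
      _ = 1 / (H : ℝ) := by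
          have hK1 : 1 + K ≠ 0 := by positivity
          rw [hB]; field_simp
  · have f1 : A / (2 * (H / 4) ^ 2) + 1 / H + n * (1014 * R * (n * (2 * H)) / (H / 4) ^ 2 +
        50 * R / (H / 4)) ≤ c / H := by
      have e1 : A / (2 * (H / 4 : ℝ) ^ 2) ≤ 8 * A / H := by
        rw [div_le_div_iff₀ (by positivity) hH0]
        nlinarith [mul_pos hA0 hH0, mul_le_mul_of_nonneg_left hHr (mul_pos hA0 hH0).le]
      have e2 : (n : ℝ) * (1014 * R * (n * (2 * H)) / (H / 4) ^ 2 + 50 * R / (H / 4)) =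
          n * (32448 * R * n + 200 * R) / H := by field_simp; ring
      rw [e2, hc, add_div (8 * A + 1), add_div (8 * A)]
      linarith
    have f2 : c / H * (blockSum * δ⁻¹ ^ I) ≤ 1 / 256 := by
      rw [div_mul_eq_mul_div, div_le_iff₀ hH0]; linarith
    have f3 : c / H * (8 * 2⁻¹ ^ I * (n * (2 * H)) / δ) ≤ 1 / 256 := by
      have : c / H * (8 * 2⁻¹ ^ I * (n * (2 * H)) / δ) = c * 16 * n * 2⁻¹ ^ I / δ := by
        field_simp; ring
      rw [this, div_le_iff₀ h0]
      rw [le_div_iff₀ (by positivity)] at hI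
      linarith
    have f4 : c / H * (8 / (J + 1) * (n * (2 * H)) / δ) ≤ 1 / 256 := by
      have : c / H * (8 / (J + 1) * (n * (2 * H)) / δ) = c * 16 * n / δ / (J + 1) := by
        field_simp; ring
      rw [this, div_le_iff₀ (by positivity)]
      have : c * 16 * n * 256 / δ = 256 * (c * 16 * n / δ) := by ring
      linarith
    calc _ ≤ c / H * (blockSum * δ⁻¹ ^ I + (8 * 2⁻¹ ^ I + 8 / (J + 1)) * (n * (2 * H)) / δ) := by
          gcongr
      _ = c / H * (blockSum * δ⁻¹ ^ I) + c / H * (8 * 2⁻¹ ^ I * (n * (2 * H)) / δ) +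
          c / H * (8 / (J + 1) * (n * (2 * H)) / δ) := by ring
      _ ≤ 1 / 64 := by linarith

/-- The scheme with given parameters whose allowed cells are chosen by a Beatty sequence. -/
noncomputable def beattyScheme {E : Type*} [NormedAddCommGroup E] [NormedSpace ℝ E]
    [MeasurableSpace E] (T : TripleSolver E) (ρ : ℝ) {δ : ℝ} (h0 : 0 < δ) (h1 : δ ≤ 1)
    {n H : ℤ} {I : ℕ} {J : ℤ} {A η K : ℝ} (hn : 1 ≤ n) (h : SchemeParams δ n H I J A η K) :
    Scheme E where
  T := T
  δ := δ
  n := n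
  H := H
  I := I
  J := J
  A := A
  η := η
  K := K
  allowed := beattySet ρ n J
  δ_pos := h0
  δ_le := h1
  n_pos := hn
  H_ge := h.H_ge
  I_pos := h.I_pos
  J_nonneg := h.J_nonneg
  η_pos := h.η_pos
  η_le := h.η_le
  K_ge := h.K_ge
  A_ge := h.A_ge
  small := h.small
  core := h.core
  regular := h.regular
  allowed_high := fun _ hk => hk.2

/-! ### Existence of the interpolating function -/

namespace Scheme

theorem tripleProb_pos {E : Type*} [NormedAddCommGroup E] [NormedSpace ℝ E] [MeasurableSpace E]
    {ν : Measure E} [IsProbabilityMeasure ν] [ν.IsOpenPosMeasure] (T : TripleSolver E) : 0 < tripleProb T ν := by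
  refine Finset.prod_pos fun i _ => ?_
  rw [measureReal_def]
  refine ENNReal.toReal_pos ?_ (measure_ne_top _ _)
  fin_cases i <;> exact (Metric.measure_closedBall_pos _ _ (by norm_num)).ne'

variable {E : Type*} [NormedAddCommGroup E] [NormedSpace ℝ E] [MeasurableSpace E]
  [BorelSpace E] [SecondCountableTopology E] [CompleteSpace E]
variable {ν : Measure E} [IsProbabilityMeasure ν] [NullSingletonClass ν]

theorem exists_constant (S : Scheme E) (ι : E →ₗᵢ[ℝ] ℂ) {ρ ε : ℝ} (h0 : 0 ≤ ρ) (h1 : ρ ≤ 1)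
    (hS : S.allowed = beattySet ρ S.n S.J) (hε0 : 0 ≤ ε) (hε1 : ε ≤ 1)
    (hε : ε * S.L + 2 = S.n * (tripleProb S.T ν * ρ)) :
    ∃ C : (ℤ → E) → ℝ, ∀ ω, AdmissibleWeight S.δ ω →
      ∀ᵐ ζ ∂(Measure.infinitePi fun _ : ℤ => ν),
        HasCauchyInterpolant ε (C ζ) fun m => ι (ω |(m : ℝ)| • ζ m) := by
  classical
  have hdens := ae_good_density (S := S) (ν := ν) h0 h1 hS
  rw [← hε] at hdens
  refine ⟨fun ζ => if h : _ then Classical.choose (p := fun C : ℝ => 0 ≤ C ∧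
      (∀ M : ℕ, |∑ k ∈ Finset.Ico (0 : ℤ) (M * S.n),
        (S.good ζ).indicator (fun _ => (1 : ℝ)) k - (ε * S.L + 2) * M| ≤
          C * (1 + (M : ℝ) ^ (2 / 3 : ℝ))) ∧
      (∀ M : ℕ, |∑ k ∈ Finset.Ico (-(M * S.n)) (0 : ℤ),
        (S.good ζ).indicator (fun _ => (1 : ℝ)) k - (ε * S.L + 2) * M| ≤
          C * (1 + (M : ℝ) ^ (2 / 3 : ℝ)))) h + S.baseConst else 0, fun ω hω => ?_⟩
  filter_upwards [hdens, ae_val_ne_zero (S := S) (ν := ν) hω] with ζ hζ hne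
  simp only [dif_pos hζ]
  obtain ⟨hC, hpos, hneg⟩ := Classical.choose_spec hζ
  exact hasCauchyInterpolant ι hω hne.1 hne.2 hε0 hε1 hC hpos hneg

end Scheme

/-! ### Gaussian laws -/

instance isOpenPosMeasure_gaussianReal {v : NNReal} [NeZero v] :
    (gaussianReal 0 v).IsOpenPosMeasure :=
  (gaussianReal_absolutelyContinuous' 0 (NeZero.ne v)).isOpenPosMeasure

instance neZero_half : NeZero (1 / 2 : NNReal) := ⟨by norm_num⟩

/-- The standard complex Gaussian law. -/
noncomputable def complexGaussian : Measure ℂ :=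
  ((gaussianReal 0 (1 / 2)).prod (gaussianReal 0 (1 / 2))).map Complex.measurableEquivRealProd.symm

instance : IsProbabilityMeasure complexGaussian :=
  Measure.isProbabilityMeasure_map Complex.measurableEquivRealProd.symm.measurable.aemeasurable

instance : NullSingletonClass complexGaussian where
  measure_singleton z := by
    have : NullSingletonClass (gaussianReal 0 (1 / 2)) :=
      nullSingletonClass_gaussianReal (by norm_num)
    rw [complexGaussian, MeasurableEquiv.map_apply]
    have : (Complex.measurableEquivRealProd.symm : ℝ × ℝ → ℂ) ⁻¹' {z} =
        {Complex.measurableEquivRealProd z} := by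
      ext y
      simp [Complex.ext_iff, Prod.ext_iff]
    rw [this]
    exact measure_singleton _

instance : complexGaussian.IsOpenPosMeasure :=
  Complex.equivRealProdCLM.symm.continuous.isOpenPosMeasure_map
    Complex.equivRealProdCLM.symm.surjective

theorem IsStdComplexGaussian.hasLaw {Ω : Type*} [MeasurableSpace Ω] {P : Measure Ω}
    [IsProbabilityMeasure P] {X : Ω → ℂ} (h : IsStdComplexGaussian X P) :
    HasLaw X complexGaussian P := by
  have hp : AEMeasurable (fun x => ((X x).re, (X x).im)) P :=
    h.re.aemeasurable.prodMk h.im.aemeasurable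
  have hX : X = Complex.measurableEquivRealProd.symm ∘ fun x => ((X x).re, (X x).im) := by
    funext x
    simp
  have hlaw := (indepFun_iff_map_prod_eq_prod_map_map h.re.aemeasurable h.im.aemeasurable).1 h.indep
  rw [h.re.map_eq, h.im.map_eq] at hlaw
  refine ⟨?_, ?_⟩
  · rw [hX]
    exact Complex.measurableEquivRealProd.symm.measurable.comp_aemeasurable hp
  · rw [hX, ← AEMeasurable.map_map_of_aemeasurable
      Complex.measurableEquivRealProd.symm.measurable.aemeasurable hp, hlaw]
    rfl

theorem mainTheorem3 (δ : ℝ) (hδ : 0 < δ) :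
    ∃ ε : ℝ, 0 < ε ∧ ε < 1 ∧
      -- independent standard real Gaussian variables
      (∃ C : (ℤ → ℝ) → ℝ,
        ∀ (Ω : Type*) [MeasurableSpace Ω] (P : Measure Ω) [IsProbabilityMeasure P]
          (ζ : ℤ → Ω → ℝ),
          iIndepFun ζ P → (∀ m, HasLaw (ζ m) (gaussianReal 0 1) P) →
          ∀ ω : ℝ → ℝ, AdmissibleWeight δ ω →
            ∀ᵐ x ∂P, HasCauchyInterpolant ε (C (fun m => ζ m x))
              (fun m => ((ζ m x * ω |(m : ℝ)| : ℝ) : ℂ))) ∧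
      -- independent standard complex Gaussian variables
      (∃ C : (ℤ → ℂ) → ℝ,
        ∀ (Ω : Type*) [MeasurableSpace Ω] (P : Measure Ω) [IsProbabilityMeasure P]
          (ζ : ℤ → Ω → ℂ),
          iIndepFun ζ P → (∀ m, IsStdComplexGaussian (ζ m) P) →
          ∀ ω : ℝ → ℝ, AdmissibleWeight δ ω →
            ∀ᵐ x ∂P, HasCauchyInterpolant ε (C (fun m => ζ m x))
              (fun m => ζ m x * (ω |(m : ℝ)| : ℂ))) := by
  by_cases h1 : δ ≤ 1
  swap
  · refine ⟨1 / 2, by norm_num, by norm_num, ⟨0, fun Ω _ P _ ζ _ _ ω hω => ?_⟩,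
      ⟨0, fun Ω _ P _ ζ _ _ ω hω => ?_⟩⟩ <;> exact absurd hω.delta_le_one h1
  have : NullSingletonClass (gaussianReal 0 1) := nullSingletonClass_gaussianReal (by norm_num)
  set p₁ := Scheme.tripleProb realSolver (gaussianReal 0 1) with hp1
  set p₂ := Scheme.tripleProb complexSolver complexGaussian with hp2
  have hp1p : 0 < p₁ := Scheme.tripleProb_pos _
  have hp2p : 0 < p₂ := Scheme.tripleProb_pos _
  set p := min p₁ p₂ with hp
  have hpp : 0 < p := lt_min hp1p hp2p
  have hple : p ≤ 1 := (min_le_left _ _).trans (Scheme.tripleProb_le_one _)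
  obtain ⟨n, hn, hnp⟩ : ∃ n : ℤ, 1 ≤ n ∧ 3 / p ≤ n := by
    obtain ⟨n, hn⟩ := exists_int_ge (3 / p)
    exact ⟨max 1 n, le_max_left _ _, hn.trans (by exact_mod_cast le_max_right _ _)⟩
  rw [div_le_iff₀ hpp] at hnp
  have hnr : (1 : ℝ) ≤ n := by exact_mod_cast hn
  obtain ⟨H, I, J, A, η, K, hpar⟩ := exists_schemeParams hδ hn
  have hH : (4 : ℝ) ≤ H := by exact_mod_cast hpar.H_ge
  set L : ℝ := n * (2 * H) with hL
  have hL0 : 0 < L := by positivity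
  set ε : ℝ := (n * p - 2) / L with hε
  have hεL : ε * L + 2 = n * p := by rw [hε]; field_simp; ring
  have hε0 : 0 < ε := div_pos (by linarith) hL0
  have hε1 : ε < 1 := by rw [hε, div_lt_one hL0, hL]; nlinarith
  set S₁ := beattyScheme realSolver (p / p₁) hδ h1 hn hpar with hS1
  set S₂ := beattyScheme complexSolver (p / p₂) hδ h1 hn hpar with hS2
  obtain ⟨C₁, hC1⟩ := Scheme.exists_constant (ν := gaussianReal 0 1) S₁ Complex.ofRealLI
    (ρ := p / p₁) (ε := ε) (by positivity) ((div_le_one hp1p).2 (min_le_left _ _)) rfl hε0.le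
    hε1.le (by
      rw [Scheme.L_eq_cast]
      change ε * L + 2 = n * (p₁ * (p / p₁))
      rw [mul_div_cancel₀ _ hp1p.ne', hεL])
  obtain ⟨C₂, hC2⟩ := Scheme.exists_constant (ν := complexGaussian) S₂ LinearIsometry.id
    (ρ := p / p₂) (ε := ε) (by positivity) ((div_le_one hp2p).2 (min_le_right _ _)) rfl hε0.le
    hε1.le (by
      rw [Scheme.L_eq_cast]
      change ε * L + 2 = n * (p₂ * (p / p₂))
      rw [mul_div_cancel₀ _ hp2p.ne', hεL])
  refine ⟨ε, hε0, hε1, ⟨C₁, fun Ω _ P _ ζ hind hlaw ω hω => ?_⟩,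
    ⟨C₂, fun Ω _ P _ ζ hind hlaw ω hω => ?_⟩⟩
  · have hm : AEMeasurable (fun x m => ζ m x) P :=
      aemeasurable_pi_lambda _ fun m => (hlaw m).aemeasurable
    have h := hC1 ω hω
    rw [← (hind.hasLaw_infinitePi hlaw hm).map_eq] at h
    filter_upwards [ae_of_ae_map hm h] with x hx
    convert hx using 2 with m
    simp [mul_comm]
  · have hm : AEMeasurable (fun x m => ζ m x) P :=
      aemeasurable_pi_lambda _ fun m => (hlaw m).hasLaw.aemeasurable
    have h := hC2 ω hω
    rw [← (hind.hasLaw_infinitePi (fun m => (hlaw m).hasLaw) hm).map_eq] at h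
    filter_upwards [ae_of_ae_map hm h] with x hx
    convert hx using 2 with m
    simp [mul_comm]
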